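/- **Setting.** Fix an episode length $T\ge 1$, a discount $\gamma\in\mathbb R$, learning rates $\eta_n\in\mathbb R$ (constant $\eta_n=\eta$ is a special case) and $\alpha>0$. Consider a sequence of problems with $N$ features and batch size $B$ such that $N,B\to\infty$ and $B/N\to\alpha$. The features $\psi(1),\dots,\psi(T+1)\in\mathbb R^N$ along an episode are jointly Gaussian (not necessarily centered), with correlations $\Sigma(t,t')=\langle\psi(t)\psi(t')^\top\rangle$. Rewards, values and predicted values are linear in the features: $R=w_R\cdot\psi/\sqrt N$, $V=w_{TD}\cdot\psi/\sqrt N$, $\hat V_n=w_n\cdot\psi/\sqrt N$. Put $$\bar\Sigma=\tfrac1T\sum_{t=1}^T\Sigma(t,t),\quad \bar\Sigma_+=\tfrac1T\sum_{t=1}^T\Sigma(t,t+1),\quad A=\bar\Sigma-\gamma\bar\Sigma_+,$$ and let $w_{TD}$ satisfy $A\,w_{TD}=\bar\Sigma w_R$ (so $w_{TD}=A^{-1}\bar\Sigma w_R$ when $A$ is invertible). Assume that there is a constant $C$, independent of $N$, bounding the operator norms of all $\Sigma(t,t)$, $1\le t\le T+1$, the second moments $\langle R^2\rangle$ and $\langle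 V^2\rangle$ at each time $t\le T$, and the second moments $\langle\hat V_0^2\rangle$ at each time $t\le T+1$. From a deterministic $w_0$, TD(0) uses at each step $n$ a fresh batch of $B$ independent episodes $\psi_n^\mu$: $$w_{n+1}=w_n+\frac{\eta_n\sqrt N}{BT}\sum_{\mu=1}^B\sum_{t=1}^T\Delta_n^\mu(t)\,\psi_n^\mu(t),\qquad \Delta_n^\mu(t)=\tfrac1{\sqrt N}\big[(w_R-w_n)\cdot\psi_n^\mu(t)+\gamma\, w_n\cdot\psi_n^\mu(t+1)\big].$$ (In terms of $u_n=w_n/\sqrt N$ this is the usual update with step $\eta_n/(BT)$ and $\hat V_n=u_n\cdot\psi$.) **Deterministic theory.** Let $m_0=w_0$, $m_{n+1}=m_n+\eta_nA(w_{TD}-m_n)$ (mean-path dynamics), $M_0=(w_0-w_{TD})(w_0-w_{TD})^\top$ and $$M_{n+1}=(I-\eta_nA)M_n(I-\eta_nA)^\top+\frac{\eta_n^2}{\alpha T^2}\sum_{t,t'=1}^TQ_n(t,t')\Sigma(t,t'),$$ where, with $d=w_R-w_{TD}$ and $f_n=w_{TD}-m_n$, $$\begin{aligned}N\,Q_n(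t,t')={}&\mathrm{Tr}\,M_n\Sigma(t,t')+f_n^\top[\Sigma(t,t')+\Sigma(t,t')^\top]d+d^\top\Sigma(t,t')d-\gamma\,\mathrm{Tr}\,M_n[\Sigma(t,t'+1)+\Sigma(t+1,t')]\\&+\gamma[f_n^\top\Sigma(t,t'+1)w_{TD}+w_{TD}^\top\Sigma(t+1,t')f_n]+\gamma[d^\top\Sigma(t,t'+1)m_n+m_n^\top\Sigma(t+1,t')d]\\&+\gamma^2\mathrm{Tr}\,M_n\Sigma(t+1,t'+1)-\gamma^2f_n^\top[\Sigma(t+1,t'+1)+\Sigma(t+1,t'+1)^\top]w_{TD}+\gamma^2w_{TD}^\top\Sigma(t+1,t'+1)w_{TD}.\end{aligned}$$ **Proposition.** For every fixed $n$: 1. The value error $\mathcal L_n=\frac1T\sum_{t=1}^T\langle(V-\hat V_n)^2\rangle$ (average over a fresh episode at time $t$, given the random $w_n$) satisfies $\mathcal L_n-\frac1N\mathrm{Tr}(\bar\Sigma M_n)\to0$ in $L^1$, hence in probability and in mean. 2. $M_n$ is the weight-error covariance: $(w_n-w_{TD})(w_n-w_{TD})^\top$ has integrable entries, and for all matrices $G=G_N$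 with uniformly bounded operator norm, $\frac1N\mathrm{Tr}\,G\big(\mathbb E[(w_n-w_{TD})(w_n-w_{TD})^\top]-M_n\big)\to0$. 3. $\mathbb E[w_n]=m_n$ exactly (for $B\ge1$). 4. $Q_n$ is the TD-error correlation: for all $t,t'\le T$, $\frac1B\sum_\mu\Delta_n^\mu(t)\Delta_n^\mu(t')-Q_n(t,t')\to0$ in $L^1$, and $\mathbb E[\Delta_n^\mu(t)\Delta_n^\mu(t')]-Q_n(t,t')\to0$ uniformly in $\mu$. 5. $M_n-(m_n-w_{TD})(m_n-w_{TD})^\top$ is positive semidefinite and, with $\langle\cdot\rangle$ the average over Gaussian weights $w$ with mean $m_n$ and this covariance, $$\begin{aligned}Q_n(t,t')=\tfrac1N\big\langle&(w_R-w)^\top\Sigma(t,t')(w_R-w)+\gamma(w_R-w)^\top\Sigma(t,t'+1)w\\&+\gamma w^\top\Sigma(t+1,t')(w_R-w)+\gamma^2w^\top\Sigma(t+1,t'+1)w\big\rangle.\end{aligned}$$ -/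

import Mathlib

open MeasureTheory ProbabilityTheory Filter Topology Matrix

noncomputable section

namespace TDLearning

/-! ### The learner

An episode of length `T` is a tuple `x` of feature vectors `x 0, …, x T` in `ℝ^N`, i.e. the features
`ψ(s_1), …, ψ(s_{T+1})` of the `T` states on which updates are made and of the final successor state.
The episodic time `t = 1, …, T` corresponds to `t : Fin T`; the feature at time `t` is
`x t.castSucc` and the feature at time `t + 1` is `x t.succ`. -/

/-- The linear function `v ↦ (w · v) / √N` of the features. Rewards, values and predicted values
are of this form, so that weights with entries of order one give outputs of order one. -/
def readout {N : ℕ} (w v : Fin N → ℝ) : ℝ := (w ⬝ᵥ v) / √(N : ℝ)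

/-- The TD error `Δ(t) = R(s_t) + γ V̂(s_{t+1}) - V̂(s_t)` with reward weights `wR` and current
weights `w`. -/
def tdError {N T : ℕ} (γ : ℝ) (wR w : Fin N → ℝ) (x : Fin (T + 1) → Fin N → ℝ) (t : Fin T) : ℝ :=
  readout wR (x t.castSucc) + γ * readout w (x t.succ) - readout w (x t.castSucc)

/-- The TD(0) iterates: at step `n` the batch of `B` episodes `ψ n 0, …, ψ n (B - 1)` is used, and
`w_{n+1} = w_n + η_n √N / (B T) ∑_μ ∑_t Δ_n^μ(t) ψ_n^μ(t)`. For `u_n = w_n / √N` this is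
`u_{n+1} = u_n + η_n / (B T) ∑_μ ∑_t Δ_n^μ(t) ψ_n^μ(t)` with `V̂ = u_n · ψ`. -/
def iterate {N T B : ℕ} (γ : ℝ) (η : ℕ → ℝ) (wR w0 : Fin N → ℝ)
    (ψ : ℕ → Fin B → Fin (T + 1) → Fin N → ℝ) : ℕ → Fin N → ℝ
  | 0 => w0
  | n + 1 => iterate γ η wR w0 ψ n +
      (η n * √(N : ℝ) / ((B : ℝ) * (T : ℝ))) • ∑ μ : Fin B, ∑ t : Fin T,
        tdError γ wR (iterate γ η wR w0 ψ n) (ψ n μ) t • ψ n μ t.castSucc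

/-- The value error `⟨(V(s) - V̂(s))²⟩_s` of the weights `w`, for the value function with weights
`wTD`, averaged over the states of an episode with law `P`. -/
def valueError {N T : ℕ} (P : Measure (Fin (T + 1) → Fin N → ℝ)) (wTD w : Fin N → ℝ) : ℝ :=
  (1 / (T : ℝ)) * ∑ t : Fin T,
    ∫ x, (readout wTD (x t.castSucc) - readout w (x t.castSucc)) ^ 2 ∂P

/-! ### Feature correlations -/

/-- The (non-centered) time correlations `Σ(t,t') = ⟨ψ(t) ψ(t')ᵀ⟩` of the features. -/
def corr {N T : ℕ} (P : Measure (Fin (T + 1) → Fin N → ℝ)) (t t' : Fin (T + 1)) :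
    Matrix (Fin N) (Fin N) ℝ :=
  Matrix.of fun i j => ∫ x, x t i * x t' j ∂P

/-- `Σ̄ = (1/T) ∑_t Σ(t,t)`. -/
def sigmaBar {N T : ℕ} (S : Fin (T + 1) → Fin (T + 1) → Matrix (Fin N) (Fin N) ℝ) :
    Matrix (Fin N) (Fin N) ℝ :=
  (1 / (T : ℝ)) • ∑ t : Fin T, S t.castSucc t.castSucc

/-- `Σ̄₊ = (1/T) ∑_t Σ(t,t+1)`. -/
def sigmaBarPlus {N T : ℕ} (S : Fin (T + 1) → Fin (T + 1) → Matrix (Fin N) (Fin N) ℝ) :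
    Matrix (Fin N) (Fin N) ℝ :=
  (1 / (T : ℝ)) • ∑ t : Fin T, S t.castSucc t.succ

/-- `A = Σ̄ - γ Σ̄₊`. -/
def driftMatrix {N T : ℕ} (γ : ℝ) (S : Fin (T + 1) → Fin (T + 1) → Matrix (Fin N) (Fin N) ℝ) :
    Matrix (Fin N) (Fin N) ℝ :=
  sigmaBar S - γ • sigmaBarPlus S

/-! ### The deterministic learning-curve theory -/

/-- The mean-path dynamics `⟨w_{n+1}⟩ = ⟨w_n⟩ + η_n A (w_TD - ⟨w_n⟩)`. -/
def meanWeights {N T : ℕ} (γ : ℝ) (η : ℕ → ℝ)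
    (S : Fin (T + 1) → Fin (T + 1) → Matrix (Fin N) (Fin N) ℝ) (wTD w0 : Fin N → ℝ) :
    ℕ → Fin N → ℝ
  | 0 => w0
  | n + 1 => meanWeights γ η S wTD w0 n +
      η n • (driftMatrix γ S *ᵥ (wTD - meanWeights γ η S wTD w0 n))

/-- The TD-error correlation `Q(t,t')` as an explicit function of the weight-error covariance `M`
and of the mean weights `m`. -/
def tdErrorCorr {N T : ℕ} (γ : ℝ)
    (S : Fin (T + 1) → Fin (T + 1) → Matrix (Fin N) (Fin N) ℝ) (wR wTD : Fin N → ℝ)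
    (M : Matrix (Fin N) (Fin N) ℝ) (m : Fin N → ℝ) (t t' : Fin T) : ℝ :=
  (1 / (N : ℝ)) *
    ((M * S t.castSucc t'.castSucc).trace
      + (wTD - m) ⬝ᵥ ((S t.castSucc t'.castSucc + (S t.castSucc t'.castSucc)ᵀ) *ᵥ (wR - wTD))
      + (wR - wTD) ⬝ᵥ (S t.castSucc t'.castSucc *ᵥ (wR - wTD))
      - γ * (M * (S t.castSucc t'.succ + S t.succ t'.castSucc)).trace
      + γ * ((wTD - m) ⬝ᵥ (S t.castSucc t'.succ *ᵥ wTD)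
          + wTD ⬝ᵥ (S t.succ t'.castSucc *ᵥ (wTD - m)))
      + γ * ((wR - wTD) ⬝ᵥ (S t.castSucc t'.succ *ᵥ m)
          + m ⬝ᵥ (S t.succ t'.castSucc *ᵥ (wR - wTD)))
      + γ ^ 2 * (M * S t.succ t'.succ).trace
      + γ ^ 2 * ((m - wTD) ⬝ᵥ ((S t.succ t'.succ + (S t.succ t'.succ)ᵀ) *ᵥ wTD))
      + γ ^ 2 * (wTD ⬝ᵥ (S t.succ t'.succ *ᵥ wTD)))

/-- The recursion
`M_{n+1} = (I - η_n A) M_n (I - η_n A)ᵀ + η_n² / (α T²) ∑_{t,t'} Q_n(t,t') Σ(t,t')`, where `Q_n` is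
the explicit function of `M_n` and `⟨w_n⟩` above, started at `M_0 = (w_0 - w_TD) (w_0 - w_TD)ᵀ`. -/
def errorCov {N T : ℕ} (γ α : ℝ) (η : ℕ → ℝ)
    (S : Fin (T + 1) → Fin (T + 1) → Matrix (Fin N) (Fin N) ℝ) (wR wTD w0 : Fin N → ℝ) :
    ℕ → Matrix (Fin N) (Fin N) ℝ
  | 0 => vecMulVec (w0 - wTD) (w0 - wTD)
  | n + 1 =>
      (1 - η n • driftMatrix γ S) * errorCov γ α η S wR wTD w0 n * (1 - η n • driftMatrix γ S)ᵀ
      + (η n ^ 2 / (α * (T : ℝ) ^ 2)) • ∑ t : Fin T, ∑ t' : Fin T,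
          tdErrorCorr γ S wR wTD (errorCov γ α η S wR wTD w0 n) (meanWeights γ η S wTD w0 n) t t' •
            S t.castSucc t'.castSucc

/-- `Q_n(t,t')` along the recursion. -/
def theoryQ {N T : ℕ} (γ α : ℝ) (η : ℕ → ℝ)
    (S : Fin (T + 1) → Fin (T + 1) → Matrix (Fin N) (Fin N) ℝ) (wR wTD w0 : Fin N → ℝ)
    (n : ℕ) (t t' : Fin T) : ℝ :=
  tdErrorCorr γ S wR wTD (errorCov γ α η S wR wTD w0 n) (meanWeights γ η S wTD w0 n) t t'

/-- The covariance matrix `M_n - (⟨w_n⟩ - w_TD) (⟨w_n⟩ - w_TD)ᵀ` of the weights. -/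
def weightCov {N T : ℕ} (γ α : ℝ) (η : ℕ → ℝ)
    (S : Fin (T + 1) → Fin (T + 1) → Matrix (Fin N) (Fin N) ℝ) (wR wTD w0 : Fin N → ℝ) (n : ℕ) :
    Matrix (Fin N) (Fin N) ℝ :=
  errorCov γ α η S wR wTD w0 n -
    vecMulVec (meanWeights γ η S wTD w0 n - wTD) (meanWeights γ η S wTD w0 n - wTD)

/-- The Gaussian weight average `⟨·⟩` at step `n`: mean `⟨w_n⟩` and second moment about `w_TD`
equal to `M_n`. -/
def weightGaussian {N T : ℕ} (γ α : ℝ) (η : ℕ → ℝ)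
    (S : Fin (T + 1) → Fin (T + 1) → Matrix (Fin N) (Fin N) ℝ) (wR wTD w0 : Fin N → ℝ) (n : ℕ) :
    Measure (EuclideanSpace ℝ (Fin N)) :=
  multivariateGaussian (WithLp.toLp 2 (meanWeights γ η S wTD w0 n)) (weightCov γ α η S wR wTD w0 n)

end TDLearning

end

/-! Write `w_n = m_n + z_n`. At fixed weights the expected update is affine in the weights with
linear part `-η_n A`, so the fixed-point equation gives `z_{n+1} = L z_n + ξ_n` with `L = I - η_n A`
and a batch noise `ξ_n` that is centered given the past. The formula for the mean weights is
immediate from this. The asymptotic claims rest on one statement, proved by induction on `n`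
(`LearningSequence.quadFormConverges`): for every family `G` of bounded operator norm, `(1/N) z_nᵀ G
z_n - (1/N) Tr (G W_n) → 0` in `L¹`, where `W_n = M_n - (m_n - w_TD)(m_n - w_TD)ᵀ`.

Induction step: expanding `z_{n+1}ᵀ G z_{n+1}` gives three terms. The term `z_nᵀ (Lᵀ G L) z_n` is
covered by the hypothesis, since `Lᵀ G L` is again a bounded family. The cross term is centered
given the past and of order `N^{-1/2}` after normalization. The noise term concentrates around a sum
of `E[Δ(t) Δ(t') | w_n] · (1/N) Tr (G Σ(t,t'))` with prefactor `η_n² N / (B T²)`. The conditional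
correlation is a quadratic polynomial in `z_n`. Its quadratic part is covered by the hypothesis; its
linear part vanishes, because the square of a linear form is a quadratic form with a rank-one matrix
(`QuadFormConverges.tendstoL1_dotProduct`). Hence it converges to `Q_n`, and `N/B → 1/α` produces
the recursion for `W_n` (`weightCov_succ`).

Concentration of the noise: the update of one episode, `Y = ∑_t Δ(t) ψ(t)`, has second moment of
order one in each unit direction, while `|Y|²` is of order `N`. For a sum of `B` independent
centered copies, a martingale argument shows that quadratic forms fluctuate much less than their
mean (`integral_sq_quadForm_sum_le`). The mean of `Yᵀ G Y` factorizes up to `O(√N)`, since `ψ(t')ᵀ G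
ψ(t)` has standard deviation `O(√N)` (`integral_sq_bilin_sub_integral_le`). This comes from an
independent copy: for Gaussian `x, y` with the same law, `x - y` and `x + y` are independent.
Otherwise Gaussianity enters through moment bounds of the type `E X⁸ ≤ κ (E X²)⁴`, so no Wick
expansion is needed.

The Gaussian representation of `Q_n` and the positivity of `W_n` support each other in a separate
induction (`weightCov_posSemidef`). The hypotheses bound outputs rather than weights, so `|m_n -
w_TD|` is not controlled. In the covariance claim the mean error cancels exactly; in the value error
only `Σ̄ (m_n - w_TD)` occurs, and it is controlled because `Σ² ≤ C Σ`. -/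

noncomputable section

namespace TDLearning

/-! ### Random variables with moments of all orders -/

section AllMoments

variable {α β E ι : Type*} {mα : MeasurableSpace α} {mβ : MeasurableSpace β} {μ : Measure α}

/-- A random variable with finite moments of all orders. -/
@[fun_prop]
def AllMoments [NormedAddCommGroup E] (f : α → E) (μ : Measure α) : Prop :=
  ∀ p : ℕ, MemLp f p μ

namespace AllMoments

variable [NormedAddCommGroup E]

theorem integrable {f : α → E} (hf : AllMoments f μ) : Integrable f μ := by
  simpa [memLp_one_iff_integrable] using hf 1

theorem aestronglyMeasurable {f : α → E} (hf : AllMoments f μ) : AEStronglyMeasurable f μ :=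
  (hf 0).1

@[fun_prop]
theorem const [IsFiniteMeasure μ] (c : E) : AllMoments (fun _ : α => c) μ :=
  fun _ => memLp_const c

@[fun_prop]
theorem add {f g : α → E} (hf : AllMoments f μ) (hg : AllMoments g μ) :
    AllMoments (fun x => f x + g x) μ := fun p => (hf p).add (hg p)

@[fun_prop]
theorem sub {f g : α → E} (hf : AllMoments f μ) (hg : AllMoments g μ) :
    AllMoments (fun x => f x - g x) μ := fun p => (hf p).sub (hg p)

@[fun_prop]
theorem sum {s : Finset ι} {f : ι → α → E} (hf : ∀ i, AllMoments (f i) μ) :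
    AllMoments (fun x => ∑ i ∈ s, f i x) μ := fun p => memLp_finsetSum s fun i _ => hf i p

@[fun_prop]
theorem mul {f g : α → ℝ} (hf : AllMoments f μ) (hg : AllMoments g μ) :
    AllMoments (fun x => f x * g x) μ := by
  intro p
  -- Hölder with exponents `2p, 2p, p`. The case `p = 0` is separate: there all three inverse
  -- exponents are infinite.
  have : ENNReal.HolderTriple ((2 * p : ℕ) : ENNReal) ((2 * p : ℕ) : ENNReal) (p : ENNReal) := by
    constructor
    rcases Nat.eq_zero_or_pos p with rfl | hp
    · simp
    · have : ((2 * p : ℕ) : ENNReal) = 2 * p := by push_cast; ring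
      rw [this, ENNReal.mul_inv (by simp) (by simp), ← add_mul, ENNReal.inv_two_add_inv_two,
        one_mul]
  exact MemLp.mul' (hg (2 * p)) (hf (2 * p))

@[fun_prop]
theorem pow [IsFiniteMeasure μ] {f : α → ℝ} (hf : AllMoments f μ) (n : ℕ) :
    AllMoments (fun x => f x ^ n) μ := by
  induction n with
  | zero => simpa using const (μ := μ) (1 : ℝ)
  | succ n ih => simpa only [pow_succ] using ih.mul hf

@[fun_prop]
theorem abs {f : α → ℝ} (hf : AllMoments f μ) : AllMoments (fun x => |f x|) μ :=
  fun p => (hf p).abs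

@[fun_prop]
theorem div_const {f : α → ℝ} [IsFiniteMeasure μ] (hf : AllMoments f μ) (c : ℝ) :
    AllMoments (fun x => f x / c) μ := by
  simpa only [div_eq_mul_inv] using hf.mul (const (c⁻¹))

theorem pi [Fintype ι] {f : α → ι → ℝ} (hf : ∀ i, AllMoments (fun x => f x i) μ) :
    AllMoments f μ := fun p => memLp_pi_iff.2 fun i => hf i p

theorem eval [Fintype ι] {f : α → ι → ℝ} (hf : AllMoments f μ) (i : ι) :
    AllMoments (fun x => f x i) μ := fun p => memLp_pi_iff.1 (hf p) i

@[fun_prop]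
theorem smul [IsFiniteMeasure μ] [Fintype ι] {f : α → ℝ} {g : α → ι → ℝ} (hf : AllMoments f μ)
    (hg : AllMoments g μ) : AllMoments (fun x => f x • g x) μ :=
  pi fun i => hf.mul (hg.eval i)

@[fun_prop]
theorem dotProduct [IsFiniteMeasure μ] [Fintype ι] {f g : α → ι → ℝ} (hf : AllMoments f μ)
    (hg : AllMoments g μ) : AllMoments (fun x => f x ⬝ᵥ g x) μ :=
  sum fun i => (hf.eval i).mul (hg.eval i)

@[fun_prop]
theorem mulVec [IsFiniteMeasure μ] [Fintype ι] {f : α → ι → ℝ} (A : Matrix ι ι ℝ)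
    (hf : AllMoments f μ) : AllMoments (fun x => A *ᵥ f x) μ :=
  pi fun i => (const (A i)).dotProduct hf

theorem comp_measurePreserving {ν : Measure β} {f : β → E} {g : α → β} (hf : AllMoments f ν)
    (hg : MeasurePreserving g μ ν) : AllMoments (fun x => f (g x)) μ :=
  fun p => (hf p).comp_measurePreserving hg

theorem comp_hasLaw {ν : Measure β} {f : β → E} {g : α → β} (hf : AllMoments f ν)
    (hg : HasLaw g ν μ) : AllMoments (fun x => f (g x)) μ :=
  fun p => MemLp.comp_of_map (by rw [hg.map_eq]; exact hf p) hg.aemeasurable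

end AllMoments

/-- The Cauchy–Schwarz inequality for the integral of a product. -/
theorem sq_integral_mul_le {f g : α → ℝ} (hf : AllMoments f μ) (hg : AllMoments g μ) :
    (∫ x, f x * g x ∂μ) ^ 2 ≤ (∫ x, f x * f x ∂μ) * ∫ x, g x * g x ∂μ := by
  have key : ∀ t : ℝ, 0 ≤ (∫ x, f x * f x ∂μ) * (t * t) + (2 * ∫ x, f x * g x ∂μ) * t
      + ∫ x, g x * g x ∂μ := by
    intro t
    have h1 : Integrable (fun x => f x * f x) μ := (hf.mul hf).integrable
    have h2 : Integrable (fun x => f x * g x) μ := (hf.mul hg).integrable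
    have h3 : Integrable (fun x => g x * g x) μ := (hg.mul hg).integrable
    have : ∫ x, (t * f x + g x) ^ 2 ∂μ = (∫ x, f x * f x ∂μ) * (t * t)
        + (2 * ∫ x, f x * g x ∂μ) * t + ∫ x, g x * g x ∂μ := by
      have e : ∀ x, (t * f x + g x) ^ 2 = (t * t) * (f x * f x) + (2 * t) * (f x * g x)
          + g x * g x := fun x => by ring
      simp_rw [e]
      rw [integral_add (f := fun x => t * t * (f x * f x) + 2 * t * (f x * g x))
        ((h1.const_mul _).add (h2.const_mul _)) h3, integral_add (h1.const_mul _) (h2.const_mul _), integral_const_mul, integral_const_mul]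
      ring
    rw [← this]
    exact integral_nonneg fun x => sq_nonneg _
  have := discrim_le_zero key
  rw [discrim] at this
  nlinarith

/-- Jensen's inequality for the square. -/
theorem sq_integral_le [IsProbabilityMeasure μ] {f : α → ℝ} (hf : AllMoments f μ) :
    (∫ x, f x ∂μ) ^ 2 ≤ ∫ x, f x ^ 2 ∂μ := by
  have := sq_integral_mul_le hf (AllMoments.const (μ := μ) (1 : ℝ))
  simpa [sq] using this

theorem integral_abs_le_sqrt [IsProbabilityMeasure μ] {f : α → ℝ} (hf : AllMoments f μ) {v : ℝ}
    (hv : ∫ x, f x ^ 2 ∂μ ≤ v) : ∫ x, |f x| ∂μ ≤ √v := by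
  apply Real.le_sqrt_of_sq_le
  refine (sq_integral_le hf.abs).trans ?_
  simpa only [sq_abs] using hv

theorem integral_sq_sum_le [IsFiniteMeasure μ] {s : Finset ι} {f : ι → α → ℝ}
    (hf : ∀ i, AllMoments (f i) μ)
    {c : ℝ} (hc : ∀ i ∈ s, ∫ x, f i x ^ 2 ∂μ ≤ c) :
    ∫ x, (∑ i ∈ s, f i x) ^ 2 ∂μ ≤ (s.card : ℝ) ^ 2 * c := by
  calc ∫ x, (∑ i ∈ s, f i x) ^ 2 ∂μ ≤ ∫ x, (s.card : ℝ) * ∑ i ∈ s, f i x ^ 2 ∂μ := by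
        refine integral_mono (AllMoments.integrable (by fun_prop))
          (AllMoments.integrable (by fun_prop)) fun x => ?_
        exact sq_sum_le_card_mul_sum_sq
    _ = s.card * ∑ i ∈ s, ∫ x, f i x ^ 2 ∂μ := by
        rw [integral_const_mul, integral_finsetSum _ fun i _ => AllMoments.integrable (by fun_prop)]
    _ ≤ s.card * (s.card * c) := by
        gcongr
        simpa using Finset.sum_le_sum hc
    _ = _ := by ring

theorem integral_dotProduct_const [Fintype ι] {f : α → ι → ℝ} (hf : AllMoments f μ) (b : ι → ℝ) :
    ∫ x, b ⬝ᵥ f x ∂μ = b ⬝ᵥ fun i => ∫ x, f x i ∂μ := by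
  simp only [dotProduct]
  rw [integral_finsetSum _ fun i _ => (hf.eval i).integrable.const_mul _]
  simp_rw [integral_const_mul]

/-- Integration of a function of a pair of independent random variables. -/
theorem integral_comp_prodMk_of_indepFun {Ω A : Type*} {mΩ : MeasurableSpace Ω}
    {mA : MeasurableSpace A} {Pr : Measure Ω} [IsProbabilityMeasure Pr] {X : Ω → A} {Y : Ω → β}
    (h : IndepFun X Y Pr) (hX : AEMeasurable X Pr) (hY : AEMeasurable Y Pr)
    {F : A → β → ℝ} (hF : Measurable (Function.uncurry F))
    (hi : Integrable (fun ω => F (X ω) (Y ω)) Pr) :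
    Integrable (fun ω' => ∫ ω, F (X ω') (Y ω) ∂Pr) Pr ∧
      ∫ ω, F (X ω) (Y ω) ∂Pr = ∫ ω', ∫ ω, F (X ω') (Y ω) ∂Pr ∂Pr := by
  have hmap := (indepFun_iff_map_prod_eq_prod_map_map hX hY).1 h
  have : IsProbabilityMeasure (Pr.map X) := Measure.isProbabilityMeasure_map hX
  have : IsProbabilityMeasure (Pr.map Y) := Measure.isProbabilityMeasure_map hY
  have hF' : Integrable (Function.uncurry F) ((Pr.map X).prod (Pr.map Y)) := by
    rw [← hmap, integrable_map_measure hF.aestronglyMeasurable (hX.prodMk hY)]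
    exact hi
  have e : ∀ a, ∫ ω, F a (Y ω) ∂Pr = ∫ y, F a y ∂(Pr.map Y) := fun a => by
    rw [integral_map hY]
    exact (hF.comp (measurable_const.prodMk measurable_id)).aestronglyMeasurable
  have hI := hF'.integral_prod_left
  refine ⟨?_, ?_⟩
  · simp_rw [e]
    exact (integrable_map_measure hI.1 hX).1 hI
  · simp_rw [e]
    rw [← integral_map (f := fun a => ∫ y, F a y ∂(Pr.map Y)) hX hI.1]
    refine Eq.trans ?_ (integral_prod _ hF')
    rw [← hmap, integral_map (hX.prodMk hY) hF.aestronglyMeasurable]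
    rfl

/-- Conditioning on `X`: an estimate proved with the first argument frozen may be averaged over it.
-/
theorem integral_comp_prodMk_le_of_indepFun {Ω A : Type*} {mΩ : MeasurableSpace Ω}
    {mA : MeasurableSpace A} {Pr : Measure Ω} [IsProbabilityMeasure Pr] {X : Ω → A} {Y : Ω → β}
    (h : IndepFun X Y Pr) (hX : AEMeasurable X Pr) (hY : AEMeasurable Y Pr)
    {F : A → β → ℝ} (hF : Measurable (Function.uncurry F))
    (hi : Integrable (fun ω => F (X ω) (Y ω)) Pr) {g : A → ℝ}
    (hg : Integrable (fun ω => g (X ω)) Pr) (hle : ∀ a, ∫ ω, F a (Y ω) ∂Pr ≤ g a) :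
    ∫ ω, F (X ω) (Y ω) ∂Pr ≤ ∫ ω, g (X ω) ∂Pr := by
  obtain ⟨h1, h2⟩ := integral_comp_prodMk_of_indepFun h hX hY hF hi
  rw [h2]
  exact integral_mono h1 hg fun ω => hle _

end AllMoments

/-! ### Quadratic forms and the operator norm -/

section Norm

open scoped Matrix.Norms.L2Operator

variable {ι : Type*} [Fintype ι]

theorem sq_dotProduct_le (u v : ι → ℝ) : (u ⬝ᵥ v) ^ 2 ≤ (u ⬝ᵥ u) * (v ⬝ᵥ v) := by
  simpa [dotProduct, sq] using Finset.sum_mul_sq_le_sq_mul_sq Finset.univ u v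

theorem dotProduct_self_nonneg' (v : ι → ℝ) : 0 ≤ v ⬝ᵥ v :=
  Finset.sum_nonneg fun _ _ => mul_self_nonneg _

theorem norm_toLp_sq (v : ι → ℝ) : ‖WithLp.toLp 2 v‖ ^ 2 = v ⬝ᵥ v := by
  rw [EuclideanSpace.norm_sq_eq]
  simp [dotProduct, sq]

theorem trace_mul_vecMulVec (G : Matrix ι ι ℝ) (u v : ι → ℝ) :
    (G * vecMulVec u v).trace = v ⬝ᵥ G *ᵥ u := by
  rw [Matrix.mul_vecMulVec, trace_vecMulVec, dotProduct_comm]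

variable [DecidableEq ι]

theorem mulVec_dotProduct_self_le (G : Matrix ι ι ℝ) (v : ι → ℝ) :
    (G *ᵥ v) ⬝ᵥ (G *ᵥ v) ≤ ‖G‖ ^ 2 * (v ⬝ᵥ v) := by
  have := Matrix.l2_opNorm_mulVec G (WithLp.toLp 2 v)
  rw [← norm_toLp_sq, ← norm_toLp_sq, ← mul_pow]
  exact pow_le_pow_left₀ (norm_nonneg _) this 2

theorem norm_le_of_mulVec_dotProduct_self_le {G : Matrix ι ι ℝ} {K : ℝ} (hK : 0 ≤ K)
    (h : ∀ v, (G *ᵥ v) ⬝ᵥ (G *ᵥ v) ≤ K ^ 2 * (v ⬝ᵥ v)) : ‖G‖ ≤ K := by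
  rw [← Matrix.l2_opNorm_toEuclideanCLM]
  refine ContinuousLinearMap.opNorm_le_bound _ hK fun v => ?_
  have := h (WithLp.ofLp v)
  rw [← norm_toLp_sq, ← norm_toLp_sq, ← mul_pow] at this
  exact le_of_sq_le_sq this (by positivity)

theorem sq_dotProduct_mulVec_le (G : Matrix ι ι ℝ) (u v : ι → ℝ) :
    (u ⬝ᵥ G *ᵥ v) ^ 2 ≤ ‖G‖ ^ 2 * ((u ⬝ᵥ u) * (v ⬝ᵥ v)) := by
  calc _ ≤ (u ⬝ᵥ u) * ((G *ᵥ v) ⬝ᵥ (G *ᵥ v)) := sq_dotProduct_le _ _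
    _ ≤ (u ⬝ᵥ u) * (‖G‖ ^ 2 * (v ⬝ᵥ v)) := by
        gcongr
        · exact dotProduct_self_nonneg' u
        · exact mulVec_dotProduct_self_le _ _
    _ = _ := by ring

theorem abs_dotProduct_mulVec_self_le (G : Matrix ι ι ℝ) (v : ι → ℝ) :
    |v ⬝ᵥ G *ᵥ v| ≤ ‖G‖ * (v ⬝ᵥ v) := by
  apply abs_le_of_sq_le_sq _ (mul_nonneg (norm_nonneg _) (dotProduct_self_nonneg' v))
  refine (sq_dotProduct_mulVec_le G v v).trans (le_of_eq ?_)
  ring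

theorem norm_le_of_sq_dotProduct_mulVec_le {G : Matrix ι ι ℝ} {K : ℝ} (hK : 0 ≤ K)
    (h : ∀ u v, (u ⬝ᵥ G *ᵥ v) ^ 2 ≤ K ^ 2 * ((u ⬝ᵥ u) * (v ⬝ᵥ v))) : ‖G‖ ≤ K := by
  refine norm_le_of_mulVec_dotProduct_self_le hK fun v => ?_
  have h1 := h (G *ᵥ v) v
  rcases (dotProduct_self_nonneg' (G *ᵥ v)).eq_or_lt with h0 | h0
  · rw [← h0]; have := dotProduct_self_nonneg' v; positivity
  · refine le_of_mul_le_mul_left ?_ h0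
    nlinarith

theorem abs_apply_le_norm (G : Matrix ι ι ℝ) (i j : ι) : |G i j| ≤ ‖G‖ := by
  apply abs_le_of_sq_le_sq _ (norm_nonneg _)
  simpa using sq_dotProduct_mulVec_le G (Pi.single i 1) (Pi.single j 1)

theorem abs_trace_le (G : Matrix ι ι ℝ) : |G.trace| ≤ Fintype.card ι * ‖G‖ := by
  calc |G.trace| ≤ ∑ i, |G i i| := Finset.abs_sum_le_sum_abs _ _
    _ ≤ ∑ _i : ι, ‖G‖ := Finset.sum_le_sum fun i _ => abs_apply_le_norm G i i
    _ = _ := by simp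

theorem norm_transpose_eq (G : Matrix ι ι ℝ) : ‖Gᵀ‖ = ‖G‖ := by
  rw [← Matrix.conjTranspose_eq_transpose_of_trivial, Matrix.l2_opNorm_conjTranspose]

/-- Makes rank-one matrices `a aᵀ / N` with `|a|² = O(N)` admissible test matrices, which turns
linear functionals into quadratic ones. -/
theorem norm_vecMulVec_self_le (a : ι → ℝ) : ‖vecMulVec a a‖ ≤ a ⬝ᵥ a := by
  have h0 := dotProduct_self_nonneg' a
  refine norm_le_of_sq_dotProduct_mulVec_le h0 fun u v => ?_
  have e : u ⬝ᵥ vecMulVec a a *ᵥ v = (u ⬝ᵥ a) * (a ⬝ᵥ v) := by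
    simp [vecMulVec_mulVec, dotProduct_smul, mul_comm]
  rw [e, mul_pow]
  calc _ ≤ ((u ⬝ᵥ u) * (a ⬝ᵥ a)) * ((a ⬝ᵥ a) * (v ⬝ᵥ v)) :=
        mul_le_mul (sq_dotProduct_le _ _) (sq_dotProduct_le _ _) (sq_nonneg _)
          (mul_nonneg (dotProduct_self_nonneg' _) h0)
    _ = _ := by ring

end Norm

/-! ### Moments of Gaussian variables -/

section GaussianMoments

/-- A constant `κ` with `E X⁸ ≤ κ (E X²)⁴` for all real Gaussian variables `X`. -/
def gaussianConst : ℝ := 128 * (1 + ∫ x, x ^ 8 ∂(gaussianReal 0 1))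

theorem one_le_gaussianConst : 1 ≤ gaussianConst := by
  have : 0 ≤ ∫ x, x ^ 8 ∂(gaussianReal 0 1) := integral_nonneg fun x => by positivity
  unfold gaussianConst
  linarith

@[fun_prop]
theorem allMoments_id_gaussianReal (m : ℝ) (v : NNReal) :
    AllMoments (fun x : ℝ => x) (gaussianReal m v) :=
  fun p => memLp_id_gaussianReal' (p : ENNReal) (by simp)

/-- Write the variable as `m + √v x` with `x` standard and use `(a + b)⁸ ≤ 2⁷ (a⁸ + b⁸)`, the source
of the factor 128. The second moment `m² + v` dominates both contributions, so no centering is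
required. -/
theorem integral_pow_eight_gaussianReal_le (m : ℝ) (v : NNReal) :
    ∫ x, x ^ 8 ∂(gaussianReal m v) ≤ gaussianConst * (∫ x, x ^ 2 ∂(gaussianReal m v)) ^ 4 := by
  have hmap : gaussianReal m v = (gaussianReal 0 1).map (fun x => m + √(v : ℝ) * x) := by
    have h1 := gaussianReal_map_const_mul (μ := 0) (v := 1) (√(v : ℝ))
    have h2 := gaussianReal_map_const_add (μ := 0) (v := v) m
    have hv : (NNReal.mk (√(v : ℝ) ^ 2) (sq_nonneg _) : NNReal) = v := by
      ext; simp
    rw [mul_zero, mul_one, hv] at h1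
    rw [zero_add, ← h1, Measure.map_map (by fun_prop) (by fun_prop)] at h2
    exact h2.symm
  have h2 : ∫ x, x ^ 2 ∂(gaussianReal m v) = m ^ 2 + v := by
    have := variance_eq_sub (μ := gaussianReal m v) (X := fun x => x)
      (by simpa using allMoments_id_gaussianReal m v 2)
    rw [variance_fun_id_gaussianReal, integral_id_gaussianReal] at this
    simp only [Pi.pow_apply] at this
    linarith
  rw [h2]
  rw [hmap, integral_map (by fun_prop) (by fun_prop)]
  have hs : √(v : ℝ) ^ 2 = v := Real.sq_sqrt v.2
  calc ∫ x, (m + √(v : ℝ) * x) ^ 8 ∂(gaussianReal 0 1)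
      ≤ ∫ x, 128 * (m ^ 8 + (v : ℝ) ^ 4 * x ^ 8) ∂(gaussianReal 0 1) := by
        refine integral_mono (AllMoments.integrable (by fun_prop))
          (AllMoments.integrable (by fun_prop)) fun x => ?_
        refine (Even.add_pow_le (by decide)).trans (le_of_eq ?_)
        have : √(v : ℝ) ^ 8 = (v : ℝ) ^ 4 := by rw [← hs, ← pow_mul, hs]
        rw [mul_pow, this]
        norm_num
    _ = 128 * (m ^ 8 + (v : ℝ) ^ 4 * ∫ x, x ^ 8 ∂(gaussianReal 0 1)) := by
        rw [integral_const_mul, integral_add (by simp)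
          (AllMoments.integrable (by fun_prop)), integral_const_mul]
        simp
    _ ≤ gaussianConst * (m ^ 2 + v) ^ 4 := by
        have h0 : 0 ≤ ∫ x, x ^ 8 ∂(gaussianReal 0 1) := integral_nonneg fun x => by positivity
        have hv : 0 ≤ (v : ℝ) := v.2
        have e1 : m ^ 8 ≤ (m ^ 2 + v) ^ 4 := by
          calc m ^ 8 = (m ^ 2) ^ 4 := by ring
            _ ≤ _ := by gcongr; linarith
        have e2 : (v : ℝ) ^ 4 ≤ (m ^ 2 + v) ^ 4 := by
          gcongr; linarith [sq_nonneg m]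
        unfold gaussianConst
        nlinarith [mul_le_mul_of_nonneg_right e2 h0]

variable {α : Type*} {mα : MeasurableSpace α} {μ : Measure α} {a b : α → ℝ}

theorem allMoments_of_hasGaussianLaw {E : Type*} [NormedAddCommGroup E] [NormedSpace ℝ E]
    [MeasurableSpace E] [BorelSpace E] [SecondCountableTopology E] [CompleteSpace E] {f : α → E}
    (ha : HasGaussianLaw f μ) : AllMoments f μ :=
  fun _ => ha.memLp (by simp)

theorem integral_pow_eight_le (ha : HasGaussianLaw a μ) :
    ∫ x, a x ^ 8 ∂μ ≤ gaussianConst * (∫ x, a x ^ 2 ∂μ) ^ 4 := by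
  have h := ha.isGaussian_map
  have := integral_pow_eight_gaussianReal_le (μ.map a)[id] Var[id; μ.map a].toNNReal
  rw [← IsGaussian.eq_gaussianReal _ h, integral_map ha.aemeasurable (by fun_prop),
    integral_map ha.aemeasurable (by fun_prop)] at this
  exact this

theorem integral_pow_eight_le_of_le (ha : HasGaussianLaw a μ) {A : ℝ}
    (hA : ∫ x, a x ^ 2 ∂μ ≤ A) : ∫ x, a x ^ 8 ∂μ ≤ gaussianConst * A ^ 4 := by
  refine (integral_pow_eight_le ha).trans ?_
  have : 0 ≤ ∫ x, a x ^ 2 ∂μ := integral_nonneg fun x => sq_nonneg _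
  have := one_le_gaussianConst
  gcongr

/-- Jensen from the eighth moment gives the constant `√κ`; it is enlarged to `κ`, using `κ ≥ 1`, so
that one constant serves throughout. -/
theorem integral_pow_four_le_of_le (ha : HasGaussianLaw a μ) {A : ℝ}
    (hA : ∫ x, a x ^ 2 ∂μ ≤ A) : ∫ x, a x ^ 4 ∂μ ≤ gaussianConst * A ^ 2 := by
  have := ha.isProbabilityMeasure
  have hm := allMoments_of_hasGaussianLaw ha
  have h1 := sq_integral_le (hm.pow 4)
  have h2 := integral_pow_eight_le_of_le ha hA
  have hk := one_le_gaussianConst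
  refine le_of_sq_le_sq (h1.trans ?_) (by positivity)
  simp_rw [← pow_mul]
  refine h2.trans ?_
  rw [mul_pow, ← pow_mul]
  gcongr
  nlinarith

theorem integral_sq_mul_le (ha : HasGaussianLaw a μ) (hb : HasGaussianLaw b μ) {A B : ℝ}
    (hA : ∫ x, a x ^ 2 ∂μ ≤ A) (hB : ∫ x, b x ^ 2 ∂μ ≤ B) :
    ∫ x, (a x * b x) ^ 2 ∂μ ≤ gaussianConst * (A * B) := by
  have := ha.isProbabilityMeasure
  have hma := allMoments_of_hasGaussianLaw ha
  have hmb := allMoments_of_hasGaussianLaw hb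
  have h1 := sq_integral_mul_le (hma.pow 2) (hmb.pow 2)
  have h2 := integral_pow_four_le_of_le ha hA
  have h3 := integral_pow_four_le_of_le hb hB
  have hk := one_le_gaussianConst
  have hA0 : 0 ≤ A := (integral_nonneg fun x => sq_nonneg _).trans hA
  have hB0 : 0 ≤ B := (integral_nonneg fun x => sq_nonneg _).trans hB
  simp_rw [mul_pow]
  refine le_of_sq_le_sq (h1.trans ?_) (by positivity)
  simp_rw [← pow_add]
  calc _ ≤ (gaussianConst * A ^ 2) * (gaussianConst * B ^ 2) := by
        apply mul_le_mul h2 h3 (integral_nonneg fun x => by positivity) (by positivity)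
    _ = _ := by ring

/-- The two factors may be dependent: Cauchy–Schwarz separates them at the price of eighth moments.
It is applied to a TD error times a feature of the same episode. -/
theorem integral_pow_four_mul_le (ha : HasGaussianLaw a μ) (hb : HasGaussianLaw b μ) {A B : ℝ}
    (hA : ∫ x, a x ^ 2 ∂μ ≤ A) (hB : ∫ x, b x ^ 2 ∂μ ≤ B) :
    ∫ x, (a x * b x) ^ 4 ∂μ ≤ gaussianConst * (A * B) ^ 2 := by
  have := ha.isProbabilityMeasure
  have hma := allMoments_of_hasGaussianLaw ha
  have hmb := allMoments_of_hasGaussianLaw hb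
  have h1 := sq_integral_mul_le (hma.pow 4) (hmb.pow 4)
  have h2 := integral_pow_eight_le_of_le ha hA
  have h3 := integral_pow_eight_le_of_le hb hB
  have hk := one_le_gaussianConst
  simp_rw [mul_pow]
  refine le_of_sq_le_sq (h1.trans ?_) (by positivity)
  simp_rw [← pow_add]
  calc _ ≤ (gaussianConst * A ^ 4) * (gaussianConst * B ^ 4) := by
        apply mul_le_mul h2 h3 (integral_nonneg fun x => by positivity) (by positivity)
    _ = _ := by ring

end GaussianMoments

/-! ### The variance of bilinear forms of Gaussian vectors -/

section Bilinear

open scoped Matrix.Norms.L2Operator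

variable {ι E : Type*} [Fintype ι] [NormedAddCommGroup E] [NormedSpace ℝ E]
  [MeasurableSpace E] [BorelSpace E]

theorem hasGaussianLaw_clm (P : Measure E) [IsGaussian P] {F : Type*} [NormedAddCommGroup F]
    [NormedSpace ℝ F] [MeasurableSpace F] [BorelSpace F] (u : E →L[ℝ] F) :
    HasGaussianLaw (fun x => u x) P :=
  IsGaussian.hasGaussianLaw_id.map u

theorem allMoments_clm (P : Measure E) [IsGaussian P] {F : Type*} [NormedAddCommGroup F]
    [NormedSpace ℝ F] [MeasurableSpace F] [BorelSpace F] [SecondCountableTopology F]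
    [CompleteSpace F] (u : E →L[ℝ] F) :
    AllMoments (fun x => u x) P :=
  allMoments_of_hasGaussianLaw (hasGaussianLaw_clm P u)

theorem integral_dotProduct_self_le {α : Type*} {mα : MeasurableSpace α} {μ : Measure α}
    [IsFiniteMeasure μ] {f : α → ι → ℝ} (hf : AllMoments f μ) {C : ℝ}
    (h : ∀ c : ι → ℝ, ∫ x, (c ⬝ᵥ f x) ^ 2 ∂μ ≤ C * (c ⬝ᵥ c)) :
    ∫ x, f x ⬝ᵥ f x ∂μ ≤ C * Fintype.card ι := by
  classical
  simp only [dotProduct]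
  rw [integral_finsetSum _ fun i _ => ((hf.eval i).mul (hf.eval i)).integrable]
  calc _ ≤ ∑ _i : ι, C := Finset.sum_le_sum fun i _ => by simpa [sq] using h (Pi.single i 1)
    _ = _ := by simp [mul_comm]

/-- The sign `σ = ±1` treats the sum and the difference of two copies at once. The vectors need not
be centered, so the bound is `(a + b)² ≤ 2a² + 2b²` rather than additivity of variances. -/
theorem integral_sq_dotProduct_add_smul_le {Ω : Type*} {mΩ : MeasurableSpace Ω} {Pr : Measure Ω}
    [IsFiniteMeasure Pr] {X Y : Ω → ι → ℝ} (hX : AllMoments X Pr) (hY : AllMoments Y Pr)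
    {C σ : ℝ} (hσ : σ ^ 2 = 1) (c : ι → ℝ) (hXc : ∫ x, (c ⬝ᵥ X x) ^ 2 ∂Pr ≤ C * (c ⬝ᵥ c))
    (hYc : ∫ x, (c ⬝ᵥ Y x) ^ 2 ∂Pr ≤ C * (c ⬝ᵥ c)) :
    ∫ x, (c ⬝ᵥ (X x + σ • Y x)) ^ 2 ∂Pr ≤ 4 * C * (c ⬝ᵥ c) := by
  calc _ ≤ ∫ x, (2 * (c ⬝ᵥ X x) ^ 2 + 2 * (c ⬝ᵥ Y x) ^ 2) ∂Pr := by
        refine integral_mono (AllMoments.integrable (by fun_prop))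
          (AllMoments.integrable (by fun_prop)) fun x => ?_
        simp only [dotProduct_add, dotProduct_smul, smul_eq_mul]
        nlinarith [sq_nonneg (c ⬝ᵥ X x - σ * (c ⬝ᵥ Y x)), hσ]
    _ = 2 * ∫ x, (c ⬝ᵥ X x) ^ 2 ∂Pr + 2 * ∫ x, (c ⬝ᵥ Y x) ^ 2 ∂Pr := by
        rw [integral_add (AllMoments.integrable (by fun_prop))
          (AllMoments.integrable (by fun_prop)), integral_const_mul, integral_const_mul]
    _ ≤ _ := by linarith

variable [SecondCountableTopology E] [CompleteSpace E]

/-- The pair is jointly Gaussian, and the covariance of `L₁ (x - y)` with `L₂ (x + y)` is `cov(L₁,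
L₂) - cov(L₁, L₂) = 0`; the mean of `P` plays no role. -/
theorem indepFun_sub_add (P : Measure E) [IsGaussian P] :
    IndepFun (fun x : E × E => x.1 - x.2) (fun x => x.1 + x.2) (P.prod P) := by
  have h1 : HasGaussianLaw (fun x : E × E => (x.1 - x.2, x.1 + x.2)) (P.prod P) :=
    hasGaussianLaw_clm (P.prod P)
      (ContinuousLinearMap.prod (ContinuousLinearMap.fst ℝ E E - ContinuousLinearMap.snd ℝ E E)
        (ContinuousLinearMap.fst ℝ E E + ContinuousLinearMap.snd ℝ E E))
  refine h1.indepFun_of_covariance_strongDual fun L₁ L₂ => ?_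
  have m1 : ∀ L : StrongDual ℝ E, MemLp L 2 P := fun L => IsGaussian.memLp_dual P L 2 (by simp)
  have f1 : ∀ L : StrongDual ℝ E, MemLp (fun x : E × E => L x.1) 2 (P.prod P) := fun L =>
    (m1 L).comp_measurePreserving measurePreserving_fst
  have f2 : ∀ L : StrongDual ℝ E, MemLp (fun x : E × E => L x.2) 2 (P.prod P) := fun L =>
    (m1 L).comp_measurePreserving measurePreserving_snd
  have hind : ∀ L L' : StrongDual ℝ E,
      cov[fun x : E × E => L x.1, fun x => L' x.2; P.prod P] = 0 := fun L L' =>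
    (indepFun_prod (μ := P) (ν := P) (X := fun x => L x) (Y := fun x => L' x)
      L.continuous.measurable L'.continuous.measurable).covariance_eq_zero (f1 L) (f2 L')
  have e1 : L₁ ∘ (fun x : E × E => x.1 - x.2) = (fun x : E × E => L₁ x.1) - fun x => L₁ x.2 := by
    ext; simp
  have e2 : L₂ ∘ (fun x : E × E => x.1 + x.2) = (fun x : E × E => L₂ x.1) + fun x => L₂ x.2 := by
    ext; simp
  rw [e1, e2, covariance_sub_left (f1 L₁) (f2 L₁) ((f1 L₂).add (f2 L₂)),
    covariance_add_right (f1 L₁) (f1 L₂) (f2 L₂), covariance_add_right (f2 L₁) (f1 L₂) (f2 L₂),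
    hind, covariance_comm (fun x : E × E => L₁ x.2) (fun x => L₂ x.1), hind]
  have c1 : cov[fun x : E × E => L₁ x.1, fun x => L₂ x.1; P.prod P] = cov[L₁, L₂; P] := by
    have := covariance_map (μ := P.prod P) (Z := Prod.fst) (X := L₁) (Y := L₂)
      (by rw [measurePreserving_fst.map_eq]; fun_prop)
      (by rw [measurePreserving_fst.map_eq]; fun_prop) (by fun_prop)
    rw [measurePreserving_fst.map_eq] at this
    exact this.symm
  have c2 : cov[fun x : E × E => L₁ x.2, fun x => L₂ x.2; P.prod P] = cov[L₁, L₂; P] := by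
    have := covariance_map (μ := P.prod P) (Z := Prod.snd) (X := L₁) (Y := L₂)
      (by rw [measurePreserving_snd.map_eq]; fun_prop)
      (by rw [measurePreserving_snd.map_eq]; fun_prop) (by fun_prop)
    rw [measurePreserving_snd.map_eq] at this
    exact this.symm
  rw [c1, c2]
  ring

variable [DecidableEq ι]

/-- A bilinear form of a pair of independent vectors. -/
theorem integral_sq_bilin_le_of_indepFun {Ω : Type*} {mΩ : MeasurableSpace Ω} {Pr : Measure Ω}
    [IsProbabilityMeasure Pr] {X Y : Ω → ι → ℝ} (h : IndepFun X Y Pr) (hX : AllMoments X Pr)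
    (hY : AllMoments Y Pr) (G : Matrix ι ι ℝ) {p s : ℝ} (hp : 0 ≤ p)
    (hXp : ∀ c : ι → ℝ, ∫ x, (c ⬝ᵥ X x) ^ 2 ∂Pr ≤ p * (c ⬝ᵥ c))
    (hYs : ∫ x, Y x ⬝ᵥ Y x ∂Pr ≤ s) :
    ∫ x, (X x ⬝ᵥ G *ᵥ Y x) ^ 2 ∂Pr ≤ p * ‖G‖ ^ 2 * s := by
  have hF : Measurable (Function.uncurry fun (y x : ι → ℝ) => (x ⬝ᵥ G *ᵥ y) ^ 2) := by
    apply Continuous.measurable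
    simp only [Function.uncurry_def, dotProduct, mulVec]
    fun_prop
  -- With `Y = y` frozen the form is the linear functional `(G y) · X`, to which the directional
  -- bound on `X` applies.
  refine (integral_comp_prodMk_le_of_indepFun h.symm hY.aestronglyMeasurable.aemeasurable
    hX.aestronglyMeasurable.aemeasurable hF (AllMoments.integrable (by fun_prop))
    (g := fun y => p * ‖G‖ ^ 2 * (y ⬝ᵥ y)) (AllMoments.integrable (by fun_prop)) ?_).trans ?_
  · intro y
    calc _ ≤ p * ((G *ᵥ y) ⬝ᵥ (G *ᵥ y)) := by
          simpa only [dotProduct_comm] using hXp (G *ᵥ y)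
      _ ≤ p * (‖G‖ ^ 2 * (y ⬝ᵥ y)) := by gcongr; exact mulVec_dotProduct_self_le G y
      _ = _ := by ring
  · rw [integral_const_mul]
    gcongr

/-- Symmetrization by an independent copy: after centering both copies the cross term has mean zero.
-/
theorem two_mul_integral_sq_sub_integral {α : Type*} {mα : MeasurableSpace α} {P : Measure α}
    [IsProbabilityMeasure P] {f : α → ℝ} (hf : AllMoments f P) :
    2 * ∫ x, (f x - ∫ y, f y ∂P) ^ 2 ∂P = ∫ x, (f x.1 - f x.2) ^ 2 ∂(P.prod P) := by
  generalize hc : ∫ y, f y ∂P = c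
  have h1 : AllMoments (fun x : α × α => f x.1) (P.prod P) :=
    hf.comp_measurePreserving measurePreserving_fst
  have h2 : AllMoments (fun x : α × α => f x.2) (P.prod P) :=
    hf.comp_measurePreserving measurePreserving_snd
  have h0 : ∫ x, (f x - c) ∂P = 0 := by
    rw [integral_sub hf.integrable (integrable_const _)]; simp [hc]
  have e : ∀ x : α × α, (f x.1 - f x.2) ^ 2 = (f x.1 - c) ^ 2 + (f x.2 - c) ^ 2
      - 2 * ((f x.1 - c) * (f x.2 - c)) := fun x => by ring
  have i1 : AllMoments (fun x : α × α => f x.1 - c) (P.prod P) := h1.sub (AllMoments.const c)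
  have i2 : AllMoments (fun x : α × α => f x.2 - c) (P.prod P) := h2.sub (AllMoments.const c)
  simp_rw [e]
  rw [integral_sub (((i1.pow 2).add (i2.pow 2)).integrable)
      ((AllMoments.const (2 : ℝ)).mul (i1.mul i2)).integrable,
    integral_add (i1.pow 2).integrable (i2.pow 2).integrable,
    integral_const_mul, integral_prod_mul (fun x => f x - c) (fun x => f x - c), h0,
    integral_fun_fst (fun x => (f x - c) ^ 2), integral_fun_snd (fun x => (f x - c) ^ 2)]
  simp
  ring

/-- For an independent copy `y`, `f x - f y` is half the sum of `u(x-y) · G v(x+y)` and `v(x-y) · Gᵀ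
u(x+y)`, each a bilinear form in independent vectors. The variance is therefore linear in the
dimension, whereas the mean can itself be of that order; the relative fluctuation is small. -/
theorem integral_sq_bilin_sub_integral_le (P : Measure E) [IsGaussian P]
    (u v : E →L[ℝ] (ι → ℝ)) (G : Matrix ι ι ℝ) {C : ℝ} (hC : 0 ≤ C)
    (hu : ∀ c : ι → ℝ, ∫ x, (c ⬝ᵥ u x) ^ 2 ∂P ≤ C * (c ⬝ᵥ c))
    (hv : ∀ c : ι → ℝ, ∫ x, (c ⬝ᵥ v x) ^ 2 ∂P ≤ C * (c ⬝ᵥ c)) :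
    ∫ x, (u x ⬝ᵥ G *ᵥ v x - ∫ y, u y ⬝ᵥ G *ᵥ v y ∂P) ^ 2 ∂P
      ≤ 8 * C ^ 2 * ‖G‖ ^ 2 * Fintype.card ι := by
  have hum := allMoments_clm P u
  have hvm := allMoments_clm P v
  set f : E → ℝ := fun x => u x ⬝ᵥ G *ᵥ v x with hf
  have hfm : AllMoments f P := by fun_prop
  have hvar := two_mul_integral_sq_sub_integral hfm
  have second : ∀ (w : E →L[ℝ] (ι → ℝ)), (∀ c : ι → ℝ, ∫ x, (c ⬝ᵥ w x) ^ 2 ∂P ≤ C * (c ⬝ᵥ c)) →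
      ∀ (σ : ℝ), σ ^ 2 = 1 → ∀ c : ι → ℝ,
      ∫ x, (c ⬝ᵥ (w x.1 + σ • w x.2)) ^ 2 ∂(P.prod P) ≤ 4 * C * (c ⬝ᵥ c) := by
    intro w hw σ hσ c
    have hwm := allMoments_clm P w
    have a1 := hwm.comp_measurePreserving (measurePreserving_fst (μ := P) (ν := P))
    have a2 := hwm.comp_measurePreserving (measurePreserving_snd (μ := P) (ν := P))
    refine integral_sq_dotProduct_add_smul_le a1 a2 hσ c ?_ ?_
    · rw [integral_fun_fst (fun x => (c ⬝ᵥ w x) ^ 2)]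
      simpa using hw c
    · rw [integral_fun_snd (fun x => (c ⬝ᵥ w x) ^ 2)]
      simpa using hw c
  have hind := indepFun_sub_add P
  have hu1 := hum.comp_measurePreserving (measurePreserving_fst (μ := P) (ν := P))
  have hu2 := hum.comp_measurePreserving (measurePreserving_snd (μ := P) (ν := P))
  have hv1 := hvm.comp_measurePreserving (measurePreserving_fst (μ := P) (ν := P))
  have hv2 := hvm.comp_measurePreserving (measurePreserving_snd (μ := P) (ν := P))
  have hA : ∫ x, (u (x.1 - x.2) ⬝ᵥ G *ᵥ v (x.1 + x.2)) ^ 2 ∂(P.prod P)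
      ≤ (4 * C) * ‖G‖ ^ 2 * ((4 * C) * Fintype.card ι) := by
    have hX : AllMoments (fun x : E × E => u (x.1 - x.2)) (P.prod P) := by
      simp only [map_sub]; exact hu1.sub hu2
    have hY : AllMoments (fun x : E × E => v (x.1 + x.2)) (P.prod P) := by
      simp only [map_add]; exact hv1.add hv2
    refine integral_sq_bilin_le_of_indepFun
      (hind.comp u.continuous.measurable v.continuous.measurable) hX hY G (by positivity) ?_ ?_
    · intro c
      simpa [sub_eq_add_neg] using second u hu (-1) (by norm_num) c
    · refine integral_dotProduct_self_le hY fun c => ?_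
      simpa using second v hv 1 (by norm_num) c
  have hB : ∫ x, (v (x.1 - x.2) ⬝ᵥ Gᵀ *ᵥ u (x.1 + x.2)) ^ 2 ∂(P.prod P)
      ≤ (4 * C) * ‖Gᵀ‖ ^ 2 * ((4 * C) * Fintype.card ι) := by
    have hX : AllMoments (fun x : E × E => v (x.1 - x.2)) (P.prod P) := by
      simp only [map_sub]; exact hv1.sub hv2
    have hY : AllMoments (fun x : E × E => u (x.1 + x.2)) (P.prod P) := by
      simp only [map_add]; exact hu1.add hu2
    refine integral_sq_bilin_le_of_indepFun
      (hind.comp v.continuous.measurable u.continuous.measurable) hX hY Gᵀ (by positivity) ?_ ?_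
    · intro c
      simpa [sub_eq_add_neg] using second v hv (-1) (by norm_num) c
    · refine integral_dotProduct_self_le hY fun c => ?_
      simpa using second u hu 1 (by norm_num) c
  rw [norm_transpose_eq] at hB
  have i1 : AllMoments (fun x : E × E => 1 / 2 * (u (x.1 - x.2) ⬝ᵥ G *ᵥ v (x.1 + x.2)) ^ 2)
      (P.prod P) := by
    simp only [map_sub, map_add]
    exact (AllMoments.const _).mul (((hu1.sub hu2).dotProduct ((hv1.add hv2).mulVec G)).pow 2)
  have i2 : AllMoments (fun x : E × E => 1 / 2 * (v (x.1 - x.2) ⬝ᵥ Gᵀ *ᵥ u (x.1 + x.2)) ^ 2)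
      (P.prod P) := by
    simp only [map_sub, map_add]
    exact (AllMoments.const _).mul (((hv1.sub hv2).dotProduct ((hu1.add hu2).mulVec Gᵀ)).pow 2)
  have hle : ∫ x, (f x.1 - f x.2) ^ 2 ∂(P.prod P)
      ≤ ∫ x, (1 / 2 * (u (x.1 - x.2) ⬝ᵥ G *ᵥ v (x.1 + x.2)) ^ 2
        + 1 / 2 * (v (x.1 - x.2) ⬝ᵥ Gᵀ *ᵥ u (x.1 + x.2)) ^ 2) ∂(P.prod P) := by
    have a1 := hfm.comp_measurePreserving (measurePreserving_fst (μ := P) (ν := P))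
    have a2 := hfm.comp_measurePreserving (measurePreserving_snd (μ := P) (ν := P))
    refine integral_mono ((a1.sub a2).pow 2).integrable ((i1.add i2).integrable) fun x => ?_
    · have e : f x.1 - f x.2 = 1 / 2 * (u (x.1 - x.2) ⬝ᵥ G *ᵥ v (x.1 + x.2)
          + v (x.1 - x.2) ⬝ᵥ Gᵀ *ᵥ u (x.1 + x.2)) := by
        have ht : ∀ p q : ι → ℝ, p ⬝ᵥ Gᵀ *ᵥ q = q ⬝ᵥ G *ᵥ p := fun p q => by
          rw [mulVec_transpose, dotProduct_comm, ← dotProduct_mulVec]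
        simp only [hf, ht, map_sub, map_add, mulVec_add, mulVec_sub, dotProduct_add, sub_dotProduct, dotProduct_sub]
        ring
      simp only [e]
      nlinarith [sq_nonneg (u (x.1 - x.2) ⬝ᵥ G *ᵥ v (x.1 + x.2)
          - v (x.1 - x.2) ⬝ᵥ Gᵀ *ᵥ u (x.1 + x.2))]
  -- Each of the two forms contributes at most `½ · 16 C² ‖G‖² |ι|`, and the left side is twice the
  -- variance, whence the constant 8.
  rw [integral_add i1.integrable i2.integrable, integral_const_mul, integral_const_mul] at hle
  nlinarith

end Bilinear

/-! ### Sums of independent centered vectors -/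

section IndependentSums

open scoped Matrix.Norms.L2Operator

variable {Ω κ ι : Type*} {mΩ : MeasurableSpace Ω} {Pr : Measure Ω}

theorem integral_sq_sum_of_iIndepFun {x : κ → Ω → ℝ} (hind : iIndepFun x Pr)
    (hm : ∀ i, AllMoments (x i) Pr) (h0 : ∀ i, ∫ ω, x i ω ∂Pr = 0) (s : Finset κ) :
    ∫ ω, (∑ i ∈ s, x i ω) ^ 2 ∂Pr = ∑ i ∈ s, ∫ ω, x i ω ^ 2 ∂Pr := by
  have h := IndepFun.variance_sum (μ := Pr) (X := x) (s := s)
    (fun i _ => by simpa using hm i 2) (fun i _ j _ hij => hind.indepFun hij)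
  have e : (∑ i ∈ s, x i) = fun ω => ∑ i ∈ s, x i ω := by ext; simp
  rw [e, variance_of_integral_eq_zero] at h
  · rw [h]
    exact Finset.sum_congr rfl fun i _ => variance_of_integral_eq_zero
      (hm i).aestronglyMeasurable.aemeasurable (h0 i)
  · exact (AllMoments.sum hm).aestronglyMeasurable.aemeasurable
  · rw [integral_finsetSum _ fun i _ => (hm i).integrable]
    exact Finset.sum_eq_zero fun i _ => h0 i

variable [IsProbabilityMeasure Pr] [Fintype ι] {Z : κ → Ω → ι → ℝ}

theorem integral_sq_dotProduct_sum_le (hind : iIndepFun Z Pr) (hm : ∀ i, AllMoments (Z i) Pr)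
    (h0 : ∀ i c, ∫ ω, c ⬝ᵥ Z i ω ∂Pr = 0) {p : ℝ}
    (hp : ∀ i c, ∫ ω, (c ⬝ᵥ Z i ω) ^ 2 ∂Pr ≤ p * (c ⬝ᵥ c)) (s : Finset κ) (c : ι → ℝ) :
    ∫ ω, (c ⬝ᵥ ∑ i ∈ s, Z i ω) ^ 2 ∂Pr ≤ s.card * (p * (c ⬝ᵥ c)) := by
  have hc : Measurable fun z : ι → ℝ => c ⬝ᵥ z := by
    simp only [dotProduct]; fun_prop
  have := integral_sq_sum_of_iIndepFun (x := fun i ω => c ⬝ᵥ Z i ω)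
    (hind.comp (fun _ z => c ⬝ᵥ z) fun _ => hc) (fun i => by have := hm i; fun_prop)
    (fun i => h0 i c) s
  simp_rw [dotProduct_sum, this]
  simpa using Finset.sum_le_sum fun i (_ : i ∈ s) => hp i c

theorem integral_sum_dotProduct_sum_le (hind : iIndepFun Z Pr) (hm : ∀ i, AllMoments (Z i) Pr)
    (h0 : ∀ i c, ∫ ω, c ⬝ᵥ Z i ω ∂Pr = 0) {r : ℝ}
    (hr : ∀ i, ∫ ω, Z i ω ⬝ᵥ Z i ω ∂Pr ≤ r) (s : Finset κ) :
    ∫ ω, (∑ i ∈ s, Z i ω) ⬝ᵥ (∑ i ∈ s, Z i ω) ∂Pr ≤ s.card * r := by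
  classical
  have hc : ∀ j, ∫ ω, (∑ i ∈ s, Z i ω j) ^ 2 ∂Pr = ∑ i ∈ s, ∫ ω, Z i ω j ^ 2 ∂Pr := fun j =>
    integral_sq_sum_of_iIndepFun (x := fun i ω => Z i ω j)
      (hind.comp (fun _ z => z j) fun _ => measurable_pi_apply j) (fun i => (hm i).eval j)
      (fun i => by simpa using h0 i (Pi.single j 1)) s
  have hm' : ∀ i j, AllMoments (fun ω => Z i ω j) Pr := fun i j => (hm i).eval j
  simp only [dotProduct, Finset.sum_apply, ← sq]
  rw [integral_finsetSum _ fun j _ =>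
    ((AllMoments.sum fun i => hm' i j).pow 2).integrable]
  simp_rw [hc]
  rw [Finset.sum_comm]
  calc _ ≤ ∑ _i ∈ s, r := Finset.sum_le_sum fun i _ => by
        rw [← integral_finsetSum _ fun j _ => ((hm' i j).pow 2).integrable]
        simpa only [dotProduct, ← sq] using hr i
    _ = _ := by simp

variable [DecidableEq ι]

/-- Concentration of a quadratic form of a sum of independent centered vectors. -/
theorem integral_sq_quadForm_sum_le (hind : iIndepFun Z Pr) (hm : ∀ i, AllMoments (Z i) Pr)
    (h0 : ∀ i c, ∫ ω, c ⬝ᵥ Z i ω ∂Pr = 0) {p r : ℝ} (hp0 : 0 ≤ p) (hr0 : 0 ≤ r)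
    (hp : ∀ i c, ∫ ω, (c ⬝ᵥ Z i ω) ^ 2 ∂Pr ≤ p * (c ⬝ᵥ c))
    (hr : ∀ i, ∫ ω, (Z i ω ⬝ᵥ Z i ω) ^ 2 ∂Pr ≤ r ^ 2)
    (G : Matrix ι ι ℝ) {g : ℝ} (hg : ∀ i, ∫ ω, Z i ω ⬝ᵥ G *ᵥ Z i ω ∂Pr = g) (s : Finset κ) :
    ∫ ω, ((∑ i ∈ s, Z i ω) ⬝ᵥ G *ᵥ (∑ i ∈ s, Z i ω) - s.card * g) ^ 2 ∂Pr
      ≤ ‖G‖ ^ 2 * (8 * p * r * s.card ^ 2 + 2 * r ^ 2 * s.card) := by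
  classical
  have hr1 : ∀ i, ∫ ω, Z i ω ⬝ᵥ Z i ω ∂Pr ≤ r := fun i =>
    le_of_sq_le_sq ((sq_integral_le ((hm i).dotProduct (hm i))).trans (hr i)) hr0
  induction s using Finset.induction_on with
  | empty => simp
  -- Martingale structure: `X` is the centered form of the old sum and `V` the increment due to the
  -- new vector. Given the old sum, `V` has mean zero, so second moments add.
  | insert a s ha ih =>
    have hS : AllMoments (fun ω => ∑ i ∈ s, Z i ω) Pr := AllMoments.sum hm
    have hZ := hm a
    have hindS : IndepFun (fun ω => ∑ i ∈ s, Z i ω) (Z a) Pr := by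
      have := hind.indepFun_finsetSum_of_notMem₀
        (fun i => (hm i).aestronglyMeasurable.aemeasurable) ha
      convert this using 1
      ext ω; simp
    set S : Ω → ι → ℝ := fun ω => ∑ i ∈ s, Z i ω with hSdef
    set n : ℝ := (s.card : ℝ) with hn
    have hn0 : 0 ≤ n := by positivity
    let X : (ι → ℝ) → ℝ := fun y => y ⬝ᵥ G *ᵥ y - n * g
    let V : (ι → ℝ) → (ι → ℝ) → ℝ := fun y z => z ⬝ᵥ (G + Gᵀ) *ᵥ y + (z ⬝ᵥ G *ᵥ z - g)
    have ht : ∀ p q : ι → ℝ, p ⬝ᵥ Gᵀ *ᵥ q = q ⬝ᵥ G *ᵥ p := fun p q => by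
      rw [mulVec_transpose, dotProduct_comm, ← dotProduct_mulVec]
    have hexp : ∀ ω, (∑ i ∈ insert a s, Z i ω) ⬝ᵥ G *ᵥ (∑ i ∈ insert a s, Z i ω)
        - (insert a s).card * g = X (S ω) + V (S ω) (Z a ω) := by
      intro ω
      simp only [X, V, Finset.sum_insert ha, Finset.card_insert_of_notMem ha, hSdef, add_dotProduct,
        mulVec_add, dotProduct_add, add_mulVec, ht]
      push_cast
      ring
    have hXm : AllMoments (fun ω => X (S ω)) Pr := by simp only [X]; fun_prop
    have hVm : AllMoments (fun ω => V (S ω) (Z a ω)) Pr := by simp only [V]; fun_prop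
    have hVm' : ∀ y, AllMoments (fun ω => V y (Z a ω)) Pr := fun y => by simp only [V]; fun_prop
    have hcross : ∫ ω, X (S ω) * V (S ω) (Z a ω) ∂Pr = 0 := by
      have hF : Measurable (Function.uncurry fun y z => X y * V y z) := by
        apply Continuous.measurable
        simp only [Function.uncurry_def, X, V, dotProduct, mulVec]
        fun_prop
      rw [(integral_comp_prodMk_of_indepFun hindS hS.aestronglyMeasurable.aemeasurable
        hZ.aestronglyMeasurable.aemeasurable hF (hXm.mul hVm).integrable).2]
      have : ∀ y, ∫ ω, X y * V y (Z a ω) ∂Pr = 0 := by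
        intro y
        rw [integral_const_mul]
        have : ∫ ω, V y (Z a ω) ∂Pr = 0 := by
          simp only [V]
          rw [integral_add (AllMoments.integrable (by fun_prop))
            (AllMoments.integrable (by fun_prop)),
            integral_sub (AllMoments.integrable (by fun_prop)) (integrable_const _), hg a]
          simp_rw [dotProduct_comm (Z a _) ((G + Gᵀ) *ᵥ y)]
          rw [h0 a]
          simp
        rw [this, mul_zero]
      simp [this]
    -- The increment has a part linear in `Z a`, of second moment `p ‖G + Gᵀ‖² · n r`, and a part
    -- quadratic in `Z a` alone, of second moment at most `‖G‖² r²`.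
    have hV2 : ∫ ω, V (S ω) (Z a ω) ^ 2 ∂Pr ≤ ‖G‖ ^ 2 * (8 * p * r * n + 2 * r ^ 2) := by
      have h1 : ∫ ω, (Z a ω ⬝ᵥ (G + Gᵀ) *ᵥ S ω) ^ 2 ∂Pr ≤ p * ‖G + Gᵀ‖ ^ 2 * (n * r) :=
        integral_sq_bilin_le_of_indepFun hindS.symm hZ hS _ hp0 (hp a)
          (integral_sum_dotProduct_sum_le hind hm h0 hr1 s)
      have h2 : ∫ ω, (Z a ω ⬝ᵥ G *ᵥ Z a ω - g) ^ 2 ∂Pr ≤ ‖G‖ ^ 2 * r ^ 2 := by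
        have hq : AllMoments (fun ω => Z a ω ⬝ᵥ G *ᵥ Z a ω) Pr := by fun_prop
        calc _ = ∫ ω, (Z a ω ⬝ᵥ G *ᵥ Z a ω) ^ 2 ∂Pr - g ^ 2 := by
              have e : ∀ ω, (Z a ω ⬝ᵥ G *ᵥ Z a ω - g) ^ 2 = (Z a ω ⬝ᵥ G *ᵥ Z a ω) ^ 2
                - 2 * g * (Z a ω ⬝ᵥ G *ᵥ Z a ω) + g ^ 2 := fun ω => by ring
              simp_rw [e]
              rw [integral_add (AllMoments.integrable (by fun_prop)) (integrable_const _),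
                integral_sub (AllMoments.integrable (by fun_prop))
                (AllMoments.integrable (by fun_prop)), integral_const_mul, hg a]
              simp
              ring
          _ ≤ ∫ ω, (Z a ω ⬝ᵥ G *ᵥ Z a ω) ^ 2 ∂Pr := by linarith [sq_nonneg g]
          _ ≤ ∫ ω, ‖G‖ ^ 2 * (Z a ω ⬝ᵥ Z a ω) ^ 2 ∂Pr := by
              refine integral_mono (AllMoments.integrable (by fun_prop))
                (AllMoments.integrable (by fun_prop)) fun ω => ?_
              simpa only [sq (Z a ω ⬝ᵥ Z a ω)] using sq_dotProduct_mulVec_le G (Z a ω) (Z a ω)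
          _ ≤ _ := by
              rw [integral_const_mul]
              gcongr
              exact hr a
      have hG : ‖G + Gᵀ‖ ^ 2 ≤ 4 * ‖G‖ ^ 2 := by
        have : ‖G + Gᵀ‖ ≤ 2 * ‖G‖ := by
          refine (norm_add_le _ _).trans ?_
          rw [norm_transpose_eq]; linarith
        calc _ ≤ (2 * ‖G‖) ^ 2 := by gcongr
          _ = _ := by ring
      calc _ ≤ ∫ ω, (2 * (Z a ω ⬝ᵥ (G + Gᵀ) *ᵥ S ω) ^ 2
            + 2 * (Z a ω ⬝ᵥ G *ᵥ Z a ω - g) ^ 2) ∂Pr := by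
            refine integral_mono (hVm.pow 2).integrable
              (AllMoments.integrable (by fun_prop)) fun ω => ?_
            simp only [V]
            nlinarith [sq_nonneg (Z a ω ⬝ᵥ (G + Gᵀ) *ᵥ S ω - (Z a ω ⬝ᵥ G *ᵥ Z a ω - g))]
        _ ≤ 2 * (p * ‖G + Gᵀ‖ ^ 2 * (n * r)) + 2 * (‖G‖ ^ 2 * r ^ 2) := by
            rw [integral_add (AllMoments.integrable (by fun_prop))
              (AllMoments.integrable (by fun_prop)), integral_const_mul, integral_const_mul]
            linarith
        _ ≤ 2 * (p * (4 * ‖G‖ ^ 2) * (n * r)) + 2 * (‖G‖ ^ 2 * r ^ 2) := by gcongr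
        _ = _ := by ring
    simp_rw [hexp]
    have e : ∀ ω, (X (S ω) + V (S ω) (Z a ω)) ^ 2 = X (S ω) ^ 2
        + 2 * (X (S ω) * V (S ω) (Z a ω)) + V (S ω) (Z a ω) ^ 2 := fun ω => by ring
    simp_rw [e]
    rw [integral_add (((hXm.pow 2).add ((AllMoments.const (2 : ℝ)).mul (hXm.mul hVm))).integrable)
      (hVm.pow 2).integrable, integral_add (hXm.pow 2).integrable
      ((AllMoments.const (2 : ℝ)).mul (hXm.mul hVm)).integrable, integral_const_mul, hcross]
    rw [Finset.card_insert_of_notMem ha]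
    push_cast
    rw [← hn]
    -- The slack in `n² + n ≤ (n + 1)²`, by which the increment is absorbed into the quadratic term
    -- of the bound.
    have hpr : 0 ≤ ‖G‖ ^ 2 * (8 * p * r * (n + 1)) := by positivity
    calc _ ≤ ‖G‖ ^ 2 * (8 * p * r * n ^ 2 + 2 * r ^ 2 * n) + 2 * 0
          + ‖G‖ ^ 2 * (8 * p * r * n + 2 * r ^ 2) := by gcongr
      _ ≤ _ := by nlinarith

end IndependentSums

/-! ### The update direction of a single episode -/

section Episode

open scoped Matrix.Norms.L2Operator

/-- The update direction `∑_t Δ(t) ψ(t)` of an episode. -/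
def tdGrad {N T : ℕ} (γ : ℝ) (wR w : Fin N → ℝ) (x : Fin (T + 1) → Fin N → ℝ) : Fin N → ℝ :=
  ∑ t : Fin T, tdError γ wR w x t • x t.castSucc

/-- The correlation of the TD errors at fixed weights. -/
def tdCorr {N T : ℕ} (P : Measure (Fin (T + 1) → Fin N → ℝ)) (γ : ℝ) (wR w : Fin N → ℝ)
    (t t' : Fin T) : ℝ :=
  ∫ x, tdError γ wR w x t * tdError γ wR w x t' ∂P

/-- The total second moment of the TD errors at fixed weights. -/
def tdPower {N T : ℕ} (P : Measure (Fin (T + 1) → Fin N → ℝ)) (γ : ℝ) (wR w : Fin N → ℝ) : ℝ :=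
  ∑ t : Fin T, tdCorr P γ wR w t t

variable {N T : ℕ} {P : Measure (Fin (T + 1) → Fin N → ℝ)} {γ C : ℝ} {wR w : Fin N → ℝ}

theorem tdError_eq (x : Fin (T + 1) → Fin N → ℝ) (t : Fin T) :
    tdError γ wR w x t
      = ((wR - w) ⬝ᵥ x t.castSucc + γ * (w ⬝ᵥ x t.succ)) / √(N : ℝ) := by
  simp only [tdError, readout, sub_dotProduct]
  ring

theorem tdCorr_self_nonneg (t : Fin T) : 0 ≤ tdCorr P γ wR w t t :=
  integral_nonneg fun _ => mul_self_nonneg _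

theorem tdPower_nonneg : 0 ≤ tdPower P γ wR w :=
  Finset.sum_nonneg fun t _ => tdCorr_self_nonneg t

theorem tdCorr_comm (t t' : Fin T) : tdCorr P γ wR w t t' = tdCorr P γ wR w t' t := by
  simp only [tdCorr, mul_comm]

theorem integral_sq_tdError_le (t : Fin T) :
    ∫ x, tdError γ wR w x t ^ 2 ∂P ≤ tdPower P γ wR w := by
  simp only [sq]
  exact Finset.single_le_sum (f := fun t => tdCorr P γ wR w t t)
    (fun t _ => tdCorr_self_nonneg t) (Finset.mem_univ t)

/-- The linear functional `v ↦ c · v` as a continuous linear map. -/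
def dotCLM (c : Fin N → ℝ) : (Fin N → ℝ) →L[ℝ] ℝ :=
  ∑ i, c i • ContinuousLinearMap.proj i

theorem dotCLM_apply (c v : Fin N → ℝ) : dotCLM c v = c ⬝ᵥ v := by
  simp [dotCLM, dotProduct]

variable [IsGaussian P]

theorem allMoments_episode (P : Measure (Fin (T + 1) → Fin N → ℝ)) [IsGaussian P]
    (t : Fin (T + 1)) : AllMoments (fun x : Fin (T + 1) → Fin N → ℝ => x t) P :=
  allMoments_clm P (ContinuousLinearMap.proj t)

theorem hasGaussianLaw_dotProduct (P : Measure (Fin (T + 1) → Fin N → ℝ)) [IsGaussian P]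
    (t : Fin (T + 1)) (c : Fin N → ℝ) :
    HasGaussianLaw (fun x : Fin (T + 1) → Fin N → ℝ => c ⬝ᵥ x t) P := by
  have := hasGaussianLaw_clm P ((dotCLM c).comp (ContinuousLinearMap.proj t))
  simpa [dotCLM_apply] using this

theorem hasGaussianLaw_tdError (P : Measure (Fin (T + 1) → Fin N → ℝ)) [IsGaussian P] (γ : ℝ)
    (wR w : Fin N → ℝ) (t : Fin T) :
    HasGaussianLaw (fun x : Fin (T + 1) → Fin N → ℝ => tdError γ wR w x t) P := by
  have := hasGaussianLaw_clm P ((√(N : ℝ))⁻¹ •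
    ((dotCLM (wR - w)).comp (ContinuousLinearMap.proj t.castSucc)
      + γ • (dotCLM w).comp (ContinuousLinearMap.proj t.succ)))
  have e : (fun x : Fin (T + 1) → Fin N → ℝ => tdError γ wR w x t) = fun x => ((√(N : ℝ))⁻¹ •
      ((dotCLM (wR - w)).comp (ContinuousLinearMap.proj t.castSucc)
        + γ • (dotCLM w).comp (ContinuousLinearMap.proj t.succ)) :
        (Fin (T + 1) → Fin N → ℝ) →L[ℝ] ℝ) x := by
    ext x
    rw [tdError_eq]
    simp [dotCLM_apply, div_eq_inv_mul]
    ring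
  rw [e]
  exact this

theorem allMoments_tdError (P : Measure (Fin (T + 1) → Fin N → ℝ)) [IsGaussian P] (γ : ℝ)
    (wR w : Fin N → ℝ) (t : Fin T) :
    AllMoments (fun x : Fin (T + 1) → Fin N → ℝ => tdError γ wR w x t) P :=
  allMoments_of_hasGaussianLaw (hasGaussianLaw_tdError P γ wR w t)

theorem allMoments_tdGrad (P : Measure (Fin (T + 1) → Fin N → ℝ)) [IsGaussian P] (γ : ℝ)
    (wR w : Fin N → ℝ) :
    AllMoments (fun x : Fin (T + 1) → Fin N → ℝ => tdGrad γ wR w x) P := by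
  have h1 := allMoments_tdError P γ wR w
  have h2 := allMoments_episode P
  exact AllMoments.sum fun t => (h1 t).smul (h2 t.castSucc)

theorem dotProduct_corr_mulVec (P : Measure (Fin (T + 1) → Fin N → ℝ)) [IsGaussian P]
    (t t' : Fin (T + 1)) (u v : Fin N → ℝ) :
    u ⬝ᵥ corr P t t' *ᵥ v = ∫ x, (u ⬝ᵥ x t) * (v ⬝ᵥ x t') ∂P := by
  have h : ∀ t i, AllMoments (fun x : Fin (T + 1) → Fin N → ℝ => x t i) P := fun t i =>
    (allMoments_episode P t).eval i
  simp only [dotProduct, mulVec, corr, of_apply, Finset.sum_mul_sum]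
  rw [integral_finsetSum _ fun i _ => (AllMoments.sum fun j =>
    ((AllMoments.const (u i)).mul (h t i)).mul ((AllMoments.const (v j)).mul (h t' j))).integrable]
  refine Finset.sum_congr rfl fun i _ => ?_
  rw [integral_finsetSum _ fun j _ =>
    (((AllMoments.const (u i)).mul (h t i)).mul ((AllMoments.const (v j)).mul (h t' j))).integrable,
    Finset.mul_sum]
  refine Finset.sum_congr rfl fun j _ => ?_
  have e : ∀ x : Fin (T + 1) → Fin N → ℝ,
    u i * x t i * (v j * x t' j) = (u i * v j) * (x t i * x t' j) := fun x => by ring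
  simp_rw [e]
  rw [integral_const_mul]
  ring

theorem integral_bilin_eq_trace (P : Measure (Fin (T + 1) → Fin N → ℝ)) [IsGaussian P]
    (t t' : Fin (T + 1)) (G : Matrix (Fin N) (Fin N) ℝ) :
    ∫ x, x t' ⬝ᵥ G *ᵥ x t ∂P = (G * corr P t t').trace := by
  have h : ∀ t i, AllMoments (fun x : Fin (T + 1) → Fin N → ℝ => x t i) P := fun t i =>
    (allMoments_episode P t).eval i
  simp only [dotProduct, mulVec, corr, Matrix.trace, diag_apply, mul_apply, of_apply,
    Finset.mul_sum]
  rw [integral_finsetSum _ fun i _ => (AllMoments.sum fun j =>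
    (h t' i).mul ((AllMoments.const (G i j)).mul (h t j))).integrable]
  refine Finset.sum_congr rfl fun i _ => ?_
  rw [integral_finsetSum _ fun j _ =>
    ((h t' i).mul ((AllMoments.const (G i j)).mul (h t j))).integrable]
  refine Finset.sum_congr rfl fun j _ => ?_
  rw [← integral_const_mul]
  congr 1
  ext x
  ring

/-- Cauchy–Schwarz: correlations between different times are controlled by the equal-time ones, the
only ones assumed bounded. -/
theorem norm_corr_le (hC0 : 0 ≤ C)
    (hC : ∀ (t : Fin (T + 1)) (v : Fin N → ℝ), ∫ x, (v ⬝ᵥ x t) ^ 2 ∂P ≤ C * (v ⬝ᵥ v))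
    (t t' : Fin (T + 1)) : ‖corr P t t'‖ ≤ C := by
  refine norm_le_of_sq_dotProduct_mulVec_le hC0 fun u v => ?_
  have h : ∀ t c, AllMoments (fun x : Fin (T + 1) → Fin N → ℝ => c ⬝ᵥ x t) P := fun t c =>
    (AllMoments.const c).dotProduct (allMoments_episode P t)
  rw [dotProduct_corr_mulVec]
  refine (sq_integral_mul_le (h t u) (h t' v)).trans ?_
  calc _ ≤ (C * (u ⬝ᵥ u)) * (C * (v ⬝ᵥ v)) := by
        refine mul_le_mul (by simpa [sq] using hC t u) (by simpa [sq] using hC t' v)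
          (integral_nonneg fun x => mul_self_nonneg _) ?_
        exact mul_nonneg hC0 (dotProduct_self_nonneg' u)
    _ = _ := by ring

/-- Along a fixed direction the update is a sum of `T` products of two Gaussian scalars. The bound
contains no factor `N`: this is the parameter `p` in the concentration of the batch noise. -/
theorem integral_sq_dotProduct_tdGrad_le
    (hC : ∀ (t : Fin (T + 1)) (v : Fin N → ℝ), ∫ x, (v ⬝ᵥ x t) ^ 2 ∂P ≤ C * (v ⬝ᵥ v))
    (c : Fin N → ℝ) :
    ∫ x, (c ⬝ᵥ tdGrad γ wR w x) ^ 2 ∂P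
      ≤ (T ^ 2 * gaussianConst * tdPower P γ wR w * C) * (c ⬝ᵥ c) := by
  have h1 := allMoments_tdError P γ wR w
  have h2 := allMoments_episode P
  have e : ∀ x, c ⬝ᵥ tdGrad γ wR w x
      = ∑ t : Fin T, tdError γ wR w x t * (c ⬝ᵥ x t.castSucc) := fun x => by
    simp [tdGrad, dotProduct_sum, dotProduct_smul]
  simp_rw [e]
  refine (integral_sq_sum_le (s := Finset.univ)
    (c := gaussianConst * (tdPower P γ wR w * (C * (c ⬝ᵥ c))))
    (fun t => (h1 t).mul ((AllMoments.const c).dotProduct (h2 t.castSucc)))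
    fun t _ => ?_).trans (le_of_eq ?_)
  · exact integral_sq_mul_le (hasGaussianLaw_tdError P γ wR w t)
      (hasGaussianLaw_dotProduct P t.castSucc c) (integral_sq_tdError_le t) (hC _ c)
  · simp
    ring

/-- The squared length is a sum of `N` coordinates of order one. Together with the directional bound
this supplies the parameter `r = O(N)` in the concentration of the batch noise. -/
theorem integral_sq_tdGrad_dotProduct_self_le
    (hC : ∀ (t : Fin (T + 1)) (v : Fin N → ℝ), ∫ x, (v ⬝ᵥ x t) ^ 2 ∂P ≤ C * (v ⬝ᵥ v)) :
    ∫ x, (tdGrad γ wR w x ⬝ᵥ tdGrad γ wR w x) ^ 2 ∂P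
      ≤ T ^ 4 * gaussianConst * (tdPower P γ wR w * C * N) ^ 2 := by
  have h1 := allMoments_tdError P γ wR w
  have h2 := allMoments_episode P
  have h3 : ∀ t i, AllMoments (fun x : Fin (T + 1) → Fin N → ℝ => x t i) P := fun t i =>
    (h2 t).eval i
  have hY := allMoments_tdGrad P γ wR w
  -- Two applications of Cauchy–Schwarz over the `T` times give the fourth power of the sum with the
  -- factor `T³`.
  have hT : ∀ i : Fin N, ∀ x : Fin (T + 1) → Fin N → ℝ, (tdGrad γ wR w x i ^ 2) ^ 2
      ≤ (T : ℝ) ^ 3 * ∑ t : Fin T, (tdError γ wR w x t * x t.castSucc i) ^ 4 := by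
    intro i x
    have e : tdGrad γ wR w x i = ∑ t : Fin T, tdError γ wR w x t * x t.castSucc i := by
      simp [tdGrad]
    have a1 := sq_sum_le_card_mul_sum_sq (s := Finset.univ)
      (f := fun t : Fin T => tdError γ wR w x t * x t.castSucc i)
    have a2 := sq_sum_le_card_mul_sum_sq (s := Finset.univ)
      (f := fun t : Fin T => (tdError γ wR w x t * x t.castSucc i) ^ 2)
    simp only [Finset.card_univ, Fintype.card_fin, ← pow_mul] at a1 a2
    rw [e]
    calc _ ≤ ((T : ℝ) * ∑ t : Fin T, (tdError γ wR w x t * x t.castSucc i) ^ 2) ^ 2 := by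
          gcongr
      _ ≤ (T : ℝ) ^ 2 * ((T : ℝ) * ∑ t : Fin T, (tdError γ wR w x t * x t.castSucc i) ^ 4) := by
          rw [mul_pow]; gcongr
      _ = _ := by ring
  have hint : ∀ i t, Integrable (fun x => (tdError γ wR w x t * x (Fin.castSucc t) i) ^ 4) P :=
    fun i t => (((h1 t).mul (h3 _ i)).pow 4).integrable
  calc _ ≤ ∫ x, ((N : ℝ) * ∑ i : Fin N, ((T : ℝ) ^ 3 *
        ∑ t : Fin T, (tdError γ wR w x t * x t.castSucc i) ^ 4)) ∂P := by
        refine integral_mono ((hY.dotProduct hY).pow 2).integrable ?_ fun x => ?_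
        · exact ((AllMoments.const _).mul (AllMoments.sum fun i => (AllMoments.const _).mul
            (AllMoments.sum fun t => ((h1 t).mul (h3 _ i)).pow 4))).integrable
        · have a := sq_sum_le_card_mul_sum_sq (s := Finset.univ)
            (f := fun i : Fin N => tdGrad γ wR w x i ^ 2)
          simp only [Finset.card_univ, Fintype.card_fin] at a
          simp only [dotProduct, ← sq]
          refine a.trans ?_
          gcongr with i
          exact hT i x
    _ = (N : ℝ) * ∑ i : Fin N, ((T : ℝ) ^ 3 *
        ∑ t : Fin T, ∫ x, (tdError γ wR w x t * x t.castSucc i) ^ 4 ∂P) := by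
        rw [integral_const_mul, integral_finsetSum _ fun i _ =>
          (integrable_finsetSum _ fun t _ => hint i t).const_mul _]
        simp_rw [integral_const_mul]
        congr 1
        refine Finset.sum_congr rfl fun i _ => ?_
        rw [integral_finsetSum _ fun t _ => hint i t]
    _ ≤ (N : ℝ) * ∑ i : Fin N, ((T : ℝ) ^ 3 *
        ∑ t : Fin T, gaussianConst * (tdPower P γ wR w * C) ^ 2) := by
        gcongr with i _ t
        refine integral_pow_four_mul_le (hasGaussianLaw_tdError P γ wR w t) ?_
          (integral_sq_tdError_le t) ?_
        · simpa using hasGaussianLaw_dotProduct P t.castSucc (Pi.single i 1)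
        · simpa using hC t.castSucc (Pi.single i 1)
    _ = _ := by simp; ring

/-- The product `Δ(t) Δ(t')` and the form `ψ(t') · G ψ(t)` are dependent, but the latter may be
replaced by its mean: its standard deviation is `O(√N)` while the mean is of order up to `N`. The
expectation thus factorizes to leading order. -/
theorem abs_integral_tdGrad_quadForm_sub_le (hC0 : 0 ≤ C)
    (hC : ∀ (t : Fin (T + 1)) (v : Fin N → ℝ), ∫ x, (v ⬝ᵥ x t) ^ 2 ∂P ≤ C * (v ⬝ᵥ v))
    (G : Matrix (Fin N) (Fin N) ℝ) :
    |∫ x, tdGrad γ wR w x ⬝ᵥ G *ᵥ tdGrad γ wR w x ∂P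
        - ∑ t : Fin T, ∑ t' : Fin T,
          tdCorr P γ wR w t t' * (G * corr P t.castSucc t'.castSucc).trace|
      ≤ T ^ 2 * (3 * gaussianConst * tdPower P γ wR w * C * ‖G‖ * √(N : ℝ)) := by
  have h1 := allMoments_tdError P γ wR w
  have h2 := allMoments_episode P
  have hk := one_le_gaussianConst
  set a : Fin T → (Fin (T + 1) → Fin N → ℝ) → ℝ := fun t x => tdError γ wR w x t with ha
  have h1' : ∀ t, AllMoments (a t) P := h1
  have hf : ∀ t t' : Fin T, AllMoments (fun x : Fin (T + 1) → Fin N → ℝ =>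
      x t'.castSucc ⬝ᵥ G *ᵥ x t.castSucc) P := fun t t' =>
    (h2 _).dotProduct ((h2 _).mulVec G)
  have e : ∀ x, tdGrad γ wR w x ⬝ᵥ G *ᵥ tdGrad γ wR w x
      = ∑ t : Fin T, ∑ t' : Fin T,
        (a t x * a t' x) * (x t'.castSucc ⬝ᵥ G *ᵥ x t.castSucc) := fun x => by
    simp only [tdGrad, mulVec_sum, sum_dotProduct, dotProduct_sum, mulVec_smul, dotProduct_smul,
      smul_dotProduct, smul_eq_mul, ha, Finset.mul_sum, mul_assoc]
  simp_rw [e]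
  rw [integral_finsetSum _ fun t _ => (AllMoments.sum fun t' =>
    ((h1' t).mul (h1' t')).mul (hf t t')).integrable]
  simp_rw [integral_finsetSum _ fun t' _ => (((h1' _).mul (h1' t')).mul (hf _ t')).integrable]
  rw [← Finset.sum_sub_distrib]
  simp_rw [← Finset.sum_sub_distrib]
  have key : ∀ t t' : Fin T, |∫ x, (a t x * a t' x) * (x t'.castSucc ⬝ᵥ G *ᵥ x t.castSucc) ∂P
      - tdCorr P γ wR w t t' * (G * corr P t.castSucc t'.castSucc).trace|
      ≤ 3 * gaussianConst * tdPower P γ wR w * C * ‖G‖ * √(N : ℝ) := by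
    intro t t'
    rw [← integral_bilin_eq_trace]
    generalize hm : ∫ x, x t'.castSucc ⬝ᵥ G *ᵥ x t.castSucc ∂P = m
    have hv := integral_sq_bilin_sub_integral_le P (ContinuousLinearMap.proj t'.castSucc)
      (ContinuousLinearMap.proj t.castSucc) G hC0 (hC t'.castSucc) (hC t.castSucc)
    simp only [ContinuousLinearMap.proj_apply, hm, Fintype.card_fin] at hv
    have hd : ∫ x, (a t x * a t' x) * (x t'.castSucc ⬝ᵥ G *ᵥ x t.castSucc) ∂P
        - tdCorr P γ wR w t t' * m
        = ∫ x, (a t x * a t' x) * (x t'.castSucc ⬝ᵥ G *ᵥ x t.castSucc - m) ∂P := by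
      simp_rw [mul_sub]
      rw [integral_sub (((h1' t).mul (h1' t')).mul (hf t t')).integrable
        (((h1' t).mul (h1' t')).mul (AllMoments.const m)).integrable, integral_mul_const]
      rfl
    rw [hd]
    have hq : 0 ≤ tdPower P γ wR w := tdPower_nonneg
    apply abs_le_of_sq_le_sq _ (by positivity)
    refine (sq_integral_mul_le ((h1' t).mul (h1' t'))
      ((hf t t').sub (AllMoments.const m))).trans ?_
    have b1 := integral_sq_mul_le (hasGaussianLaw_tdError P γ wR w t)
      (hasGaussianLaw_tdError P γ wR w t') (integral_sq_tdError_le t) (integral_sq_tdError_le t')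
    simp only [sq] at b1 hv
    calc _ ≤ (gaussianConst * (tdPower P γ wR w * tdPower P γ wR w))
          * (8 * (C * C) * (‖G‖ * ‖G‖) * N) := by
          refine mul_le_mul b1 hv (integral_nonneg fun x => mul_self_nonneg _) (by positivity)
      _ = 8 * gaussianConst * (tdPower P γ wR w * C * ‖G‖) ^ 2 * N := by ring
      -- `8 κ ≤ 9 κ²` turns the bound into a perfect square, so that its root is the stated `3 κ`.
      _ ≤ 9 * gaussianConst ^ 2 * (tdPower P γ wR w * C * ‖G‖) ^ 2 * N := by
          gcongr
          · norm_num
          · nlinarith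
      _ = _ := by
          have : √(N : ℝ) ^ 2 = N := Real.sq_sqrt (by positivity)
          simp only [mul_pow, this]
          ring
  refine (Finset.abs_sum_le_sum_abs _ _).trans ?_
  calc _ ≤ ∑ _t : Fin T, ∑ _t' : Fin T,
        3 * gaussianConst * tdPower P γ wR w * C * ‖G‖ * √(N : ℝ) := by
        gcongr with t
        refine (Finset.abs_sum_le_sum_abs _ _).trans ?_
        gcongr with t'
        exact key t t'
    _ = _ := by simp; ring

/-- The mean update direction. -/
theorem smul_integral_tdGrad (P : Measure (Fin (T + 1) → Fin N → ℝ)) [IsGaussian P] (γ : ℝ)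
    (wR w : Fin N → ℝ) (i : Fin N) :
    √(N : ℝ) / T * ∫ x, tdGrad γ wR w x i ∂P
      = (sigmaBar (corr P) *ᵥ wR - driftMatrix γ (corr P) *ᵥ w) i := by
  -- The coordinate `i` itself excludes `N = 0`, so the factor `√N` cancels the normalization of the
  -- TD error.
  have hN : √(N : ℝ) ≠ 0 := by
    have : 0 < N := i.pos
    positivity
  have h1 := allMoments_tdError P γ wR w
  have h2 : ∀ t i, AllMoments (fun x : Fin (T + 1) → Fin N → ℝ => x t i) P := fun t i =>
    (allMoments_episode P t).eval i
  have h3 : ∀ t c, AllMoments (fun x : Fin (T + 1) → Fin N → ℝ => c ⬝ᵥ x t) P := fun t c =>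
    (AllMoments.const c).dotProduct (allMoments_episode P t)
  have hcorr : ∀ (t t' : Fin (T + 1)) (v : Fin N → ℝ),
      (corr P t t' *ᵥ v) i = ∫ x, x t i * (v ⬝ᵥ x t') ∂P := fun t t' v => by
    have := dotProduct_corr_mulVec P t t' (Pi.single i 1) v
    simpa using this
  have ht : ∀ t : Fin T, √(N : ℝ) * ∫ x, tdError γ wR w x t * x t.castSucc i ∂P
      = (corr P t.castSucc t.castSucc *ᵥ (wR - w)) i + γ * (corr P t.castSucc t.succ *ᵥ w) i := by
    intro t
    rw [hcorr, hcorr, ← integral_const_mul, ← integral_const_mul,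
      ← integral_add ((h2 _ _).mul (h3 _ _)).integrable
        ((AllMoments.const γ).mul ((h2 _ _).mul (h3 _ _))).integrable]
    congr 1
    ext x
    rw [tdError_eq]
    field_simp
  have e : ∀ x, tdGrad γ wR w x i = ∑ t : Fin T, tdError γ wR w x t * x t.castSucc i := fun x => by
    simp [tdGrad]
  simp_rw [e]
  rw [integral_finsetSum _ fun t _ => ((h1 t).mul (h2 _ i)).integrable, div_mul_eq_mul_div,
    Finset.mul_sum, Finset.sum_congr rfl fun t _ => ht t]
  simp only [driftMatrix, sigmaBar, sigmaBarPlus, sub_mulVec, smul_mulVec, sum_mulVec, mulVec_sub,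
    Pi.sub_apply, Pi.smul_apply, Finset.sum_apply, smul_eq_mul, Finset.sum_add_distrib,
    Finset.sum_sub_distrib, ← Finset.mul_sum]
  ring

end Episode

/-! ### The noise of a batch of independent episodes at fixed weights -/

section Batch

open scoped Matrix.Norms.L2Operator

/-- The mean update direction of an episode. -/
def meanGrad {N T : ℕ} (P : Measure (Fin (T + 1) → Fin N → ℝ)) (γ : ℝ) (wR w : Fin N → ℝ) :
    Fin N → ℝ :=
  fun i => ∫ x, tdGrad γ wR w x i ∂P

/-- The deviation of the update of a batch `y` from its mean. -/
def batchNoise {N T B : ℕ} (P : Measure (Fin (T + 1) → Fin N → ℝ)) (γ h : ℝ) (wR w : Fin N → ℝ)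
    (y : Fin B → Fin (T + 1) → Fin N → ℝ) : Fin N → ℝ :=
  (h * √(N : ℝ) / ((B : ℝ) * (T : ℝ))) • ∑ μ, (tdGrad γ wR w (y μ) - meanGrad P γ wR w)

/-- The rate of concentration of quadratic forms of the batch noise. -/
def noiseRate (N B : ℝ) : ℝ :=
  (√(32 * (N * B ^ 2 + N ^ 2 * B)) + B * (3 * √N + 1)) / B ^ 2

theorem noiseRate_nonneg {N B : ℝ} (hB : 0 ≤ B) : 0 ≤ noiseRate N B := by
  unfold noiseRate; positivity

theorem integral_comp_of_hasLaw {Ω α : Type*} {mΩ : MeasurableSpace Ω} {mα : MeasurableSpace α}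
    {P : Measure α} {Pr : Measure Ω} {X : Ω → α} (hX : HasLaw X P Pr) {f : α → ℝ}
    (hf : AllMoments f P) : ∫ ω, f (X ω) ∂Pr = ∫ x, f x ∂P :=
  hX.integral_comp hf.aestronglyMeasurable

/-! ### Centering a random vector at its mean -/

section Centering

variable {α ι : Type*} {mα : MeasurableSpace α} {P : Measure α} [IsProbabilityMeasure P]
  [Fintype ι] {Y : α → ι → ℝ}

theorem integral_dotProduct_sub_mean (hY : AllMoments Y P) (c : ι → ℝ) :
    ∫ x, c ⬝ᵥ (Y x - fun i => ∫ z, Y z i ∂P) ∂P = 0 := by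
  simp_rw [dotProduct_sub]
  rw [integral_sub (AllMoments.integrable (by fun_prop)) (integrable_const _),
    integral_dotProduct_const hY]
  simp

theorem integral_sq_dotProduct_sub_mean_le (hY : AllMoments Y P) (c : ι → ℝ) :
    ∫ x, (c ⬝ᵥ (Y x - fun i => ∫ z, Y z i ∂P)) ^ 2 ∂P ≤ ∫ x, (c ⬝ᵥ Y x) ^ 2 ∂P := by
  set m := c ⬝ᵥ fun i => ∫ z, Y z i ∂P with hm
  have e : ∀ x, (c ⬝ᵥ (Y x - fun i => ∫ z, Y z i ∂P)) ^ 2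
      = (c ⬝ᵥ Y x) ^ 2 - 2 * m * (c ⬝ᵥ Y x) + m ^ 2 := fun x => by
    rw [dotProduct_sub, ← hm]; ring
  simp_rw [e]
  rw [integral_add (AllMoments.integrable (by fun_prop)) (integrable_const _),
    integral_sub (AllMoments.integrable (by fun_prop)) (AllMoments.integrable (by fun_prop)),
    integral_const_mul, integral_dotProduct_const hY, ← hm]
  simp
  nlinarith [sq_nonneg m]

theorem integral_sub_mean_quadForm (hY : AllMoments Y P) (G : Matrix ι ι ℝ) :
    ∫ x, (Y x - fun i => ∫ z, Y z i ∂P) ⬝ᵥ G *ᵥ (Y x - fun i => ∫ z, Y z i ∂P) ∂P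
      = ∫ x, Y x ⬝ᵥ G *ᵥ Y x ∂P
        - (fun i => ∫ z, Y z i ∂P) ⬝ᵥ G *ᵥ (fun i => ∫ z, Y z i ∂P) := by
  set m : ι → ℝ := fun i => ∫ z, Y z i ∂P with hm
  have e : ∀ x, (Y x - m) ⬝ᵥ G *ᵥ (Y x - m)
      = Y x ⬝ᵥ G *ᵥ Y x - (G *ᵥ m) ⬝ᵥ Y x - (Gᵀ *ᵥ m) ⬝ᵥ Y x + m ⬝ᵥ G *ᵥ m := fun x => by
    simp only [mulVec_sub, dotProduct_sub, sub_dotProduct, mulVec_transpose,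
      ← dotProduct_mulVec, dotProduct_comm (G *ᵥ m)]
    ring
  simp_rw [e]
  rw [integral_add (AllMoments.integrable (by fun_prop)) (integrable_const _),
    integral_sub (AllMoments.integrable (by fun_prop)) (AllMoments.integrable (by fun_prop)),
    integral_sub (AllMoments.integrable (by fun_prop)) (AllMoments.integrable (by fun_prop)),
    integral_dotProduct_const hY, integral_dotProduct_const hY, ← hm]
  simp only [mulVec_transpose, ← dotProduct_mulVec, dotProduct_comm (G *ᵥ m) m]
  simp

/-- Testing with `c = m`, the mean, gives `|m|⁴ = (E m · Y)² ≤ p |m|²`. Hence the mean of an update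
has length of order one and is negligible beside the update itself. The second alternative is the
case `m = 0`, as `p` has no assumed sign. -/
theorem mean_dotProduct_self_le (hY : AllMoments Y P) {p : ℝ}
    (hp : ∀ c, ∫ x, (c ⬝ᵥ Y x) ^ 2 ∂P ≤ p * (c ⬝ᵥ c)) :
    (fun i => ∫ z, Y z i ∂P) ⬝ᵥ (fun i => ∫ z, Y z i ∂P) ≤ p ∨
      (fun i => ∫ z, Y z i ∂P) ⬝ᵥ (fun i => ∫ z, Y z i ∂P) = 0 := by
  set m : ι → ℝ := fun i => ∫ z, Y z i ∂P with hm
  rcases (dotProduct_self_nonneg' m).eq_or_lt with h0 | h0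
  · exact Or.inr h0.symm
  · left
    have h1 := (sq_integral_le (μ := P) (f := fun x => m ⬝ᵥ Y x) (by fun_prop)).trans (hp m)
    rw [integral_dotProduct_const hY, ← hm] at h1
    refine le_of_mul_le_mul_right ?_ h0
    nlinarith

theorem integral_sq_sub_mean_dotProduct_self_le (hY : AllMoments Y P) :
    ∫ x, ((Y x - fun i => ∫ z, Y z i ∂P) ⬝ᵥ (Y x - fun i => ∫ z, Y z i ∂P)) ^ 2 ∂P
      ≤ 16 * ∫ x, (Y x ⬝ᵥ Y x) ^ 2 ∂P := by
  classical
  -- With `G = 1` this yields `|m|² ≤ E |Y|²`, hence `|m|⁴ ≤ E |Y|⁴`; the 16 is then `8 + 8`.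
  have h := integral_sub_mean_quadForm hY 1
  simp only [one_mulVec] at h
  set m : ι → ℝ := fun i => ∫ z, Y z i ∂P with hm
  have h0 : 0 ≤ ∫ x, (Y x - m) ⬝ᵥ (Y x - m) ∂P :=
    integral_nonneg fun x => dotProduct_self_nonneg' _
  have hm0 := dotProduct_self_nonneg' m
  have h1 : (m ⬝ᵥ m) ^ 2 ≤ ∫ x, (Y x ⬝ᵥ Y x) ^ 2 ∂P := by
    refine le_trans ?_ (sq_integral_le (μ := P) (f := fun x => Y x ⬝ᵥ Y x) (by fun_prop))
    exact pow_le_pow_left₀ hm0 (by linarith) 2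
  calc _ ≤ ∫ x, (8 * (Y x ⬝ᵥ Y x) ^ 2 + 8 * (m ⬝ᵥ m) ^ 2) ∂P := by
        refine integral_mono (AllMoments.integrable (by fun_prop))
          (AllMoments.integrable (by fun_prop)) fun x => ?_
        have a1 : (Y x - m) ⬝ᵥ (Y x - m) ≤ 2 * (Y x ⬝ᵥ Y x) + 2 * (m ⬝ᵥ m) := by
          have := dotProduct_self_nonneg' (Y x + m)
          simp only [add_dotProduct, dotProduct_add, sub_dotProduct, dotProduct_sub] at this ⊢
          linarith
        have a2 := pow_le_pow_left₀ (dotProduct_self_nonneg' _) a1 2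
        refine a2.trans ?_
        nlinarith [sq_nonneg (Y x ⬝ᵥ Y x - m ⬝ᵥ m)]
    _ = 8 * ∫ x, (Y x ⬝ᵥ Y x) ^ 2 ∂P + 8 * (m ⬝ᵥ m) ^ 2 := by
        rw [integral_add (AllMoments.integrable (by fun_prop)) (integrable_const _),
          integral_const_mul]
        simp
    _ ≤ _ := by linarith

end Centering

variable {N T B : ℕ} {P : Measure (Fin (T + 1) → Fin N → ℝ)} [IsGaussian P] {γ C : ℝ}
  {wR w : Fin N → ℝ} {Ω : Type*} {mΩ : MeasurableSpace Ω} {Pr : Measure Ω}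
  [IsProbabilityMeasure Pr] {ψ : Fin B → Ω → Fin (T + 1) → Fin N → ℝ}

theorem continuous_tdGrad (γ : ℝ) (wR w : Fin N → ℝ) :
    Continuous (fun x : Fin (T + 1) → Fin N → ℝ => tdGrad γ wR w x) := by
  simp only [tdGrad, tdError, readout, dotProduct]
  fun_prop

theorem allMoments_batchNoise (hlaw : ∀ μ, HasLaw (ψ μ) P Pr) (h : ℝ) :
    AllMoments (fun ω => batchNoise P γ h wR w fun μ => ψ μ ω) Pr := by
  have h1 : ∀ μ, AllMoments (fun ω => tdGrad γ wR w (ψ μ ω)) Pr := fun μ =>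
    (allMoments_tdGrad P γ wR w).comp_hasLaw (hlaw μ)
  unfold batchNoise
  fun_prop

theorem integral_sq_dotProduct_batchNoise_le (hT : 0 < T) (hlaw : ∀ μ, HasLaw (ψ μ) P Pr)
    (hind : iIndepFun ψ Pr)
    (hC : ∀ (t : Fin (T + 1)) (v : Fin N → ℝ), ∫ x, (v ⬝ᵥ x t) ^ 2 ∂P ≤ C * (v ⬝ᵥ v))
    (h : ℝ) (c : Fin N → ℝ) :
    ∫ ω, (c ⬝ᵥ batchNoise P γ h wR w fun μ => ψ μ ω) ^ 2 ∂Pr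
      ≤ h ^ 2 * gaussianConst * C * (N / B) * tdPower P γ wR w * (c ⬝ᵥ c) := by
  have hY := allMoments_tdGrad P γ wR w
  have hZ : AllMoments (fun x => tdGrad γ wR w x - meanGrad P γ wR w) P := by fun_prop
  have hmeas : Measurable fun x : Fin (T + 1) → Fin N → ℝ =>
      tdGrad γ wR w x - meanGrad P γ wR w :=
    ((continuous_tdGrad γ wR w).sub continuous_const).measurable
  have key := integral_sq_dotProduct_sum_le
    (Z := fun μ ω => tdGrad γ wR w (ψ μ ω) - meanGrad P γ wR w)
    (hind.comp _ fun _ => hmeas) (fun μ => hZ.comp_hasLaw (hlaw μ))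
    (fun μ c => by
      rw [integral_comp_of_hasLaw (hlaw μ)
        (f := fun x => c ⬝ᵥ (tdGrad γ wR w x - meanGrad P γ wR w)) (by fun_prop)]
      exact integral_dotProduct_sub_mean hY c)
    (fun μ c => by
      rw [integral_comp_of_hasLaw (hlaw μ)
        (f := fun x => (c ⬝ᵥ (tdGrad γ wR w x - meanGrad P γ wR w)) ^ 2) (by fun_prop)]
      exact (integral_sq_dotProduct_sub_mean_le hY c).trans
        (integral_sq_dotProduct_tdGrad_le hC c)) Finset.univ c
  simp only [batchNoise, dotProduct_smul, smul_eq_mul, mul_pow]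
  rw [integral_const_mul]
  simp only [Finset.card_univ, Fintype.card_fin] at key
  refine (mul_le_mul_of_nonneg_left key (sq_nonneg _)).trans (le_of_eq ?_)
  have hT' : (T : ℝ) ≠ 0 := by positivity
  have hs : √(N : ℝ) ^ 2 = N := Real.sq_sqrt (by positivity)
  rw [div_pow, mul_pow, hs]
  -- For an empty batch both sides vanish, as division by zero is zero.
  rcases Nat.eq_zero_or_pos B with rfl | hB
  · simp
  · have hB' : (B : ℝ) ≠ 0 := by positivity
    field_simp

/-- Two errors add up: the fluctuation of the form of the sum of `B` centered updates, and `B` times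
the error of factorizing the mean for a single episode. After the prefactor `h² / (B² T²)` they form
`noiseRate`. The bound is linear in `tdPower`, so that it can later be averaged over random weights.
-/
theorem integral_abs_batchNoise_quadForm_sub_le (hT : 0 < T) (hN : 0 < N) (hB : 0 < B)
    (hlaw : ∀ μ, HasLaw (ψ μ) P Pr) (hind : iIndepFun ψ Pr) (hC0 : 0 ≤ C)
    (hC : ∀ (t : Fin (T + 1)) (v : Fin N → ℝ), ∫ x, (v ⬝ᵥ x t) ^ 2 ∂P ≤ C * (v ⬝ᵥ v))
    (h : ℝ) (G : Matrix (Fin N) (Fin N) ℝ) :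
    ∫ ω, |1 / (N : ℝ) * ((batchNoise P γ h wR w fun μ => ψ μ ω) ⬝ᵥ
          G *ᵥ (batchNoise P γ h wR w fun μ => ψ μ ω))
        - h ^ 2 / T ^ 2 * (N / B) * ∑ t : Fin T, ∑ t' : Fin T,
          tdCorr P γ wR w t t' * (1 / (N : ℝ) * (G * corr P t.castSucc t'.castSucc).trace)| ∂Pr
      ≤ h ^ 2 * gaussianConst * C * ‖G‖ * noiseRate N B * tdPower P γ wR w := by
  have hk := one_le_gaussianConst
  have hq : 0 ≤ tdPower P γ wR w := tdPower_nonneg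
  have hY := allMoments_tdGrad P γ wR w
  have hZ : AllMoments (fun x => tdGrad γ wR w x - meanGrad P γ wR w) P := by fun_prop
  have hmeas : Measurable fun x : Fin (T + 1) → Fin N → ℝ =>
      tdGrad γ wR w x - meanGrad P γ wR w :=
    ((continuous_tdGrad γ wR w).sub continuous_const).measurable
  set p : ℝ := T ^ 2 * gaussianConst * tdPower P γ wR w * C with hp
  have hp0 : 0 ≤ p := by positivity
  set g : ℝ := ∫ x, (tdGrad γ wR w x - meanGrad P γ wR w) ⬝ᵥ
    G *ᵥ (tdGrad γ wR w x - meanGrad P γ wR w) ∂P with hg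
  -- Centering costs a factor 16; `κ ≤ κ²` then makes the bound the square of `4 p N`.
  have hr : ∫ x, ((tdGrad γ wR w x - meanGrad P γ wR w) ⬝ᵥ
      (tdGrad γ wR w x - meanGrad P γ wR w)) ^ 2 ∂P ≤ (4 * p * N) ^ 2 := by
    refine (integral_sq_sub_mean_dotProduct_self_le hY).trans ?_
    have := integral_sq_tdGrad_dotProduct_self_le (γ := γ) (wR := wR) (w := w) hC
    calc _ ≤ 16 * (T ^ 4 * gaussianConst * (tdPower P γ wR w * C * N) ^ 2) := by gcongr
      _ ≤ 16 * (T ^ 4 * gaussianConst ^ 2 * (tdPower P γ wR w * C * N) ^ 2) := by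
          gcongr; nlinarith
      _ = _ := by rw [hp]; ring
  set S : Ω → Fin N → ℝ := fun ω => ∑ μ, (tdGrad γ wR w (ψ μ ω) - meanGrad P γ wR w) with hS
  have hSm : AllMoments S Pr := AllMoments.sum fun μ => hZ.comp_hasLaw (hlaw μ)
  have key : ∫ ω, (S ω ⬝ᵥ G *ᵥ S ω - B * g) ^ 2 ∂Pr
      ≤ ‖G‖ ^ 2 * (8 * p * (4 * p * N) * B ^ 2 + 2 * (4 * p * N) ^ 2 * B) := by
    have := integral_sq_quadForm_sum_le
      (Z := fun μ ω => tdGrad γ wR w (ψ μ ω) - meanGrad P γ wR w)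
      (hind.comp _ fun _ => hmeas) (fun μ => hZ.comp_hasLaw (hlaw μ))
      (fun μ c => by
        rw [integral_comp_of_hasLaw (hlaw μ)
          (f := fun x => c ⬝ᵥ (tdGrad γ wR w x - meanGrad P γ wR w)) (by fun_prop)]
        exact integral_dotProduct_sub_mean hY c) hp0 (by positivity : 0 ≤ 4 * p * N)
      (fun μ c => by
        rw [integral_comp_of_hasLaw (hlaw μ)
          (f := fun x => (c ⬝ᵥ (tdGrad γ wR w x - meanGrad P γ wR w)) ^ 2) (by fun_prop)]
        exact (integral_sq_dotProduct_sub_mean_le hY c).trans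
          (integral_sq_dotProduct_tdGrad_le hC c))
      (fun μ => by
        rw [integral_comp_of_hasLaw (hlaw μ)
          (f := fun x => ((tdGrad γ wR w x - meanGrad P γ wR w) ⬝ᵥ
            (tdGrad γ wR w x - meanGrad P γ wR w)) ^ 2) (by fun_prop)]
        exact hr) G (g := g)
      (fun μ => by
        rw [integral_comp_of_hasLaw (hlaw μ)
          (f := fun x => (tdGrad γ wR w x - meanGrad P γ wR w) ⬝ᵥ
            G *ᵥ (tdGrad γ wR w x - meanGrad P γ wR w)) (by fun_prop)]) Finset.univ
    simpa only [Finset.card_univ, Fintype.card_fin] using this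
  have key1 : ∫ ω, |S ω ⬝ᵥ G *ᵥ S ω - B * g| ∂Pr
      ≤ ‖G‖ * p * √(32 * (N * B ^ 2 + N ^ 2 * B)) := by
    refine (integral_abs_le_sqrt (f := fun ω => S ω ⬝ᵥ G *ᵥ S ω - B * g) (by fun_prop)
      key).trans (le_of_eq ?_)
    have e : ‖G‖ ^ 2 * (8 * p * (4 * p * N) * B ^ 2 + 2 * (4 * p * N) ^ 2 * B)
        = (‖G‖ * p) ^ 2 * (32 * ((N : ℝ) * B ^ 2 + N ^ 2 * B)) := by ring
    rw [e, Real.sqrt_mul (sq_nonneg _), Real.sqrt_sq (by positivity)]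
  set g' : ℝ := ∑ t : Fin T, ∑ t' : Fin T,
    tdCorr P γ wR w t t' * (G * corr P t.castSucc t'.castSucc).trace with hg'
  -- The term `3 √N` is the factorization error, and the `1` comes from subtracting the mean update.
  have hmean : |g - g'| ≤ ‖G‖ * p * (3 * √(N : ℝ) + 1) := by
    have e : g = ∫ x, tdGrad γ wR w x ⬝ᵥ G *ᵥ tdGrad γ wR w x ∂P
        - meanGrad P γ wR w ⬝ᵥ G *ᵥ meanGrad P γ wR w :=
      integral_sub_mean_quadForm hY G
    have a1 := abs_integral_tdGrad_quadForm_sub_le (γ := γ) (wR := wR) (w := w) hC0 hC G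
    rw [← hg'] at a1
    have a2 : |meanGrad P γ wR w ⬝ᵥ G *ᵥ meanGrad P γ wR w| ≤ ‖G‖ * p := by
      refine (abs_dotProduct_mulVec_self_le G _).trans ?_
      gcongr
      rcases mean_dotProduct_self_le hY (fun c => integral_sq_dotProduct_tdGrad_le hC c)
        with h0 | h0
      · exact h0
      · exact h0.le.trans hp0
    rw [e]
    calc _ = |(∫ x, tdGrad γ wR w x ⬝ᵥ G *ᵥ tdGrad γ wR w x ∂P - g')
          - meanGrad P γ wR w ⬝ᵥ G *ᵥ meanGrad P γ wR w| := by congr 1; ring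
      _ ≤ _ := abs_sub _ _
      _ ≤ _ := add_le_add a1 a2
      _ = _ := by rw [hp]; ring
  have hN' : (N : ℝ) ≠ 0 := by positivity
  have hB' : (B : ℝ) ≠ 0 := by positivity
  have hT' : (T : ℝ) ≠ 0 := by positivity
  set k : ℝ := h ^ 2 / (B ^ 2 * T ^ 2) with hkdef
  have hk0 : 0 ≤ k := by positivity
  have e : ∀ ω, 1 / (N : ℝ) * ((batchNoise P γ h wR w fun μ => ψ μ ω) ⬝ᵥ
        G *ᵥ (batchNoise P γ h wR w fun μ => ψ μ ω))
      - h ^ 2 / T ^ 2 * (N / B) * ∑ t : Fin T, ∑ t' : Fin T,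
        tdCorr P γ wR w t t' * (1 / (N : ℝ) * (G * corr P t.castSucc t'.castSucc).trace)
      = k * ((S ω ⬝ᵥ G *ᵥ S ω - B * g) + B * (g - g')) := by
    intro ω
    have e1 : ∑ t : Fin T, ∑ t' : Fin T,
        tdCorr P γ wR w t t' * (1 / (N : ℝ) * (G * corr P t.castSucc t'.castSucc).trace)
        = 1 / (N : ℝ) * g' := by
      rw [hg', Finset.mul_sum]
      refine Finset.sum_congr rfl fun t _ => ?_
      rw [Finset.mul_sum]
      refine Finset.sum_congr rfl fun t' _ => ?_
      ring
    have hs : √(N : ℝ) * √(N : ℝ) = N := Real.mul_self_sqrt (by positivity)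
    have e2 : (batchNoise P γ h wR w fun μ => ψ μ ω)
        = (h * √(N : ℝ) / ((B : ℝ) * (T : ℝ))) • S ω := rfl
    have e3 : (h * √(N : ℝ) / ((B : ℝ) * (T : ℝ))) * (h * √(N : ℝ) / ((B : ℝ) * (T : ℝ)))
        = k * N := by
      rw [hkdef, div_mul_div_comm, div_mul_eq_mul_div]
      congr 1
      · calc _ = h ^ 2 * (√(N : ℝ) * √(N : ℝ)) := by ring
          _ = _ := by rw [hs]
      · ring
    rw [e1, e2]
    simp only [mulVec_smul, smul_dotProduct, dotProduct_smul, smul_eq_mul]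
    rw [← mul_assoc (h * √(N : ℝ) / ((B : ℝ) * (T : ℝ))), e3, hkdef]
    field_simp
    ring
  simp_rw [e, abs_mul, abs_of_nonneg hk0]
  rw [integral_const_mul]
  have hQ : AllMoments (fun ω => S ω ⬝ᵥ G *ᵥ S ω - B * g) Pr := by fun_prop
  calc k * ∫ ω, |S ω ⬝ᵥ G *ᵥ S ω - B * g + B * (g - g')| ∂Pr
      ≤ k * ∫ ω, (|S ω ⬝ᵥ G *ᵥ S ω - B * g| + |B * (g - g')|) ∂Pr := by
        refine mul_le_mul_of_nonneg_left (integral_mono ?_ ?_ fun ω => abs_add_le _ _) hk0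
        · exact (hQ.add (AllMoments.const _)).abs.integrable
        · exact (hQ.abs.add (AllMoments.const _)).integrable
    _ = k * (∫ ω, |S ω ⬝ᵥ G *ᵥ S ω - B * g| ∂Pr + B * |g - g'|) := by
        rw [integral_add hQ.abs.integrable (integrable_const _)]
        simp [abs_mul]
    _ ≤ k * (‖G‖ * p * √(32 * (N * B ^ 2 + N ^ 2 * B))
          + B * (‖G‖ * p * (3 * √(N : ℝ) + 1))) := by gcongr
    _ = _ := by
        rw [hkdef, hp, noiseRate]
        field_simp

theorem integral_abs_batch_tdCorr_sub_le (hB : 0 < B) (hlaw : ∀ μ, HasLaw (ψ μ) P Pr)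
    (hind : iIndepFun ψ Pr) (t t' : Fin T) :
    ∫ ω, |1 / (B : ℝ) * ∑ μ, tdError γ wR w (ψ μ ω) t * tdError γ wR w (ψ μ ω) t'
        - tdCorr P γ wR w t t'| ∂Pr
      ≤ gaussianConst / √(B : ℝ) * tdPower P γ wR w := by
  have hk := one_le_gaussianConst
  have hq : 0 ≤ tdPower P γ wR w := tdPower_nonneg
  have h1 := allMoments_tdError P γ wR w t
  have h2 := allMoments_tdError P γ wR w t'
  set c := tdCorr P γ wR w t t' with hc
  have hX : AllMoments (fun x => tdError γ wR w x t * tdError γ wR w x t' - c) P :=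
    (h1.mul h2).sub (AllMoments.const c)
  have hmeas : Measurable fun x : Fin (T + 1) → Fin N → ℝ =>
      tdError γ wR w x t * tdError γ wR w x t' - c := by
    apply Continuous.measurable
    simp only [tdError, readout, dotProduct]
    fun_prop
  have h0 : ∫ x, (tdError γ wR w x t * tdError γ wR w x t' - c) ∂P = 0 := by
    rw [integral_sub (h1.mul h2).integrable (integrable_const _)]
    simp [hc, tdCorr]
  have hv : ∫ x, (tdError γ wR w x t * tdError γ wR w x t' - c) ^ 2 ∂P
      ≤ gaussianConst * (tdPower P γ wR w * tdPower P γ wR w) := by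
    refine le_trans ?_ (integral_sq_mul_le (hasGaussianLaw_tdError P γ wR w t)
      (hasGaussianLaw_tdError P γ wR w t') (integral_sq_tdError_le t) (integral_sq_tdError_le t'))
    have e : ∀ x, (tdError γ wR w x t * tdError γ wR w x t' - c) ^ 2
        = (tdError γ wR w x t * tdError γ wR w x t') ^ 2
          - 2 * c * (tdError γ wR w x t * tdError γ wR w x t') + c ^ 2 := fun x => by ring
    simp_rw [e]
    rw [integral_add (AllMoments.integrable (by fun_prop)) (integrable_const _),
      integral_sub (AllMoments.integrable (by fun_prop)) (AllMoments.integrable (by fun_prop)),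
      integral_const_mul]
    have : ∫ x, tdError γ wR w x t * tdError γ wR w x t' ∂P = c := rfl
    rw [this]
    simp
    nlinarith [sq_nonneg c]
  have hXc : ∀ μ, AllMoments (fun ω => tdError γ wR w (ψ μ ω) t * tdError γ wR w (ψ μ ω) t' - c)
      Pr := fun μ => hX.comp_hasLaw (hlaw μ)
  have key := integral_sq_sum_of_iIndepFun
    (x := fun μ ω => tdError γ wR w (ψ μ ω) t * tdError γ wR w (ψ μ ω) t' - c)
    (hind.comp _ fun _ => hmeas) hXc
    (fun μ => by rw [integral_comp_of_hasLaw (hlaw μ) hX, h0]) Finset.univ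
  have key2 : ∫ ω, (∑ μ, (tdError γ wR w (ψ μ ω) t * tdError γ wR w (ψ μ ω) t' - c)) ^ 2 ∂Pr
      ≤ B * (gaussianConst * (tdPower P γ wR w * tdPower P γ wR w)) := by
    rw [key]
    calc _ ≤ ∑ _μ : Fin B, gaussianConst * (tdPower P γ wR w * tdPower P γ wR w) :=
          Finset.sum_le_sum fun μ _ => by
            rw [integral_comp_of_hasLaw (hlaw μ)
              (f := fun x => (tdError γ wR w x t * tdError γ wR w x t' - c) ^ 2) (hX.pow 2)]
            exact hv
      _ = _ := by simp
  have hB' : (0 : ℝ) < B := by positivity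
  have e : ∀ ω, 1 / (B : ℝ) * ∑ μ, tdError γ wR w (ψ μ ω) t * tdError γ wR w (ψ μ ω) t' - c
      = 1 / (B : ℝ) * ∑ μ, (tdError γ wR w (ψ μ ω) t * tdError γ wR w (ψ μ ω) t' - c) := by
    intro ω
    rw [Finset.sum_sub_distrib]
    simp
    field_simp
  simp_rw [e, abs_mul]
  rw [integral_const_mul, abs_of_nonneg (by positivity)]
  have := integral_abs_le_sqrt (AllMoments.sum (s := Finset.univ) hXc) key2
  calc _ ≤ 1 / (B : ℝ) * √(B * (gaussianConst * (tdPower P γ wR w * tdPower P γ wR w))) := by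
        gcongr
    -- Again `κ ≤ κ²`, to have a perfect square under the root.
    _ ≤ 1 / (B : ℝ) * √(B * (gaussianConst * tdPower P γ wR w) ^ 2) := by
        gcongr
        nlinarith [mul_nonneg hq hq]
    _ = _ := by
        rw [Real.sqrt_mul hB'.le, Real.sqrt_sq (by positivity)]
        have : √(B : ℝ) * √(B : ℝ) = B := Real.mul_self_sqrt hB'.le
        field_simp
        rw [sq, this]

end Batch

/-! ### The TD-error correlation as a quadratic function of the weights -/

section Correlation

open scoped Matrix.Norms.L2Operator

variable {N T : ℕ} {P : Measure (Fin (T + 1) → Fin N → ℝ)} {γ C : ℝ}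

/-- The matrix of the quadratic part of the TD-error correlation. -/
def tdForm {N T : ℕ} (γ : ℝ) (S : Fin (T + 1) → Fin (T + 1) → Matrix (Fin N) (Fin N) ℝ)
    (t t' : Fin T) : Matrix (Fin N) (Fin N) ℝ :=
  S t.castSucc t'.castSucc - γ • S t.castSucc t'.succ - γ • S t.succ t'.castSucc
    + γ ^ 2 • S t.succ t'.succ

/-- The correlation of a TD error with the temporal difference of the features. -/
def tdCross {N T : ℕ} (P : Measure (Fin (T + 1) → Fin N → ℝ)) (γ : ℝ) (wR w : Fin N → ℝ)
    (t t' : Fin T) : Fin N → ℝ :=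
  fun i => ∫ x, (tdError γ wR w x t • (γ • x t'.succ - x t'.castSucc)) i ∂P

theorem tdError_add (wR m z : Fin N → ℝ) (x : Fin (T + 1) → Fin N → ℝ) (t : Fin T) :
    tdError γ wR (m + z) x t
      = tdError γ wR m x t + (z ⬝ᵥ (γ • x t.succ - x t.castSucc)) / √(N : ℝ) := by
  simp only [tdError_eq, sub_dotProduct, add_dotProduct, dotProduct_sub, dotProduct_smul,
    smul_eq_mul]
  ring

theorem corr_transpose (t t' : Fin (T + 1)) : (corr P t t')ᵀ = corr P t' t := by
  ext i j
  simp [corr, mul_comm]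

variable [IsGaussian P]

theorem allMoments_diff (P : Measure (Fin (T + 1) → Fin N → ℝ)) [IsGaussian P] (γ : ℝ)
    (t : Fin T) :
    AllMoments (fun x : Fin (T + 1) → Fin N → ℝ => γ • x t.succ - x t.castSucc) P :=
  ((AllMoments.const γ).smul (allMoments_episode P t.succ)).sub (allMoments_episode P t.castSucc)

theorem integral_sq_dotProduct_diff_le
    (hC : ∀ (t : Fin (T + 1)) (v : Fin N → ℝ), ∫ x, (v ⬝ᵥ x t) ^ 2 ∂P ≤ C * (v ⬝ᵥ v))
    (t : Fin T) (v : Fin N → ℝ) :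
    ∫ x, (v ⬝ᵥ (γ • x t.succ - x t.castSucc)) ^ 2 ∂P ≤ (2 * γ ^ 2 + 2) * C * (v ⬝ᵥ v) := by
  have h : ∀ t, AllMoments (fun x : Fin (T + 1) → Fin N → ℝ => v ⬝ᵥ x t) P := fun t =>
    (AllMoments.const v).dotProduct (allMoments_episode P t)
  calc _ ≤ ∫ x, (2 * γ ^ 2 * (v ⬝ᵥ x t.succ) ^ 2 + 2 * (v ⬝ᵥ x t.castSucc) ^ 2) ∂P := by
        refine integral_mono
          (((AllMoments.const v).dotProduct (allMoments_diff P γ t)).pow 2).integrable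
          (((AllMoments.const _).mul ((h t.succ).pow 2)).add
            ((AllMoments.const _).mul ((h t.castSucc).pow 2))).integrable fun x => ?_
        simp only [dotProduct_sub, dotProduct_smul, smul_eq_mul]
        nlinarith [sq_nonneg (γ * (v ⬝ᵥ x t.succ) + v ⬝ᵥ x t.castSucc)]
    _ = 2 * γ ^ 2 * ∫ x, (v ⬝ᵥ x t.succ) ^ 2 ∂P + 2 * ∫ x, (v ⬝ᵥ x t.castSucc) ^ 2 ∂P := by
        rw [integral_add (((AllMoments.const _).mul ((h t.succ).pow 2))).integrable
          (((AllMoments.const _).mul ((h t.castSucc).pow 2))).integrable, integral_const_mul,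
          integral_const_mul]
    _ ≤ 2 * γ ^ 2 * (C * (v ⬝ᵥ v)) + 2 * (C * (v ⬝ᵥ v)) := by
        gcongr
        · exact hC _ _
        · exact hC _ _
    _ = _ := by ring

/-- By duality, `|c|²` is the correlation of a TD error with the scalar `c · (γψ(t'+1) - ψ(t'))`,
and Cauchy–Schwarz bounds it by a multiple of `|c|`. The length is thus bounded independently of the
number of coordinates. -/
theorem tdCross_dotProduct_self_le (hC0 : 0 ≤ C)
    (hC : ∀ (t : Fin (T + 1)) (v : Fin N → ℝ), ∫ x, (v ⬝ᵥ x t) ^ 2 ∂P ≤ C * (v ⬝ᵥ v))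
    (wR m : Fin N → ℝ) (t t' : Fin T) :
    tdCross P γ wR m t t' ⬝ᵥ tdCross P γ wR m t t'
      ≤ (2 * γ ^ 2 + 2) * C * tdPower P γ wR m := by
  have h1 := allMoments_tdError P γ wR m t
  have h2 := allMoments_diff P γ t'
  have hq : 0 ≤ tdPower P γ wR m := tdPower_nonneg
  set c := tdCross P γ wR m t t' with hc
  have e : c ⬝ᵥ c = ∫ x, tdError γ wR m x t * (c ⬝ᵥ (γ • x t'.succ - x t'.castSucc)) ∂P := by
    have := integral_dotProduct_const (h1.smul h2) c
    simp only [dotProduct_smul, smul_eq_mul] at this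
    exact this.symm
  rcases (dotProduct_self_nonneg' c).eq_or_lt with h0 | h0
  · rw [← h0]; positivity
  · refine le_of_mul_le_mul_right ?_ h0
    have := sq_integral_mul_le h1 ((AllMoments.const c).dotProduct h2)
    rw [← e] at this
    have a1 := integral_sq_tdError_le (P := P) (γ := γ) (wR := wR) (w := m) t
    have a2 := integral_sq_dotProduct_diff_le (γ := γ) hC t' c
    simp only [sq] at a1 a2
    calc (c ⬝ᵥ c) * (c ⬝ᵥ c) = (c ⬝ᵥ c) ^ 2 := by ring
      _ ≤ _ := this
      _ ≤ tdPower P γ wR m * ((2 * (γ * γ) + 2) * C * (c ⬝ᵥ c)) :=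
          mul_le_mul a1 a2 (integral_nonneg fun x => mul_self_nonneg _) hq
      _ = _ := by ring

theorem dotProduct_tdForm_mulVec (P : Measure (Fin (T + 1) → Fin N → ℝ)) [IsGaussian P] (γ : ℝ)
    (t t' : Fin T) (u v : Fin N → ℝ) :
    u ⬝ᵥ tdForm γ (corr P) t t' *ᵥ v = ∫ x, (u ⬝ᵥ (γ • x t.succ - x t.castSucc))
      * (v ⬝ᵥ (γ • x t'.succ - x t'.castSucc)) ∂P := by
  have h : ∀ t t' : Fin (T + 1), AllMoments
      (fun x : Fin (T + 1) → Fin N → ℝ => (u ⬝ᵥ x t) * (v ⬝ᵥ x t')) P := fun t t' =>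
    ((AllMoments.const u).dotProduct (allMoments_episode P t)).mul
      ((AllMoments.const v).dotProduct (allMoments_episode P t'))
  have e : ∀ x : Fin (T + 1) → Fin N → ℝ, (u ⬝ᵥ (γ • x t.succ - x t.castSucc))
      * (v ⬝ᵥ (γ • x t'.succ - x t'.castSucc))
      = (u ⬝ᵥ x t.castSucc) * (v ⬝ᵥ x t'.castSucc)
        - γ * ((u ⬝ᵥ x t.castSucc) * (v ⬝ᵥ x t'.succ))
        - γ * ((u ⬝ᵥ x t.succ) * (v ⬝ᵥ x t'.castSucc))
        + γ ^ 2 * ((u ⬝ᵥ x t.succ) * (v ⬝ᵥ x t'.succ)) := fun x => by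
    simp only [dotProduct_sub, dotProduct_smul, smul_eq_mul]; ring
  have hs : ∀ (c : ℝ) (t t' : Fin (T + 1)), AllMoments
      (fun x : Fin (T + 1) → Fin N → ℝ => c * ((u ⬝ᵥ x t) * (v ⬝ᵥ x t'))) P := fun c t t' =>
    (AllMoments.const c).mul (h t t')
  simp_rw [e]
  rw [integral_add (((h _ _).sub (hs γ _ _)).sub (hs γ _ _)).integrable (hs _ _ _).integrable,
    integral_sub ((h _ _).sub (hs γ _ _)).integrable (hs _ _ _).integrable,
    integral_sub (h _ _).integrable (hs _ _ _).integrable, integral_const_mul, integral_const_mul,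
    integral_const_mul]
  simp only [tdForm, add_mulVec, sub_mulVec, smul_mulVec, dotProduct_add, dotProduct_sub,
    dotProduct_smul, smul_eq_mul, dotProduct_corr_mulVec]

/-- The TD error is affine in the weights, so this second-order expansion about `m` is exact. With
the factor `√N`, the coefficient of the linear term has squared length `O(N)`, the size at which
normalized linear forms of the deviation still vanish. -/
theorem tdCorr_add (P : Measure (Fin (T + 1) → Fin N → ℝ)) [IsGaussian P] (γ : ℝ)
    (wR m z : Fin N → ℝ) (t t' : Fin T) :
    tdCorr P γ wR (m + z) t t' = tdCorr P γ wR m t t'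
      + 1 / (N : ℝ) * (√(N : ℝ) • (tdCross P γ wR m t t' + tdCross P γ wR m t' t) ⬝ᵥ z)
      + 1 / (N : ℝ) * (z ⬝ᵥ tdForm γ (corr P) t t' *ᵥ z) := by
  have h1 := fun t => allMoments_tdError P γ wR m t
  have h2 := fun t => allMoments_diff P γ t
  have h3 := fun t => (AllMoments.const z).dotProduct (h2 t)
  have e : ∀ x, tdError γ wR (m + z) x t * tdError γ wR (m + z) x t'
      = tdError γ wR m x t * tdError γ wR m x t'
        + (√(N : ℝ))⁻¹ * (z ⬝ᵥ (tdError γ wR m x t • (γ • x t'.succ - x t'.castSucc)))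
        + (√(N : ℝ))⁻¹ * (z ⬝ᵥ (tdError γ wR m x t' • (γ • x t.succ - x t.castSucc)))
        + 1 / (N : ℝ) * ((z ⬝ᵥ (γ • x t.succ - x t.castSucc))
          * (z ⬝ᵥ (γ • x t'.succ - x t'.castSucc))) := fun x => by
    have hs : 1 / (N : ℝ) = (√(N : ℝ))⁻¹ * (√(N : ℝ))⁻¹ := by
      rw [← mul_inv, Real.mul_self_sqrt (by positivity), one_div]
    rw [tdError_add, tdError_add, hs]
    simp only [dotProduct_smul, smul_eq_mul]
    ring
  have i1 : AllMoments (fun x => (√(N : ℝ))⁻¹ *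
      (z ⬝ᵥ (tdError γ wR m x t • (γ • x t'.succ - x t'.castSucc)))) P :=
    (AllMoments.const _).mul ((AllMoments.const z).dotProduct ((h1 t).smul (h2 t')))
  have i2 : AllMoments (fun x => (√(N : ℝ))⁻¹ *
      (z ⬝ᵥ (tdError γ wR m x t' • (γ • x t.succ - x t.castSucc)))) P :=
    (AllMoments.const _).mul ((AllMoments.const z).dotProduct ((h1 t').smul (h2 t)))
  have i3 := ((h1 t).mul (h1 t'))
  have hcr : ∀ t t', ∫ x, z ⬝ᵥ (tdError γ wR m x t • (γ • x t'.succ - x t'.castSucc)) ∂P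
      = z ⬝ᵥ tdCross P γ wR m t t' := fun t t' =>
    integral_dotProduct_const ((h1 t).smul (h2 t')) z
  have hs : 1 / (N : ℝ) * √(N : ℝ) = (√(N : ℝ))⁻¹ := by
    rw [one_div, inv_mul_eq_div, Real.sqrt_div_self]
  rw [tdCorr]
  simp_rw [e]
  rw [integral_add ((i3.add i1).add i2).integrable
      ((AllMoments.const _).mul ((h3 t).mul (h3 t'))).integrable,
    integral_add (i3.add i1).integrable i2.integrable, integral_add i3.integrable i1.integrable,
    integral_const_mul, integral_const_mul, integral_const_mul,
    hcr t t', hcr t' t, ← dotProduct_tdForm_mulVec, smul_dotProduct, smul_eq_mul, ← mul_assoc, hs,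
    add_dotProduct, dotProduct_comm z, dotProduct_comm z]
  simp only [tdCorr]
  ring

theorem tdCorr_eq (P : Measure (Fin (T + 1) → Fin N → ℝ)) [IsGaussian P] (γ : ℝ)
    (wR w : Fin N → ℝ) (t t' : Fin T) :
    tdCorr P γ wR w t t' = 1 / (N : ℝ) *
      ((wR - w) ⬝ᵥ (corr P t.castSucc t'.castSucc *ᵥ (wR - w))
        + γ * ((wR - w) ⬝ᵥ (corr P t.castSucc t'.succ *ᵥ w))
        + γ * (w ⬝ᵥ (corr P t.succ t'.castSucc *ᵥ (wR - w)))
        + γ ^ 2 * (w ⬝ᵥ (corr P t.succ t'.succ *ᵥ w))) := by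
  have h : ∀ (c : ℝ) (u v : Fin N → ℝ) (t t' : Fin (T + 1)), AllMoments
      (fun x : Fin (T + 1) → Fin N → ℝ => c * ((u ⬝ᵥ x t) * (v ⬝ᵥ x t'))) P := fun c u v t t' =>
    (AllMoments.const c).mul (((AllMoments.const u).dotProduct (allMoments_episode P t)).mul
      ((AllMoments.const v).dotProduct (allMoments_episode P t')))
  have e : ∀ x, tdError γ wR w x t * tdError γ wR w x t' = 1 / (N : ℝ) *
      (1 * (((wR - w) ⬝ᵥ x t.castSucc) * ((wR - w) ⬝ᵥ x t'.castSucc))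
        + γ * (((wR - w) ⬝ᵥ x t.castSucc) * (w ⬝ᵥ x t'.succ))
        + γ * ((w ⬝ᵥ x t.succ) * ((wR - w) ⬝ᵥ x t'.castSucc))
        + γ ^ 2 * ((w ⬝ᵥ x t.succ) * (w ⬝ᵥ x t'.succ))) := fun x => by
    rw [tdError_eq, tdError_eq, div_mul_div_comm, Real.mul_self_sqrt (by positivity)]
    ring
  rw [tdCorr]
  simp_rw [e]
  rw [integral_const_mul, integral_add (((h _ _ _ _ _).add (h _ _ _ _ _)).add
    (h _ _ _ _ _)).integrable (h _ _ _ _ _).integrable,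
    integral_add ((h _ _ _ _ _).add (h _ _ _ _ _)).integrable (h _ _ _ _ _).integrable,
    integral_add (h _ _ _ _ _).integrable (h _ _ _ _ _).integrable]
  simp only [integral_const_mul, dotProduct_corr_mulVec, one_mul]

theorem tdPower_add_le
    (hC : ∀ (t : Fin (T + 1)) (v : Fin N → ℝ), ∫ x, (v ⬝ᵥ x t) ^ 2 ∂P ≤ C * (v ⬝ᵥ v))
    (wR m z : Fin N → ℝ) :
    tdPower P γ wR (m + z) ≤ 2 * tdPower P γ wR m
      + T * (2 * ((2 * γ ^ 2 + 2) * C)) * (1 / (N : ℝ) * (z ⬝ᵥ z)) := by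
  have key : ∀ t : Fin T, tdCorr P γ wR (m + z) t t ≤ 2 * tdCorr P γ wR m t t
      + 2 * ((2 * γ ^ 2 + 2) * C) * (1 / (N : ℝ) * (z ⬝ᵥ z)) := by
    intro t
    have h1 := allMoments_tdError P γ wR m t
    have h2 := (AllMoments.const z).dotProduct (allMoments_diff P γ t)
    calc tdCorr P γ wR (m + z) t t
        ≤ ∫ x, (2 * (tdError γ wR m x t * tdError γ wR m x t)
          + 2 * (1 / (N : ℝ)) * (z ⬝ᵥ (γ • x t.succ - x t.castSucc)) ^ 2) ∂P := by
          refine integral_mono ((allMoments_tdError P γ wR (m + z) t).mul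
            (allMoments_tdError P γ wR (m + z) t)).integrable
            (((AllMoments.const _).mul (h1.mul h1)).add
              ((AllMoments.const _).mul (h2.pow 2))).integrable fun x => ?_
          have hs : 1 / (N : ℝ) = (√(N : ℝ))⁻¹ * (√(N : ℝ))⁻¹ := by
            rw [← mul_inv, Real.mul_self_sqrt (by positivity), one_div]
          simp only [tdError_add, hs, div_eq_mul_inv]
          nlinarith [sq_nonneg (tdError γ wR m x t
            - (z ⬝ᵥ (γ • x t.succ - x t.castSucc)) * (√(N : ℝ))⁻¹)]
      _ = 2 * tdCorr P γ wR m t t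
          + 2 * (1 / (N : ℝ)) * ∫ x, (z ⬝ᵥ (γ • x t.succ - x t.castSucc)) ^ 2 ∂P := by
          rw [integral_add ((AllMoments.const _).mul (h1.mul h1)).integrable
            ((AllMoments.const _).mul (h2.pow 2)).integrable, integral_const_mul,
            integral_const_mul]
          rfl
      _ ≤ 2 * tdCorr P γ wR m t t
          + 2 * (1 / (N : ℝ)) * ((2 * γ ^ 2 + 2) * C * (z ⬝ᵥ z)) := by
          gcongr
          exact integral_sq_dotProduct_diff_le hC t z
      _ = _ := by ring
  calc _ ≤ ∑ t : Fin T, (2 * tdCorr P γ wR m t t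
      + 2 * ((2 * γ ^ 2 + 2) * C) * (1 / (N : ℝ) * (z ⬝ᵥ z))) :=
        Finset.sum_le_sum fun t _ => key t
    _ = _ := by
        rw [Finset.sum_add_distrib, ← Finset.mul_sum]
        simp [tdPower]
        ring

theorem norm_tdForm_le (hC0 : 0 ≤ C)
    (hC : ∀ (t : Fin (T + 1)) (v : Fin N → ℝ), ∫ x, (v ⬝ᵥ x t) ^ 2 ∂P ≤ C * (v ⬝ᵥ v))
    (t t' : Fin T) : ‖tdForm γ (corr P) t t'‖ ≤ (1 + |γ|) ^ 2 * C := by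
  have h := norm_corr_le hC0 hC
  calc _ ≤ ‖corr P t.castSucc t'.castSucc‖ + ‖γ • corr P t.castSucc t'.succ‖
        + ‖γ • corr P t.succ t'.castSucc‖ + ‖γ ^ 2 • corr P t.succ t'.succ‖ :=
        (norm_add_le _ _).trans (add_le_add_left ((norm_sub_le _ _).trans
          (add_le_add_left (norm_sub_le _ _) _)) _)
    _ ≤ C + |γ| * C + |γ| * C + |γ| ^ 2 * C := by
        simp only [norm_smul, norm_pow, Real.norm_eq_abs]
        gcongr <;> exact h _ _
    _ = _ := by ring

theorem allMoments_tdCorr {Ω : Type*} {mΩ : MeasurableSpace Ω} {Pr : Measure Ω}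
    [IsFiniteMeasure Pr] (P : Measure (Fin (T + 1) → Fin N → ℝ)) [IsGaussian P] (γ : ℝ)
    (wR : Fin N → ℝ) {w : Ω → Fin N → ℝ} (hw : AllMoments w Pr) (t t' : Fin T) :
    AllMoments (fun ω => tdCorr P γ wR (w ω) t t') Pr := by
  simp only [tdCorr_eq]
  fun_prop

theorem allMoments_tdPower {Ω : Type*} {mΩ : MeasurableSpace Ω} {Pr : Measure Ω}
    [IsFiniteMeasure Pr] (P : Measure (Fin (T + 1) → Fin N → ℝ)) [IsGaussian P] (γ : ℝ)
    (wR : Fin N → ℝ) {w : Ω → Fin N → ℝ} (hw : AllMoments w Pr) :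
    AllMoments (fun ω => tdPower P γ wR (w ω)) Pr :=
  AllMoments.sum fun t => allMoments_tdCorr P γ wR hw t t

theorem continuous_tdCorr (P : Measure (Fin (T + 1) → Fin N → ℝ)) [IsGaussian P] (γ : ℝ)
    (wR : Fin N → ℝ) (t t' : Fin T) :
    Continuous fun w => tdCorr P γ wR w t t' := by
  simp only [tdCorr_eq, dotProduct, mulVec]
  fun_prop

end Correlation

/-! ### The iterates -/

section Iterates

variable {N T B : ℕ} {γ : ℝ} {η : ℕ → ℝ} {wR w0 : Fin N → ℝ}

theorem iterate_succ_eq (ψ : ℕ → Fin B → Fin (T + 1) → Fin N → ℝ) (n : ℕ) :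
    iterate γ η wR w0 ψ (n + 1) = iterate γ η wR w0 ψ n +
      (η n * √(N : ℝ) / ((B : ℝ) * (T : ℝ))) •
        ∑ μ, tdGrad γ wR (iterate γ η wR w0 ψ n) (ψ n μ) := rfl

theorem iterate_congr {ψ ψ' : ℕ → Fin B → Fin (T + 1) → Fin N → ℝ} {n : ℕ}
    (h : ∀ m < n, ψ m = ψ' m) : iterate γ η wR w0 ψ n = iterate γ η wR w0 ψ' n := by
  induction n with
  | zero => rfl
  | succ n ih => rw [iterate_succ_eq, iterate_succ_eq, ih fun m hm => h m (by omega),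
      h n (by omega)]

theorem continuous_tdGrad_comp {X : Type*} [TopologicalSpace X]
    {f : X → Fin N → ℝ}
    {g : X → Fin (T + 1) → Fin N → ℝ} (hf : Continuous f) (hg : Continuous g) :
    Continuous fun x => tdGrad γ wR (f x) (g x) := by
  have hg' : ∀ t i, Continuous fun x => g x t i := fun t i =>
    (continuous_apply i).comp ((continuous_apply t).comp hg)
  have hf' : ∀ i, Continuous fun x => f x i := fun i => (continuous_apply i).comp hf
  refine continuous_pi fun i => ?_
  simp only [tdGrad, tdError, readout, dotProduct, Finset.sum_apply, Pi.smul_apply, smul_eq_mul]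
  fun_prop

theorem measurable_tdGrad_comp {X : Type*} [MeasurableSpace X]
    {f : X → Fin N → ℝ}
    {g : X → Fin (T + 1) → Fin N → ℝ} (hf : Measurable f) (hg : Measurable g) :
    Measurable fun x => tdGrad γ wR (f x) (g x) := by
  have hg' : ∀ t i, Measurable fun x => g x t i := fun t i =>
    (measurable_pi_apply i).comp ((measurable_pi_apply t).comp hg)
  have hf' : ∀ i, Measurable fun x => f x i := fun i => (measurable_pi_apply i).comp hf
  refine measurable_pi_iff.2 fun i => ?_
  simp only [tdGrad, tdError, readout, dotProduct, Finset.sum_apply, Pi.smul_apply, smul_eq_mul]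
  fun_prop

theorem measurable_iterate (n : ℕ) : Measurable
    fun ψ : ℕ → Fin B → Fin (T + 1) → Fin N → ℝ => iterate γ η wR w0 ψ n := by
  induction n with
  | zero => exact measurable_const
  | succ n ih =>
    simp only [iterate_succ_eq]
    have hs : Measurable fun ψ : ℕ → Fin B → Fin (T + 1) → Fin N → ℝ =>
        ∑ μ, tdGrad γ wR (iterate γ η wR w0 ψ n) (ψ n μ) := by
      refine Finset.measurable_fun_sum _ fun μ _ => ?_
      exact measurable_tdGrad_comp ih ((measurable_pi_apply μ).comp (measurable_pi_apply n))
    have hs' := hs.const_smul (η n * √(N : ℝ) / ((B : ℝ) * (T : ℝ)))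
    exact Measurable.add ih hs'

variable {P : Measure (Fin (T + 1) → Fin N → ℝ)} {Ω : Type*} {mΩ : MeasurableSpace Ω}
  {Pr : Measure Ω} {ψ : ℕ → Fin B → Ω → Fin (T + 1) → Fin N → ℝ}

theorem allMoments_tdError_comp [IsFiniteMeasure Pr] {w : Ω → Fin N → ℝ} (hw : AllMoments w Pr)
    {x : Ω → Fin (T + 1) → Fin N → ℝ} (hx : ∀ t, AllMoments (fun ω => x ω t) Pr) (t : Fin T) :
    AllMoments (fun ω => tdError γ wR (w ω) (x ω) t) Pr := by
  have h1 := hx t.castSucc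
  have h2 := hx t.succ
  simp only [tdError_eq]
  exact ((((AllMoments.const wR).sub hw).dotProduct h1).add
    ((AllMoments.const γ).mul (hw.dotProduct h2))).div_const _

theorem allMoments_episode_comp [IsGaussian P] (hlaw : ∀ n μ, HasLaw (ψ n μ) P Pr) (n : ℕ)
    (μ : Fin B) (t : Fin (T + 1)) : AllMoments (fun ω => ψ n μ ω t) Pr :=
  (allMoments_episode P t).comp_hasLaw (hlaw n μ)

theorem allMoments_iterate [IsGaussian P] [IsFiniteMeasure Pr]
    (hlaw : ∀ n μ, HasLaw (ψ n μ) P Pr) (n : ℕ) :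
    AllMoments (fun ω => iterate γ η wR w0 (fun m μ => ψ m μ ω) n) Pr := by
  induction n with
  | zero => exact AllMoments.const w0
  | succ n ih =>
    simp only [iterate_succ_eq]
    refine ih.add ((AllMoments.const _).smul (AllMoments.sum fun μ => AllMoments.sum fun t => ?_))
    have hx := allMoments_episode_comp hlaw n μ
    exact (allMoments_tdError_comp ih hx t).smul (hx _)

/-- The weights before step `n` are a function of the batches `0, …, n - 1` only, a set of indices
disjoint from that of batch `n`. -/
theorem indepFun_iterate_batch (hψ : ∀ n μ, AEMeasurable (ψ n μ) Pr)
    (hindep : iIndepFun (fun p : ℕ × Fin B => ψ p.1 p.2) Pr) (n : ℕ) :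
    IndepFun (fun ω => iterate γ η wR w0 (fun m μ => ψ m μ ω) n) (fun ω μ => ψ n μ ω) Pr := by
  have h := hindep.indepFun_finset₀ (Finset.range n ×ˢ Finset.univ) ({n} ×ˢ Finset.univ)
    (by
      rw [Finset.disjoint_left]
      rintro ⟨m, μ⟩ h1 h2
      simp at h1 h2
      omega) (fun p => hψ p.1 p.2)
  -- Batches from `n` on are filled with zeros; by `iterate_congr` this does not change the `n`-th
  -- iterate.
  let f : (((Finset.range n ×ˢ Finset.univ : Finset (ℕ × Fin B))) → Fin (T + 1) → Fin N → ℝ) →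
      Fin N → ℝ := fun y => iterate γ η wR w0 (fun m μ =>
    if hm : m < n then y ⟨(m, μ), by simpa using hm⟩ else 0) n
  let g : ((({n} ×ˢ Finset.univ : Finset (ℕ × Fin B))) → Fin (T + 1) → Fin N → ℝ) →
      Fin B → Fin (T + 1) → Fin N → ℝ := fun y μ => y ⟨(n, μ), by simp⟩
  have hf : Measurable f := by
    refine (measurable_iterate n).comp (measurable_pi_lambda _ fun m => measurable_pi_lambda _
      fun μ => ?_)
    by_cases hm : m < n
    · simp only [hm, dif_pos]; exact measurable_pi_apply _
    · simp only [hm, dif_neg, not_false_eq_true]; exact measurable_const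
  have hg : Measurable g := measurable_pi_lambda _ fun μ => measurable_pi_apply _
  have := h.comp hf hg
  have hfe : (fun ω => iterate γ η wR w0 (fun m μ => ψ m μ ω) n)
      = f ∘ fun ω (i : ((Finset.range n ×ˢ Finset.univ : Finset (ℕ × Fin B)))) =>
        ψ i.1.1 i.1.2 ω := by
    ext ω : 1
    refine iterate_congr fun m hm => ?_
    ext μ : 1
    simp [hm]
  rw [hfe]
  exact this

theorem iIndepFun_batch (hindep : iIndepFun (fun p : ℕ × Fin B => ψ p.1 p.2) Pr) (n : ℕ) :
    iIndepFun (ψ n) Pr :=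
  hindep.precomp (g := fun μ : Fin B => (n, μ)) fun μ μ' h => by simpa using h

theorem meanGrad_eq [IsGaussian P] (w : Fin N → ℝ) :
    (√(N : ℝ) / T) • meanGrad P γ wR w
      = sigmaBar (corr P) *ᵥ wR - driftMatrix γ (corr P) *ᵥ w := by
  ext i
  simpa [meanGrad] using smul_integral_tdGrad P γ wR w i

theorem batchNoise_eq [IsGaussian P] (hB : 0 < B) (h : ℝ) (w : Fin N → ℝ)
    (y : Fin B → Fin (T + 1) → Fin N → ℝ) :
    batchNoise P γ h wR w y = (h * √(N : ℝ) / ((B : ℝ) * (T : ℝ))) • ∑ μ, tdGrad γ wR w (y μ)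
      - h • (sigmaBar (corr P) *ᵥ wR - driftMatrix γ (corr P) *ᵥ w) := by
  have hB' : (B : ℝ) ≠ 0 := by positivity
  rw [batchNoise, ← meanGrad_eq, Finset.sum_sub_distrib, smul_sub]
  congr 1
  ext i
  simp
  field_simp

theorem continuous_batchNoise [IsGaussian P] (hB : 0 < B) (h : ℝ) :
    Continuous fun p : (Fin N → ℝ) × (Fin B → Fin (T + 1) → Fin N → ℝ) =>
      batchNoise P γ h wR p.1 p.2 := by
  simp only [batchNoise_eq hB]
  have h1 : Continuous fun p : (Fin N → ℝ) × (Fin B → Fin (T + 1) → Fin N → ℝ) =>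
      ∑ μ, tdGrad γ wR p.1 (p.2 μ) := continuous_finsetSum _ fun μ _ =>
    continuous_tdGrad_comp continuous_fst ((continuous_apply μ).comp continuous_snd)
  have h2 : Continuous fun p : (Fin N → ℝ) × (Fin B → Fin (T + 1) → Fin N → ℝ) =>
      sigmaBar (corr P) *ᵥ wR - driftMatrix γ (corr P) *ᵥ p.1 :=
    continuous_const.sub (Continuous.matrix_mulVec continuous_const continuous_fst)
  exact (h1.const_smul (h * √(N : ℝ) / ((B : ℝ) * (T : ℝ)))).sub (h2.const_smul h)

/-- The fixed-point equation removes `w_TD` from the dynamics; the increment becomes the expected TD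
update at the mean weights. Neither uniqueness of `w_TD` nor invertibility of `A` is involved. -/
theorem meanWeights_succ {wTD : Fin N → ℝ}
    {S : Fin (T + 1) → Fin (T + 1) → Matrix (Fin N) (Fin N) ℝ}
    (hTD : driftMatrix γ S *ᵥ wTD = sigmaBar S *ᵥ wR) (n : ℕ) :
    meanWeights γ η S wTD w0 (n + 1) = meanWeights γ η S wTD w0 n +
      η n • (sigmaBar S *ᵥ wR - driftMatrix γ S *ᵥ meanWeights γ η S wTD w0 n) := by
  rw [meanWeights, mulVec_sub, hTD]

/-- The expected update is affine in the weights, so the random and the mean trajectory differ by a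
linear recursion driven by noise. The noise depends on the current weights, but is centered for each
frozen value of them. -/
theorem iterate_succ_sub_meanWeights [IsGaussian P] (hB : 0 < B) {wTD : Fin N → ℝ}
    (hTD : driftMatrix γ (corr P) *ᵥ wTD = sigmaBar (corr P) *ᵥ wR)
    (y : ℕ → Fin B → Fin (T + 1) → Fin N → ℝ) (n : ℕ) :
    iterate γ η wR w0 y (n + 1) - meanWeights γ η (corr P) wTD w0 (n + 1)
      = (1 - η n • driftMatrix γ (corr P)) *ᵥ
          (iterate γ η wR w0 y n - meanWeights γ η (corr P) wTD w0 n)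
        + batchNoise P γ (η n) wR (iterate γ η wR w0 y n) (y n) := by
  rw [iterate_succ_eq, meanWeights_succ hTD, batchNoise_eq hB]
  simp only [sub_mulVec, one_mulVec, mulVec_sub, smul_sub, smul_mulVec]
  abel

variable [IsProbabilityMeasure Pr]

theorem integral_iterate_eq_meanWeights [IsGaussian P] (hB : 0 < B)
    (hlaw : ∀ n μ, HasLaw (ψ n μ) P Pr)
    (hindep : iIndepFun (fun p : ℕ × Fin B => ψ p.1 p.2) Pr) {wTD : Fin N → ℝ}
    (hTD : driftMatrix γ (corr P) *ᵥ wTD = sigmaBar (corr P) *ᵥ wR) (n : ℕ) (i : Fin N) :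
    ∫ ω, iterate γ η wR w0 (fun m μ => ψ m μ ω) n i ∂Pr
      = meanWeights γ η (corr P) wTD w0 n i := by
  have hm : ∀ n, AllMoments (fun ω => iterate γ η wR w0 (fun m μ => ψ m μ ω) n) Pr := fun n =>
    allMoments_iterate hlaw n
  suffices h : ∀ i, ∫ ω, (iterate γ η wR w0 (fun m μ => ψ m μ ω) n
      - meanWeights γ η (corr P) wTD w0 n) i ∂Pr = 0 by
    have := h i
    simp only [Pi.sub_apply] at this
    rw [integral_sub ((hm n).eval i).integrable (integrable_const _)] at this
    simpa [sub_eq_zero] using this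
  clear i
  induction n with
  | zero => intro i; simp [iterate, meanWeights]
  | succ n ih =>
    intro i
    set w : Ω → Fin N → ℝ := fun ω => iterate γ η wR w0 (fun m μ => ψ m μ ω) n with hw
    have hz : AllMoments (fun ω => w ω - meanWeights γ η (corr P) wTD w0 n) Pr :=
      (hm n).sub (AllMoments.const _)
    have hz' : AllMoments (fun ω => (1 - η n • driftMatrix γ (corr P)) *ᵥ
        (w ω - meanWeights γ η (corr P) wTD w0 n)) Pr := hz.mulVec _
    -- The noise is the difference of two deviations already known to have all moments.
    have hξ : AllMoments (fun ω => batchNoise P γ (η n) wR (w ω) fun μ => ψ n μ ω) Pr := by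
      have := ((hm (n + 1)).sub (AllMoments.const
        (meanWeights γ η (corr P) wTD w0 (n + 1)))).sub hz'
      simp only [iterate_succ_sub_meanWeights hB hTD] at this
      convert this using 2 with ω
      exact (add_sub_cancel_left _ _).symm
    have hξ0 : ∫ ω, batchNoise P γ (η n) wR (w ω) (fun μ => ψ n μ ω) i ∂Pr = 0 := by
      rw [(integral_comp_prodMk_of_indepFun
        (indepFun_iterate_batch (fun n μ => (hlaw n μ).aemeasurable) hindep n)
        (hm n).aestronglyMeasurable.aemeasurable
        (aemeasurable_pi_lambda _ fun μ => (hlaw n μ).aemeasurable)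
        (F := fun w y => batchNoise P γ (η n) wR w y i)
        ((continuous_apply i).comp (continuous_batchNoise hB (η n))).measurable
        (hξ.eval i).integrable).2]
      have : ∀ v : Fin N → ℝ, ∫ ω, batchNoise P γ (η n) wR v (fun μ => ψ n μ ω) i ∂Pr = 0 := by
        intro v
        have hY := allMoments_tdGrad P γ wR v
        have hYi : AllMoments (fun x => (tdGrad γ wR v x - meanGrad P γ wR v) i) P :=
          AllMoments.eval (by fun_prop) i
        simp only [batchNoise, Pi.smul_apply, Finset.sum_apply, smul_eq_mul]
        rw [integral_const_mul, integral_finsetSum _ fun μ _ =>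
          (hYi.comp_hasLaw (hlaw n μ)).integrable]
        simp_rw [integral_comp_of_hasLaw (hlaw n _) hYi]
        have := integral_dotProduct_sub_mean hY (Pi.single i 1)
        simp only [single_dotProduct, one_mul] at this
        exact mul_eq_zero_of_right _ (Finset.sum_eq_zero fun μ _ => this)
      simp [this]
    simp_rw [iterate_succ_sub_meanWeights hB hTD]
    simp only [Pi.add_apply]
    rw [integral_add (hz'.eval i).integrable (hξ.eval i).integrable, hξ0, add_zero]
    simp only [mulVec]
    rw [integral_dotProduct_const hz]
    have : (fun i => ∫ ω, (w ω - meanWeights γ η (corr P) wTD w0 n) i ∂Pr) = 0 := by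
      ext j; exact ih j
    rw [this, dotProduct_zero]

end Iterates

/-! ### The Gaussian weight ensemble -/

section GaussianWeights

theorem dotProduct_transpose_mulVec {ι : Type*} [Fintype ι] (A : Matrix ι ι ℝ) (u v : ι → ℝ) :
    u ⬝ᵥ Aᵀ *ᵥ v = v ⬝ᵥ A *ᵥ u := by
  rw [mulVec_transpose, dotProduct_comm, ← dotProduct_mulVec]

/-- The long formula for `Q` is the second-order expansion about `m` in disguise: the rank-one part
of `M` combines with the terms in `m`, `w_R` and `w_TD` to the correlation at weights `m`, and `W`
enters only through `tdForm`. -/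
theorem tdErrorCorr_add_vecMulVec {N T : ℕ} (P : Measure (Fin (T + 1) → Fin N → ℝ))
    [IsGaussian P] (γ : ℝ) (wR wTD m : Fin N → ℝ) (W : Matrix (Fin N) (Fin N) ℝ) (t t' : Fin T) :
    tdErrorCorr γ (corr P) wR wTD (W + vecMulVec (m - wTD) (m - wTD)) m t t'
      = tdCorr P γ wR m t t' + 1 / (N : ℝ) * (W * tdForm γ (corr P) t t').trace := by
  rw [tdCorr_eq, tdErrorCorr, ← mul_add]
  congr 1
  simp only [add_mul, trace_add, mul_add, mul_sub, trace_sub, tdForm, mul_smul_comm, trace_smul,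
    smul_eq_mul, trace_mul_comm (vecMulVec _ _), trace_mul_vecMulVec, add_mulVec,
    dotProduct_add, dotProduct_transpose_mulVec, mulVec_sub, dotProduct_sub, sub_dotProduct]
  ring

variable {N : ℕ} {m : Fin N → ℝ} {W : Matrix (Fin N) (Fin N) ℝ}

theorem allMoments_gaussian_sub (m : Fin N → ℝ) (W : Matrix (Fin N) (Fin N) ℝ) :
    AllMoments (fun u : EuclideanSpace ℝ (Fin N) => WithLp.ofLp u - m)
      (multivariateGaussian (WithLp.toLp 2 m) W) := by
  refine AllMoments.sub (AllMoments.pi fun i => ?_) (AllMoments.const m)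
  exact allMoments_of_hasGaussianLaw
    ((IsGaussian.hasGaussianLaw_id
      (μ := multivariateGaussian (WithLp.toLp 2 m) W)).map (EuclideanSpace.proj (𝕜 := ℝ) i))

theorem integral_gaussian_sub (i : Fin N) :
    ∫ u : EuclideanSpace ℝ (Fin N), (WithLp.ofLp u - m) i
      ∂(multivariateGaussian (WithLp.toLp 2 m) W) = 0 := by
  have h := (EuclideanSpace.proj (𝕜 := ℝ) i).integral_comp_comm
    (IsGaussian.integrable_id (μ := multivariateGaussian (WithLp.toLp 2 m) W))
  simp only [id, integral_id_multivariateGaussian, PiLp.proj_apply] at h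
  have h2 := ((allMoments_gaussian_sub m W).add (AllMoments.const m)).eval i |>.integrable
  simp only [Pi.sub_apply, Pi.add_apply, sub_add_cancel] at h2
  simp only [Pi.sub_apply]
  rw [integral_sub h2 (integrable_const _), h]
  simp

theorem integral_gaussian_quadForm (hW : W.PosSemidef) (H : Matrix (Fin N) (Fin N) ℝ) :
    ∫ u : EuclideanSpace ℝ (Fin N), (WithLp.ofLp u - m) ⬝ᵥ H *ᵥ (WithLp.ofLp u - m)
      ∂(multivariateGaussian (WithLp.toLp 2 m) W) = (W * H).trace := by
  have hz := allMoments_gaussian_sub m W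
  have hc : ∀ i j, ∫ u : EuclideanSpace ℝ (Fin N), (WithLp.ofLp u - m) i * (WithLp.ofLp u - m) j
      ∂(multivariateGaussian (WithLp.toLp 2 m) W) = W i j := fun i j => by
    rw [← covariance_eval_multivariateGaussian (μ := WithLp.toLp 2 m) hW i j, covariance]
    have h : ∀ i, ∫ u : EuclideanSpace ℝ (Fin N), u i
        ∂(multivariateGaussian (WithLp.toLp 2 m) W) = m i := fun i => by
      have h1 := integral_gaussian_sub (m := m) (W := W) i
      have h2 := ((hz.add (AllMoments.const m)).eval i).integrable
      simp only [Pi.sub_apply, Pi.add_apply, sub_add_cancel] at h1 h2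
      rw [integral_sub h2 (integrable_const _)] at h1
      simpa [sub_eq_zero] using h1
    simp [h]
  have hs : ∀ i j, W i j = W j i := fun i j => by simpa using hW.1.apply j i
  have e : ∀ z : Fin N → ℝ, z ⬝ᵥ H *ᵥ z = ∑ i, ∑ j, H i j * (z i * z j) := fun z => by
    simp only [dotProduct, mulVec, Finset.mul_sum]
    exact Finset.sum_congr rfl fun i _ => Finset.sum_congr rfl fun j _ => by ring
  have hij : ∀ i j, AllMoments (fun u : EuclideanSpace ℝ (Fin N) =>
      H i j * ((WithLp.ofLp u - m) i * (WithLp.ofLp u - m) j))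
      (multivariateGaussian (WithLp.toLp 2 m) W) := fun i j =>
    (AllMoments.const _).mul ((hz.eval i).mul (hz.eval j))
  simp_rw [e]
  rw [integral_finsetSum _ fun i _ => (AllMoments.sum fun j => hij i j).integrable]
  simp_rw [integral_finsetSum Finset.univ fun j _ => (hij _ j).integrable, integral_const_mul, hc]
  simp only [Matrix.trace, diag_apply, mul_apply]
  rw [Finset.sum_comm]
  exact Finset.sum_congr rfl fun i _ => Finset.sum_congr rfl fun j _ => by
    rw [hs, mul_comm]

variable {T : ℕ} {P : Measure (Fin (T + 1) → Fin N → ℝ)} [IsGaussian P] {γ : ℝ}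

theorem integral_gaussian_tdCorr (hW : W.PosSemidef) (wR : Fin N → ℝ) (t t' : Fin T) :
    ∫ u : EuclideanSpace ℝ (Fin N), tdCorr P γ wR (WithLp.ofLp u) t t'
      ∂(multivariateGaussian (WithLp.toLp 2 m) W)
      = tdCorr P γ wR m t t' + 1 / (N : ℝ) * (W * tdForm γ (corr P) t t').trace := by
  have hz := allMoments_gaussian_sub m W
  have e : ∀ u : EuclideanSpace ℝ (Fin N), tdCorr P γ wR (WithLp.ofLp u) t t'
      = tdCorr P γ wR m t t'
      + 1 / (N : ℝ) * ((√(N : ℝ) • (tdCross P γ wR m t t' + tdCross P γ wR m t' t)) ⬝ᵥ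
          (WithLp.ofLp u - m))
      + 1 / (N : ℝ) * ((WithLp.ofLp u - m) ⬝ᵥ tdForm γ (corr P) t t' *ᵥ (WithLp.ofLp u - m)) :=
    fun u => by rw [← tdCorr_add, add_sub_cancel]
  rw [integral_congr_ae (ae_of_all _ e), integral_add ((AllMoments.const _).add ((AllMoments.const _).mul
      ((AllMoments.const _).dotProduct hz))).integrable
      ((AllMoments.const _).mul (hz.dotProduct (hz.mulVec _))).integrable,
    integral_add (integrable_const _) ((AllMoments.const _).mul
      ((AllMoments.const _).dotProduct hz)).integrable, integral_const_mul, integral_const_mul,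
    integral_dotProduct_const hz, integral_gaussian_quadForm hW]
  simp only [integral_gaussian_sub]
  simp [dotProduct]

theorem sum_tdCorr_nonneg (wR w : Fin N → ℝ) (a : Fin T → ℝ) :
    0 ≤ ∑ t, ∑ t', a t * a t' * tdCorr P γ wR w t t' := by
  have h := fun t => allMoments_tdError P γ wR w t
  have h2 : ∀ t t', AllMoments (fun x => a t * a t' *
      (tdError γ wR w x t * tdError γ wR w x t')) P := fun t t' =>
    (AllMoments.const _).mul ((h t).mul (h t'))
  have : ∑ t, ∑ t', a t * a t' * tdCorr P γ wR w t t'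
      = ∫ x, (∑ t, a t * tdError γ wR w x t) * ∑ t, a t * tdError γ wR w x t ∂P := by
    simp_rw [Finset.sum_mul_sum, mul_mul_mul_comm]
    rw [integral_finsetSum _ fun t _ => (AllMoments.sum fun t' => h2 t t').integrable]
    simp_rw [integral_finsetSum Finset.univ fun t' _ => (h2 _ t').integrable, integral_const_mul]
    rfl
  rw [this]
  exact integral_nonneg fun x => mul_self_nonneg _

/-- A Schur-product argument: the sum is the expectation of the form `Q` evaluated at the random
vector with entries `v · ψ(t)`. -/
theorem sum_mul_corr_nonneg {Q : Fin T → Fin T → ℝ}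
    (hQ : ∀ a : Fin T → ℝ, 0 ≤ ∑ t, ∑ t', a t * a t' * Q t t') (v : Fin N → ℝ) :
    0 ≤ ∑ t : Fin T, ∑ t' : Fin T, Q t t' * (v ⬝ᵥ corr P t.castSucc t'.castSucc *ᵥ v) := by
  have h := fun t => (AllMoments.const v).dotProduct (allMoments_episode P t)
  have h2 : ∀ t t' : Fin T, AllMoments (fun x : Fin (T + 1) → Fin N → ℝ => Q t t' *
      ((v ⬝ᵥ x t.castSucc) * (v ⬝ᵥ x t'.castSucc))) P := fun t t' =>
    (AllMoments.const _).mul ((h _).mul (h _))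
  simp_rw [dotProduct_corr_mulVec, ← integral_const_mul]
  simp_rw [← integral_finsetSum Finset.univ fun t' _ => (h2 _ t').integrable]
  rw [← integral_finsetSum _ fun t _ => (AllMoments.sum fun t' => h2 t t').integrable]
  refine integral_nonneg fun x => (hQ fun t => v ⬝ᵥ x t.castSucc).trans (le_of_eq ?_)
  exact Finset.sum_congr rfl fun i _ => Finset.sum_congr rfl fun j _ => mul_comm _ _

/-! ### The covariance recursion, its positivity, and `Q` as a Gaussian average -/

section Recursion

variable {α : ℝ} {η : ℕ → ℝ} {S : Fin (T + 1) → Fin (T + 1) → Matrix (Fin N) (Fin N) ℝ}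
  {wR wTD w0 : Fin N → ℝ}

instance isGaussian_weightGaussian (n : ℕ) : IsGaussian (weightGaussian γ α η S wR wTD w0 n) := by
  unfold weightGaussian
  infer_instance

theorem weightCov_zero : weightCov γ α η S wR wTD w0 0 = 0 := by
  simp [weightCov, errorCov, meanWeights]

/-- The mean error `m_n - w_TD` is propagated by the same matrix `I - η_n A`, so its outer product
drops out of the recursion for `M_n` and leaves the noise source unchanged. -/
theorem weightCov_succ (n : ℕ) : weightCov γ α η S wR wTD w0 (n + 1)
    = (1 - η n • driftMatrix γ S) * weightCov γ α η S wR wTD w0 n *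
        (1 - η n • driftMatrix γ S)ᵀ
      + (η n ^ 2 / (α * (T : ℝ) ^ 2)) • ∑ t : Fin T, ∑ t' : Fin T,
          theoryQ γ α η S wR wTD w0 n t t' • S t.castSucc t'.castSucc := by
  have e : meanWeights γ η S wTD w0 (n + 1) - wTD
      = (1 - η n • driftMatrix γ S) *ᵥ (meanWeights γ η S wTD w0 n - wTD) := by
    rw [meanWeights, ← neg_sub (meanWeights γ η S wTD w0 n) wTD]
    simp only [mulVec_neg, sub_mulVec, one_mulVec, smul_mulVec, smul_neg]
    abel
  have e2 : ∀ (L : Matrix (Fin N) (Fin N) ℝ) (v : Fin N → ℝ),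
      vecMulVec (L *ᵥ v) (L *ᵥ v) = L * vecMulVec v v * Lᵀ := fun L v => by
    rw [mul_vecMulVec, vecMulVec_mul, vecMul_transpose]
  rw [weightCov, e, e2, weightCov, errorCov]
  generalize 1 - η n • driftMatrix γ S = L
  rw [mul_sub, sub_mul]
  simp only [theoryQ]
  abel

theorem errorCov_eq (n : ℕ) : errorCov γ α η S wR wTD w0 n = weightCov γ α η S wR wTD w0 n
    + vecMulVec (meanWeights γ η S wTD w0 n - wTD) (meanWeights γ η S wTD w0 n - wTD) := by
  rw [weightCov, sub_add_cancel]

theorem theoryQ_eq (n : ℕ) (t t' : Fin T) :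
    theoryQ γ α η (corr P) wR wTD w0 n t t'
      = tdCorr P γ wR (meanWeights γ η (corr P) wTD w0 n) t t'
        + 1 / (N : ℝ) * (weightCov γ α η (corr P) wR wTD w0 n
          * tdForm γ (corr P) t t').trace := by
  rw [theoryQ, errorCov_eq, tdErrorCorr_add_vecMulVec]

theorem theoryQ_eq_integral {n : ℕ}
    (hW : (weightCov γ α η (corr P) wR wTD w0 n).PosSemidef) (t t' : Fin T) :
    theoryQ γ α η (corr P) wR wTD w0 n t t'
      = ∫ u : EuclideanSpace ℝ (Fin N), tdCorr P γ wR (WithLp.ofLp u) t t'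
        ∂(weightGaussian γ α η (corr P) wR wTD w0 n) := by
  rw [theoryQ_eq, weightGaussian, integral_gaussian_tdCorr hW]

/-- Positivity and the Gaussian average support each other: if `W_n` is positive semidefinite, then
`Q_n` is an average over Gaussian weights of Gram matrices of TD errors, hence positive
semidefinite. By `sum_mul_corr_nonneg` the noise source is then positive, and so is `W_{n+1}`. -/
theorem weightCov_posSemidef (hα : 0 ≤ α) (n : ℕ) :
    (weightCov γ α η (corr P) wR wTD w0 n).PosSemidef := by
  induction n with
  | zero => rw [weightCov_zero]; exact PosSemidef.zero
  | succ n ih =>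
    set Q := theoryQ γ α η (corr P) wR wTD w0 n with hQ
    have hQc : ∀ t t', Q t t' = Q t' t := fun t t' => by
      simp only [hQ, theoryQ_eq_integral ih]
      exact integral_congr_ae (ae_of_all _ fun u => tdCorr_comm t t')
    have hQp : ∀ a : Fin T → ℝ, 0 ≤ ∑ t, ∑ t', a t * a t' * Q t t' := fun a => by
      have hm : ∀ t t', AllMoments (fun u : EuclideanSpace ℝ (Fin N) =>
          a t * a t' * tdCorr P γ wR (WithLp.ofLp u) t t')
          (weightGaussian γ α η (corr P) wR wTD w0 n) := fun t t' => by
        have hz := (allMoments_gaussian_sub (meanWeights γ η (corr P) wTD w0 n)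
          (weightCov γ α η (corr P) wR wTD w0 n)).add
            (AllMoments.const (meanWeights γ η (corr P) wTD w0 n))
        simp only [sub_add_cancel] at hz
        exact (AllMoments.const _).mul (allMoments_tdCorr P γ wR hz t t')
      simp_rw [hQ, theoryQ_eq_integral ih, ← integral_const_mul]
      simp_rw [← integral_finsetSum Finset.univ fun t' _ => (hm _ t').integrable]
      rw [← integral_finsetSum _ fun t _ => (AllMoments.sum fun t' => hm t t').integrable]
      exact integral_nonneg fun u => sum_tdCorr_nonneg wR _ a
    rw [weightCov_succ]
    refine PosSemidef.add ?_ (PosSemidef.smul ?_ (by positivity))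
    · have := ih.mul_mul_conjTranspose_same (1 - η n • driftMatrix γ (corr P))
      rwa [conjTranspose_eq_transpose_of_trivial] at this
    · refine PosSemidef.of_dotProduct_mulVec_nonneg ?_ fun v => ?_
      · rw [Matrix.IsHermitian, conjTranspose_eq_transpose_of_trivial]
        simp only [transpose_sum, transpose_smul, corr_transpose]
        rw [Finset.sum_comm]
        exact Finset.sum_congr rfl fun t _ => Finset.sum_congr rfl fun t' _ => by rw [← hQ, hQc]
      · simp only [sum_mulVec, dotProduct_sum, smul_mulVec, dotProduct_smul, smul_eq_mul,
          star_trivial]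
        exact sum_mul_corr_nonneg hQp v

end Recursion

end GaussianWeights

/-! ### Bounds for the deterministic theory -/

section Bounds

open scoped Matrix.Norms.L2Operator

variable {N T : ℕ} {P : Measure (Fin (T + 1) → Fin N → ℝ)} [IsGaussian P] {γ C : ℝ}

theorem abs_tdCorr_le (wR w : Fin N → ℝ) (t t' : Fin T) :
    |tdCorr P γ wR w t t'| ≤ tdPower P γ wR w := by
  have h := fun t => allMoments_tdError P γ wR w t
  have hp := fun t => integral_sq_tdError_le (P := P) (γ := γ) (wR := wR) (w := w) t
  simp only [sq] at hp
  refine abs_le_of_sq_le_sq ((sq_integral_mul_le (h t) (h t')).trans ?_) tdPower_nonneg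
  rw [sq]
  exact mul_le_mul (hp t) (hp t') (integral_nonneg fun x => mul_self_nonneg _) tdPower_nonneg

theorem allMoments_readout (P : Measure (Fin (T + 1) → Fin N → ℝ)) [IsGaussian P] (w : Fin N → ℝ)
    (t : Fin (T + 1)) :
    AllMoments (fun x : Fin (T + 1) → Fin N → ℝ => readout w (x t)) P :=
  ((AllMoments.const w).dotProduct (allMoments_episode P t)).div_const _

theorem integral_sq_readout (P : Measure (Fin (T + 1) → Fin N → ℝ)) [IsGaussian P] (w : Fin N → ℝ)
    (t : Fin (T + 1)) :
    ∫ x, readout w (x t) ^ 2 ∂P = 1 / (N : ℝ) * (w ⬝ᵥ corr P t t *ᵥ w) := by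
  rw [dotProduct_corr_mulVec, ← integral_const_mul]
  refine integral_congr_ae (ae_of_all _ fun x => ?_)
  simp only [readout, div_pow, Real.sq_sqrt (Nat.cast_nonneg N)]
  ring

theorem tdPower_le_of_readout_le {cR D : ℝ} {wR m : Fin N → ℝ}
    (hR : ∀ t : Fin T, ∫ x, readout wR (x t.castSucc) ^ 2 ∂P ≤ cR)
    (hm : ∀ t : Fin (T + 1), ∫ x, readout m (x t) ^ 2 ∂P ≤ D) :
    tdPower P γ wR m ≤ T * (3 * cR + 3 * γ ^ 2 * D + 3 * D) := by
  have key : ∀ t : Fin T, tdCorr P γ wR m t t ≤ 3 * cR + 3 * γ ^ 2 * D + 3 * D := fun t => by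
    have h1 := allMoments_readout P wR t.castSucc
    have h2 := allMoments_readout P m t.castSucc
    have h3 := allMoments_readout P m t.succ
    have i1 := (AllMoments.const (μ := P) (3 : ℝ)).mul (h1.pow 2)
    have i2 := (AllMoments.const (μ := P) (3 : ℝ)).mul (h2.pow 2)
    have i3 := (AllMoments.const (μ := P) (3 * γ ^ 2)).mul (h3.pow 2)
    calc _ ≤ ∫ x, (3 * readout wR (x t.castSucc) ^ 2 + 3 * γ ^ 2 * readout m (x t.succ) ^ 2
          + 3 * readout m (x t.castSucc) ^ 2) ∂P := by
          refine integral_mono ((allMoments_tdError P γ wR m t).mul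
            (allMoments_tdError P γ wR m t)).integrable ((i1.add i3).add i2).integrable fun x => ?_
          simp only [tdError]
          nlinarith [sq_nonneg (readout wR (x t.castSucc) - γ * readout m (x t.succ)),
            sq_nonneg (readout wR (x t.castSucc) + readout m (x t.castSucc)),
            sq_nonneg (readout m (x t.castSucc) + γ * readout m (x t.succ))]
      _ = 3 * ∫ x, readout wR (x t.castSucc) ^ 2 ∂P
          + 3 * γ ^ 2 * ∫ x, readout m (x t.succ) ^ 2 ∂P
          + 3 * ∫ x, readout m (x t.castSucc) ^ 2 ∂P := by
          rw [integral_add (i1.add i3).integrable i2.integrable,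
            integral_add i1.integrable i3.integrable, integral_const_mul, integral_const_mul,
            integral_const_mul]
      _ ≤ _ := by
          gcongr
          · exact hR t
          · exact hm _
          · exact hm _
  calc _ ≤ ∑ _t : Fin T, (3 * cR + 3 * γ ^ 2 * D + 3 * D) := Finset.sum_le_sum fun t _ => key t
    _ = _ := by rw [Finset.sum_const, Finset.card_univ, Fintype.card_fin, nsmul_eq_mul]

theorem meanGrad_dotProduct_self_le (hC0 : 0 ≤ C)
    (hC : ∀ (t : Fin (T + 1)) (v : Fin N → ℝ), ∫ x, (v ⬝ᵥ x t) ^ 2 ∂P ≤ C * (v ⬝ᵥ v))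
    (wR m : Fin N → ℝ) :
    meanGrad P γ wR m ⬝ᵥ meanGrad P γ wR m ≤ T ^ 2 * gaussianConst * tdPower P γ wR m * C := by
  have hk := one_le_gaussianConst
  have hq : 0 ≤ tdPower P γ wR m := tdPower_nonneg
  rcases mean_dotProduct_self_le (allMoments_tdGrad P γ wR m)
    (integral_sq_dotProduct_tdGrad_le (γ := γ) (wR := wR) (w := m) hC) with h | h
  · exact h
  · refine h.le.trans ?_
    positivity

/-- The increment of the mean weights is `√N` times a vector of bounded length, and a readout
divides by `√N`; outputs therefore change by a quantity of order one. -/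
theorem integral_sq_readout_add_meanGrad_le (hT : 0 < T) (hC0 : 0 ≤ C)
    (hC : ∀ (t : Fin (T + 1)) (v : Fin N → ℝ), ∫ x, (v ⬝ᵥ x t) ^ 2 ∂P ≤ C * (v ⬝ᵥ v))
    (h : ℝ) (wR m : Fin N → ℝ) (t : Fin (T + 1)) :
    ∫ x, readout (m + (h * (√(N : ℝ) / T)) • meanGrad P γ wR m) (x t) ^ 2 ∂P
      ≤ 2 * ∫ x, readout m (x t) ^ 2 ∂P
        + 2 * h ^ 2 * gaussianConst * C ^ 2 * tdPower P γ wR m := by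
  set g := meanGrad P γ wR m with hg
  have hT' : (T : ℝ) ≠ 0 := by positivity
  have h1 := allMoments_readout P m t
  have h2 := (AllMoments.const g).dotProduct (allMoments_episode P t)
  have i1 := (AllMoments.const (μ := P) (2 : ℝ)).mul (h1.pow 2)
  have i2 := (AllMoments.const (μ := P) (2 * h ^ 2 / T ^ 2)).mul (h2.pow 2)
  have hk := one_le_gaussianConst
  calc _ ≤ ∫ x, (2 * readout m (x t) ^ 2 + 2 * h ^ 2 / T ^ 2 * (g ⬝ᵥ x t) ^ 2) ∂P := by
        refine integral_mono ((allMoments_readout P _ t).pow 2).integrable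
          (i1.add i2).integrable fun x => ?_
        have e : readout (m + (h * (√(N : ℝ) / T)) • g) (x t)
            = readout m (x t) + h / T * (√(N : ℝ) / √(N : ℝ)) * (g ⬝ᵥ x t) := by
          simp only [readout, add_dotProduct, smul_dotProduct, smul_eq_mul]
          ring
        -- Only an inequality is used, so that `N = 0` is covered as well.
        have hs : (√(N : ℝ) / √(N : ℝ)) ^ 2 ≤ 1 := by
          have h0 : 0 ≤ √(N : ℝ) / √(N : ℝ) := by positivity
          have h1 := div_self_le_one (√(N : ℝ))
          nlinarith
        have hb : (h / T * (√(N : ℝ) / √(N : ℝ)) * (g ⬝ᵥ x t)) ^ 2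
            ≤ h ^ 2 / T ^ 2 * (g ⬝ᵥ x t) ^ 2 := by
          rw [mul_pow, mul_pow, div_pow]
          gcongr
          exact mul_le_of_le_one_right (by positivity) hs
        simp only
        rw [e]
        have := add_sq_le (a := readout m (x t))
          (b := h / T * (√(N : ℝ) / √(N : ℝ)) * (g ⬝ᵥ x t))
        calc _ ≤ _ := this
          _ ≤ 2 * (readout m (x t) ^ 2 + h ^ 2 / T ^ 2 * (g ⬝ᵥ x t) ^ 2) := by gcongr
          _ = _ := by ring
    _ = 2 * ∫ x, readout m (x t) ^ 2 ∂P + 2 * h ^ 2 / T ^ 2 * ∫ x, (g ⬝ᵥ x t) ^ 2 ∂P := by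
        rw [integral_add i1.integrable i2.integrable, integral_const_mul, integral_const_mul]
    _ ≤ 2 * ∫ x, readout m (x t) ^ 2 ∂P + 2 * h ^ 2 / T ^ 2 *
          (C * (T ^ 2 * gaussianConst * tdPower P γ wR m * C)) := by
        gcongr
        exact (hC t g).trans (by gcongr; exact meanGrad_dotProduct_self_le hC0 hC wR m)
    _ = _ := by field_simp

theorem norm_smul_sum_le {S : Fin T → Matrix (Fin N) (Fin N) ℝ} (hC0 : 0 ≤ C)
    (hS : ∀ t, ‖S t‖ ≤ C) : ‖(1 / (T : ℝ)) • ∑ t, S t‖ ≤ C := by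
  rw [norm_smul, Real.norm_of_nonneg (by positivity)]
  calc _ ≤ 1 / (T : ℝ) * (T * C) := by
        gcongr
        calc _ ≤ ∑ t, ‖S t‖ := norm_sum_le _ _
          _ ≤ ∑ _t : Fin T, C := Finset.sum_le_sum fun t _ => hS t
          _ = _ := by simp
    _ = (T / T : ℝ) * C := by ring
    _ ≤ 1 * C := by gcongr; exact div_self_le_one _
    _ = C := one_mul _

theorem norm_sigmaBar_le (hC0 : 0 ≤ C)
    (hC : ∀ (t : Fin (T + 1)) (v : Fin N → ℝ), ∫ x, (v ⬝ᵥ x t) ^ 2 ∂P ≤ C * (v ⬝ᵥ v)) :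
    ‖sigmaBar (corr P)‖ ≤ C :=
  norm_smul_sum_le hC0 fun _ => norm_corr_le hC0 hC _ _

theorem norm_one_sub_driftMatrix_le (hC0 : 0 ≤ C)
    (hC : ∀ (t : Fin (T + 1)) (v : Fin N → ℝ), ∫ x, (v ⬝ᵥ x t) ^ 2 ∂P ≤ C * (v ⬝ᵥ v)) (h : ℝ) :
    ‖(1 - h • driftMatrix γ (corr P) : Matrix (Fin N) (Fin N) ℝ)‖
      ≤ 1 + |h| * (C + |γ| * C) := by
  have h1 : ‖(1 : Matrix (Fin N) (Fin N) ℝ)‖ ≤ 1 :=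
    norm_le_of_mulVec_dotProduct_self_le zero_le_one fun v => by simp
  have h2 : ‖driftMatrix γ (corr P)‖ ≤ C + |γ| * C := by
    refine (norm_sub_le _ _).trans (add_le_add (norm_sigmaBar_le hC0 hC) ?_)
    rw [norm_smul, Real.norm_eq_abs]
    gcongr
    exact norm_smul_sum_le hC0 fun _ => norm_corr_le hC0 hC _ _
  refine (norm_sub_le _ _).trans (add_le_add h1 ?_)
  rw [norm_smul, Real.norm_eq_abs]
  gcongr

theorem abs_inv_mul_trace_le (G : Matrix (Fin N) (Fin N) ℝ) :
    |1 / (N : ℝ) * G.trace| ≤ ‖G‖ := by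
  rw [abs_mul, abs_of_nonneg (by positivity : (0 : ℝ) ≤ 1 / N)]
  calc _ ≤ 1 / (N : ℝ) * (N * ‖G‖) := by
        gcongr
        simpa using abs_trace_le G
    _ = (N / N : ℝ) * ‖G‖ := by ring
    _ ≤ 1 * ‖G‖ := by gcongr; exact div_self_le_one _
    _ = _ := one_mul _

variable {α : ℝ} {η : ℕ → ℝ} {wR wTD w0 : Fin N → ℝ}

theorem abs_theoryQ_le (hC0 : 0 ≤ C)
    (hC : ∀ (t : Fin (T + 1)) (v : Fin N → ℝ), ∫ x, (v ⬝ᵥ x t) ^ 2 ∂P ≤ C * (v ⬝ᵥ v)) (n : ℕ)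
    (t t' : Fin T) : |theoryQ γ α η (corr P) wR wTD w0 n t t'|
      ≤ tdPower P γ wR (meanWeights γ η (corr P) wTD w0 n)
        + ‖weightCov γ α η (corr P) wR wTD w0 n‖ * ((1 + |γ|) ^ 2 * C) := by
  rw [theoryQ_eq]
  refine (abs_add_le _ _).trans (add_le_add (abs_tdCorr_le _ _ _ _)
    ((abs_inv_mul_trace_le _).trans ((norm_mul_le _ _).trans ?_)))
  gcongr
  exact norm_tdForm_le hC0 hC t t'

theorem norm_weightCov_succ_le (hT : 0 < T) (hα : 0 < α) (hC0 : 0 ≤ C)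
    (hC : ∀ (t : Fin (T + 1)) (v : Fin N → ℝ), ∫ x, (v ⬝ᵥ x t) ^ 2 ∂P ≤ C * (v ⬝ᵥ v)) (n : ℕ)
    {b : ℝ} (hb : ∀ t t', |theoryQ γ α η (corr P) wR wTD w0 n t t'| ≤ b) :
    ‖weightCov γ α η (corr P) wR wTD w0 (n + 1)‖
      ≤ (1 + |η n| * (C + |γ| * C)) ^ 2 * ‖weightCov γ α η (corr P) wR wTD w0 n‖
        + η n ^ 2 / α * (b * C) := by
  have hL := norm_one_sub_driftMatrix_le (P := P) (γ := γ) hC0 hC (η n)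
  have hT' : (T : ℝ) ≠ 0 := by positivity
  rw [weightCov_succ]
  refine (norm_add_le _ _).trans (add_le_add ?_ ?_)
  · refine (norm_mul_le _ _).trans ?_
    rw [norm_transpose_eq]
    calc _ ≤ ‖(1 - η n • driftMatrix γ (corr P) : Matrix (Fin N) (Fin N) ℝ)‖
          * ‖weightCov γ α η (corr P) wR wTD w0 n‖
          * ‖(1 - η n • driftMatrix γ (corr P) : Matrix (Fin N) (Fin N) ℝ)‖ := by
          gcongr; exact norm_mul_le _ _
      _ = ‖(1 - η n • driftMatrix γ (corr P) : Matrix (Fin N) (Fin N) ℝ)‖ ^ 2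
          * ‖weightCov γ α η (corr P) wR wTD w0 n‖ := by ring
      _ ≤ _ := by gcongr
  · rw [norm_smul, Real.norm_of_nonneg (by positivity)]
    calc _ ≤ η n ^ 2 / (α * T ^ 2) * ∑ _t : Fin T, ∑ _t' : Fin T, b * C := by
          gcongr
          refine (norm_sum_le _ _).trans (Finset.sum_le_sum fun t _ =>
            (norm_sum_le _ _).trans (Finset.sum_le_sum fun t' _ => ?_))
          rw [norm_smul, Real.norm_eq_abs]
          exact mul_le_mul (hb t t') (norm_corr_le hC0 hC _ _) (norm_nonneg _)
            ((abs_nonneg _).trans (hb t t'))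
      _ = _ := by
          simp
          field_simp

end Bounds

/-! ### One step of learning at random weights -/

section Step

open scoped Matrix.Norms.L2Operator

variable {N T B : ℕ} {γ C : ℝ} {η : ℕ → ℝ} {wR w0 : Fin N → ℝ}
  {P : Measure (Fin (T + 1) → Fin N → ℝ)} [IsGaussian P] {Ω : Type*} {mΩ : MeasurableSpace Ω}
  {Pr : Measure Ω} [IsProbabilityMeasure Pr] {ψ : ℕ → Fin B → Ω → Fin (T + 1) → Fin N → ℝ}

theorem allMoments_batchNoise_comp (hB : 0 < B) (h : ℝ) {w : Ω → Fin N → ℝ}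
    (hw : AllMoments w Pr) {y : Fin B → Ω → Fin (T + 1) → Fin N → ℝ}
    (hy : ∀ μ t, AllMoments (fun ω => y μ ω t) Pr) :
    AllMoments (fun ω => batchNoise P γ h wR (w ω) fun μ => y μ ω) Pr := by
  simp only [batchNoise_eq hB]
  exact ((AllMoments.const _).smul (AllMoments.sum fun μ => AllMoments.sum fun t =>
    (allMoments_tdError_comp hw (hy μ) t).smul (hy μ _))).sub
    ((AllMoments.const _).smul ((AllMoments.const _).sub (hw.mulVec _)))

/-- The variance bound gives a geometric mean of `tdPower` and `|c|²/N`. Passing to the arithmetic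
mean makes it linear in these two quantities, whose expectations over random weights are under
control. -/
theorem integral_abs_dotProduct_batchNoise_le (hT : 0 < T) (hB : 0 < B)
    {y : Fin B → Ω → Fin (T + 1) → Fin N → ℝ} (hlaw : ∀ μ, HasLaw (y μ) P Pr)
    (hind : iIndepFun y Pr) (hC0 : 0 ≤ C)
    (hC : ∀ (t : Fin (T + 1)) (v : Fin N → ℝ), ∫ x, (v ⬝ᵥ x t) ^ 2 ∂P ≤ C * (v ⬝ᵥ v))
    (h : ℝ) (w c : Fin N → ℝ) :
    ∫ ω, |1 / (N : ℝ) * (c ⬝ᵥ batchNoise P γ h wR w fun μ => y μ ω)| ∂Pr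
      ≤ √(h ^ 2 * gaussianConst * C * (N / B)) / (2 * √(N : ℝ))
        * (tdPower P γ wR w + 1 / (N : ℝ) * (c ⬝ᵥ c)) := by
  have hk := one_le_gaussianConst
  have hq : 0 ≤ tdPower P γ wR w := tdPower_nonneg
  have hcc := dotProduct_self_nonneg' c
  have hξ := (AllMoments.const c).dotProduct (allMoments_batchNoise (γ := γ) (wR := wR) (w := w)
    hlaw h)
  have h1 := integral_abs_le_sqrt hξ (integral_sq_dotProduct_batchNoise_le hT hlaw hind hC h c)
  simp only [abs_mul, integral_const_mul]
  rw [abs_of_nonneg (by positivity : (0 : ℝ) ≤ 1 / N)]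
  set a := h ^ 2 * gaussianConst * C * (N / B) with ha
  have ha0 : 0 ≤ a := by positivity
  set s := √(N : ℝ) with hs
  have hN : (N : ℝ) = s * s := (Real.mul_self_sqrt (by positivity)).symm
  calc _ ≤ 1 / (N : ℝ) * √(a * tdPower P γ wR w * (c ⬝ᵥ c)) := by gcongr
    _ = √a / s * (√(tdPower P γ wR w) * (√(c ⬝ᵥ c) / s)) := by
        rw [Real.sqrt_mul (by positivity), Real.sqrt_mul ha0, hN, one_div, mul_inv]
        ring
    _ ≤ √a / s * ((tdPower P γ wR w + 1 / (N : ℝ) * (c ⬝ᵥ c)) / 2) := by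
        gcongr
        have e1 := Real.sq_sqrt hq
        have e2 : 1 / (N : ℝ) * (c ⬝ᵥ c) = (√(c ⬝ᵥ c) / s) ^ 2 := by
          rw [div_pow, Real.sq_sqrt hcc, hN]; ring
        rw [e2]
        nlinarith [sq_nonneg (√(tdPower P γ wR w) - √(c ⬝ᵥ c) / s)]
    _ = _ := by ring

/-- Batch `n` is independent of the weights on which it acts, so each estimate at frozen weights
extends to the random iterate. -/
theorem integral_iterate_batch_le (hlaw : ∀ n μ, HasLaw (ψ n μ) P Pr)
    (hindep : iIndepFun (fun p : ℕ × Fin B => ψ p.1 p.2) Pr) (n : ℕ)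
    {F : (Fin N → ℝ) → (Fin B → Fin (T + 1) → Fin N → ℝ) → ℝ}
    (hF : Continuous (Function.uncurry F))
    (hi : AllMoments (fun ω => F (iterate γ η wR w0 (fun m μ => ψ m μ ω) n) fun μ => ψ n μ ω) Pr)
    {g : (Fin N → ℝ) → ℝ}
    (hg : AllMoments (fun ω => g (iterate γ η wR w0 (fun m μ => ψ m μ ω) n)) Pr)
    (hle : ∀ a, ∫ ω, F a (fun μ => ψ n μ ω) ∂Pr ≤ g a) :
    ∫ ω, F (iterate γ η wR w0 (fun m μ => ψ m μ ω) n) (fun μ => ψ n μ ω) ∂Pr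
      ≤ ∫ ω, g (iterate γ η wR w0 (fun m μ => ψ m μ ω) n) ∂Pr :=
  integral_comp_prodMk_le_of_indepFun
    (indepFun_iterate_batch (fun n μ => (hlaw n μ).aemeasurable) hindep n)
    (allMoments_iterate hlaw n).aestronglyMeasurable.aemeasurable
    (aemeasurable_pi_lambda _ fun μ => (hlaw n μ).aemeasurable) hF.measurable hi.integrable
    hg.integrable hle

end Step

/-! ### Learning in the proportional limit -/

/-- A sequence of TD learning problems of order one in the proportional limit. -/
structure LearningSequence (T : ℕ) (γ α C : ℝ) (η : ℕ → ℝ) {Ω : ℕ → Type*}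
    [∀ k, MeasurableSpace (Ω k)] (Pr : ∀ k, Measure (Ω k)) where
  N : ℕ → ℕ
  B : ℕ → ℕ
  P : ∀ k, Measure (Fin (T + 1) → Fin (N k) → ℝ)
  wR : ∀ k, Fin (N k) → ℝ
  wTD : ∀ k, Fin (N k) → ℝ
  w0 : ∀ k, Fin (N k) → ℝ
  ψ : ∀ k, ℕ → Fin (B k) → Ω k → Fin (T + 1) → Fin (N k) → ℝ
  T_pos : 0 < T
  α_pos : 0 < α
  tendsto_N : Tendsto N atTop atTop
  tendsto_B : Tendsto B atTop atTop
  tendsto_ratio : Tendsto (fun k => (B k : ℝ) / (N k : ℝ)) atTop (𝓝 α)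
  gaussian : ∀ k, IsGaussian (P k)
  fixedPoint : ∀ k, driftMatrix γ (corr (P k)) *ᵥ wTD k = sigmaBar (corr (P k)) *ᵥ wR k
  corr_le : ∀ k (t : Fin (T + 1)) (v : Fin (N k) → ℝ),
    v ⬝ᵥ (corr (P k) t t *ᵥ v) ≤ C * (v ⬝ᵥ v)
  reward_le : ∀ k (t : Fin T), ∫ x, readout (wR k) (x t.castSucc) ^ 2 ∂(P k) ≤ C
  value_le : ∀ k (t : Fin T), ∫ x, readout (wTD k) (x t.castSucc) ^ 2 ∂(P k) ≤ C
  initial_le : ∀ k (t : Fin (T + 1)), ∫ x, readout (w0 k) (x t) ^ 2 ∂(P k) ≤ C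
  prob : ∀ k, IsProbabilityMeasure (Pr k)
  hasLaw : ∀ k n μ, HasLaw (ψ k n μ) (P k) (Pr k)
  indep : ∀ k, iIndepFun (fun p : ℕ × Fin (B k) => ψ k p.1 p.2) (Pr k)

namespace LearningSequence

open scoped Matrix.Norms.L2Operator

variable {T : ℕ} {γ α C : ℝ} {η : ℕ → ℝ} {Ω : ℕ → Type*} [∀ k, MeasurableSpace (Ω k)]
  {Pr : ∀ k, Measure (Ω k)} (s : LearningSequence T γ α C η Pr)

attribute [instance] gaussian

/-- The weights after `n` steps. -/
def w (k n : ℕ) (ω : Ω k) : Fin (s.N k) → ℝ :=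
  iterate γ η (s.wR k) (s.w0 k) (fun m μ => s.ψ k m μ ω) n

/-- The mean weights after `n` steps. -/
def mean (k n : ℕ) : Fin (s.N k) → ℝ :=
  meanWeights γ η (corr (s.P k)) (s.wTD k) (s.w0 k) n

/-- The deviation of the weights from their mean. -/
def dev (k n : ℕ) (ω : Ω k) : Fin (s.N k) → ℝ := s.w k n ω - s.mean k n

/-- The theoretical covariance of the weights after `n` steps. -/
def cov (k n : ℕ) : Matrix (Fin (s.N k)) (Fin (s.N k)) ℝ :=
  weightCov γ α η (corr (s.P k)) (s.wR k) (s.wTD k) (s.w0 k) n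

/-- The theoretical TD-error correlation. -/
def theory (k n : ℕ) (t t' : Fin T) : ℝ :=
  theoryQ γ α η (corr (s.P k)) (s.wR k) (s.wTD k) (s.w0 k) n t t'

/-- The propagator of the mean-path dynamics. -/
def step (k n : ℕ) : Matrix (Fin (s.N k)) (Fin (s.N k)) ℝ :=
  1 - η n • driftMatrix γ (corr (s.P k))

/-- The noise in the update at step `n`. -/
def noise (k n : ℕ) (ω : Ω k) : Fin (s.N k) → ℝ :=
  batchNoise (s.P k) γ (η n) (s.wR k) (s.w k n ω) fun μ => s.ψ k n μ ω

theorem C_nonneg (s : LearningSequence T γ α C η Pr) : 0 ≤ C :=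
  (integral_nonneg fun _ => sq_nonneg _).trans (s.reward_le 0 ⟨0, s.T_pos⟩)

theorem integral_sq_dotProduct_le (k : ℕ) (t : Fin (T + 1)) (v : Fin (s.N k) → ℝ) :
    ∫ x, (v ⬝ᵥ x t) ^ 2 ∂(s.P k) ≤ C * (v ⬝ᵥ v) := by
  have := s.corr_le k t v
  rw [dotProduct_corr_mulVec] at this
  simpa only [sq] using this

theorem mean_succ (k n : ℕ) : s.mean k (n + 1)
    = s.mean k n + (η n * (√(s.N k : ℝ) / T)) • meanGrad (s.P k) γ (s.wR k) (s.mean k n) := by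
  rw [mul_smul, meanGrad_eq]
  exact meanWeights_succ (s.fixedPoint k) n

theorem tdPower_mean_le_of_readout_le {n : ℕ} {D : ℝ}
    (hD : ∀ k (t : Fin (T + 1)), ∫ x, readout (s.mean k n) (x t) ^ 2 ∂(s.P k) ≤ D) (k : ℕ) :
    tdPower (s.P k) γ (s.wR k) (s.mean k n) ≤ T * (3 * C + 3 * γ ^ 2 * D + 3 * D) :=
  tdPower_le_of_readout_le (s.reward_le k) (hD k)

/-- The induction carries bounds on outputs at all times up to `T + 1`, since the lengths of the
weight vectors are not controlled by the hypotheses. -/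
theorem exists_readout_mean_le (n : ℕ) : ∃ D, ∀ k (t : Fin (T + 1)),
    ∫ x, readout (s.mean k n) (x t) ^ 2 ∂(s.P k) ≤ D := by
  have hk := one_le_gaussianConst
  induction n with
  | zero => exact ⟨C, s.initial_le⟩
  | succ n ih =>
    obtain ⟨D, hD⟩ := ih
    refine ⟨2 * D + 2 * η n ^ 2 * gaussianConst * C ^ 2 * (T * (3 * C + 3 * γ ^ 2 * D + 3 * D)),
      fun k t => ?_⟩
    rw [mean_succ]
    refine (integral_sq_readout_add_meanGrad_le s.T_pos s.C_nonneg (s.integral_sq_dotProduct_le k)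
      (η n) (s.wR k) (s.mean k n) t).trans ?_
    gcongr
    · exact hD k t
    · exact s.tdPower_mean_le_of_readout_le hD k

theorem exists_tdPower_mean_le (n : ℕ) : ∃ q, 0 ≤ q ∧ ∀ k,
    tdPower (s.P k) γ (s.wR k) (s.mean k n) ≤ q := by
  obtain ⟨D, hD⟩ := s.exists_readout_mean_le n
  exact ⟨_, tdPower_nonneg.trans (s.tdPower_mean_le_of_readout_le hD 0),
    s.tdPower_mean_le_of_readout_le hD⟩

theorem exists_theory_le_of_cov_le {n : ℕ} {b : ℝ} (hb : ∀ k, ‖s.cov k n‖ ≤ b) :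
    ∃ c, 0 ≤ c ∧ ∀ k t t', |s.theory k n t t'| ≤ c := by
  obtain ⟨q, hq0, hq⟩ := s.exists_tdPower_mean_le n
  have hC0 := s.C_nonneg
  have hb0 : 0 ≤ b := (norm_nonneg _).trans (hb 0)
  refine ⟨q + b * ((1 + |γ|) ^ 2 * C), by positivity, fun k t t' => ?_⟩
  refine (abs_theoryQ_le s.C_nonneg (s.integral_sq_dotProduct_le k) n t t').trans ?_
  gcongr
  · exact hq k
  · exact hb k

/-- The covariance starts at zero and its source is bounded in operator norm. No such bound is
available for `M_n`, whose rank-one part is not controlled; this is why the argument runs on the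
covariance. -/
theorem exists_cov_le (n : ℕ) : ∃ b, 0 ≤ b ∧ ∀ k, ‖s.cov k n‖ ≤ b := by
  have hC0 := s.C_nonneg
  have hα := s.α_pos
  induction n with
  | zero => exact ⟨0, le_rfl, fun k => by simp [cov, weightCov_zero]⟩
  | succ n ih =>
    obtain ⟨b, hb0, hb⟩ := ih
    obtain ⟨c, hc0, hc⟩ := s.exists_theory_le_of_cov_le hb
    refine ⟨(1 + |η n| * (C + |γ| * C)) ^ 2 * b + η n ^ 2 / α * (c * C), by positivity,
      fun k => (norm_weightCov_succ_le s.T_pos s.α_pos s.C_nonneg (s.integral_sq_dotProduct_le k)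
        n (hc k)).trans ?_⟩
    gcongr
    exact hb k

theorem exists_theory_le (n : ℕ) : ∃ c, 0 ≤ c ∧ ∀ k t t', |s.theory k n t t'| ≤ c :=
  let ⟨_, _, hb⟩ := s.exists_cov_le n
  s.exists_theory_le_of_cov_le hb

theorem norm_step_le (k n : ℕ) : ‖s.step k n‖ ≤ 1 + |η n| * (C + |γ| * C) :=
  norm_one_sub_driftMatrix_le s.C_nonneg (s.integral_sq_dotProduct_le k) (η n)

theorem allMoments_w (k n : ℕ) : AllMoments (s.w k n) (Pr k) :=
  have := s.prob k
  allMoments_iterate (s.hasLaw k) n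

theorem allMoments_dev (k n : ℕ) : AllMoments (s.dev k n) (Pr k) :=
  have := s.prob k
  (s.allMoments_w k n).sub (AllMoments.const _)

theorem allMoments_noise (k n : ℕ) (hB : 0 < s.B k) : AllMoments (s.noise k n) (Pr k) :=
  have := s.prob k
  allMoments_batchNoise_comp hB _ (s.allMoments_w k n) fun μ => allMoments_episode_comp
    (s.hasLaw k) n μ

theorem dev_zero (k : ℕ) (ω : Ω k) : s.dev k 0 ω = 0 := sub_self _

theorem dev_succ (k n : ℕ) (hB : 0 < s.B k) (ω : Ω k) :
    s.dev k (n + 1) ω = s.step k n *ᵥ s.dev k n ω + s.noise k n ω :=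
  iterate_succ_sub_meanWeights hB (s.fixedPoint k) _ n

theorem cov_zero (k : ℕ) : s.cov k 0 = 0 := weightCov_zero

theorem cov_succ (k n : ℕ) : s.cov k (n + 1) = s.step k n * s.cov k n * (s.step k n)ᵀ
    + (η n ^ 2 / (α * (T : ℝ) ^ 2)) • ∑ t : Fin T, ∑ t' : Fin T,
      s.theory k n t t' • corr (s.P k) t.castSucc t'.castSucc := weightCov_succ n

theorem allMoments_tdCorr (k n : ℕ) (t t' : Fin T) :
    AllMoments (fun ω => tdCorr (s.P k) γ (s.wR k) (s.w k n ω) t t') (Pr k) :=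
  have := s.prob k
  TDLearning.allMoments_tdCorr _ γ _ (s.allMoments_w k n) t t'

theorem allMoments_tdPower (k n : ℕ) :
    AllMoments (fun ω => tdPower (s.P k) γ (s.wR k) (s.w k n ω)) (Pr k) :=
  have := s.prob k
  TDLearning.allMoments_tdPower _ γ _ (s.allMoments_w k n)

theorem allMoments_quadForm (k n : ℕ) (G : Matrix (Fin (s.N k)) (Fin (s.N k)) ℝ) :
    AllMoments (fun ω => 1 / (s.N k : ℝ) * (s.dev k n ω ⬝ᵥ G *ᵥ s.dev k n ω)) (Pr k) :=
  have := s.prob k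
  (AllMoments.const _).mul ((s.allMoments_dev k n).dotProduct ((s.allMoments_dev k n).mulVec G))

theorem continuous_noise (k : ℕ) (hB : 0 < s.B k) (h : ℝ) :
    Continuous fun p : (Fin (s.N k) → ℝ) × (Fin (s.B k) → Fin (T + 1) → Fin (s.N k) → ℝ) =>
      batchNoise (s.P k) γ h (s.wR k) p.1 p.2 :=
  continuous_batchNoise hB h

/-- At frozen weights the noise is tested against the fixed vector `D z`. The prefactor is of order
`N^{-1/2}`, because `N/B` stays bounded. -/
theorem integral_abs_cross_le (k n : ℕ) (hB : 0 < s.B k)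
    (D : Matrix (Fin (s.N k)) (Fin (s.N k)) ℝ) :
    ∫ ω, |1 / (s.N k : ℝ) * ((D *ᵥ s.dev k n ω) ⬝ᵥ s.noise k n ω)| ∂(Pr k)
      ≤ √(η n ^ 2 * gaussianConst * C * (s.N k / s.B k)) / (2 * √(s.N k : ℝ))
        * (∫ ω, tdPower (s.P k) γ (s.wR k) (s.w k n ω) ∂(Pr k)
          + ‖D‖ ^ 2 * ∫ ω, 1 / (s.N k : ℝ) * (s.dev k n ω ⬝ᵥ s.dev k n ω) ∂(Pr k)) := by
  have := s.prob k
  have hd := s.allMoments_dev k n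
  have hn := s.allMoments_noise k n hB
  have hdd := (AllMoments.const (μ := Pr k) (1 / (s.N k : ℝ))).mul (hd.dotProduct hd)
  have hg := (AllMoments.const (μ := Pr k) (√(η n ^ 2 * gaussianConst * C * (s.N k / s.B k))
    / (2 * √(s.N k : ℝ)))).mul
      ((s.allMoments_tdPower k n).add ((AllMoments.const (‖D‖ ^ 2)).mul hdd))
  rw [← integral_const_mul, ← integral_add (s.allMoments_tdPower k n).integrable
    ((AllMoments.const (‖D‖ ^ 2)).mul hdd).integrable, ← integral_const_mul]
  refine integral_iterate_batch_le (s.hasLaw k) (s.indep k) n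
    (F := fun a y => |1 / (s.N k : ℝ) * ((D *ᵥ (a - s.mean k n)) ⬝ᵥ
      batchNoise (s.P k) γ (η n) (s.wR k) a y)|) ?_
    ((AllMoments.const _).mul ((hd.mulVec D).dotProduct hn)).abs
    (g := fun a => √(η n ^ 2 * gaussianConst * C * (s.N k / s.B k)) / (2 * √(s.N k : ℝ))
      * (tdPower (s.P k) γ (s.wR k) a
        + ‖D‖ ^ 2 * (1 / (s.N k : ℝ) * ((a - s.mean k n) ⬝ᵥ (a - s.mean k n))))) hg fun a => ?_
  · exact (continuous_const.mul ((Continuous.matrix_mulVec continuous_const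
      (continuous_fst.sub continuous_const)).dotProduct (s.continuous_noise k hB (η n)))).abs
  · refine (integral_abs_dotProduct_batchNoise_le s.T_pos hB (s.hasLaw k n)
      (iIndepFun_batch (s.indep k) n) s.C_nonneg (s.integral_sq_dotProduct_le k) (η n) a
      (D *ᵥ (a - s.mean k n))).trans ?_
    refine mul_le_mul_of_nonneg_left (add_le_add le_rfl ?_) (by positivity)
    rw [mul_left_comm]
    exact mul_le_mul_of_nonneg_left (mulVec_dotProduct_self_le _ _) (by positivity)

theorem integral_abs_noise_quadForm_sub_le (k n : ℕ) (hN : 0 < s.N k) (hB : 0 < s.B k)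
    (G : Matrix (Fin (s.N k)) (Fin (s.N k)) ℝ) :
    ∫ ω, |1 / (s.N k : ℝ) * (s.noise k n ω ⬝ᵥ G *ᵥ s.noise k n ω)
        - η n ^ 2 / T ^ 2 * (s.N k / s.B k) * ∑ t : Fin T, ∑ t' : Fin T,
          tdCorr (s.P k) γ (s.wR k) (s.w k n ω) t t'
            * (1 / (s.N k : ℝ) * (G * corr (s.P k) t.castSucc t'.castSucc).trace)| ∂(Pr k)
      ≤ η n ^ 2 * gaussianConst * C * ‖G‖ * noiseRate (s.N k) (s.B k)
        * ∫ ω, tdPower (s.P k) γ (s.wR k) (s.w k n ω) ∂(Pr k) := by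
  have := s.prob k
  have hn := s.allMoments_noise k n hB
  rw [← integral_const_mul]
  refine integral_iterate_batch_le (s.hasLaw k) (s.indep k) n
    (F := fun a y => |1 / (s.N k : ℝ) * ((batchNoise (s.P k) γ (η n) (s.wR k) a y) ⬝ᵥ
        G *ᵥ (batchNoise (s.P k) γ (η n) (s.wR k) a y))
      - η n ^ 2 / T ^ 2 * (s.N k / s.B k) * ∑ t : Fin T, ∑ t' : Fin T,
          tdCorr (s.P k) γ (s.wR k) a t t'
            * (1 / (s.N k : ℝ) * (G * corr (s.P k) t.castSucc t'.castSucc).trace)|) ?_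
    ?_ (g := fun a => η n ^ 2 * gaussianConst * C * ‖G‖ * noiseRate (s.N k) (s.B k)
        * tdPower (s.P k) γ (s.wR k) a)
    ((AllMoments.const _).mul (s.allMoments_tdPower k n)) fun a => ?_
  · have hc := s.continuous_noise k hB (η n)
    refine ((continuous_const.mul (hc.dotProduct (Continuous.matrix_mulVec continuous_const
      hc))).sub (continuous_const.mul (continuous_finsetSum _ fun t _ =>
        continuous_finsetSum _ fun t' _ => Continuous.mul ?_ continuous_const))).abs
    exact (continuous_tdCorr _ γ _ t t').comp continuous_fst
  · exact (((AllMoments.const _).mul (hn.dotProduct (hn.mulVec G))).sub ((AllMoments.const _).mul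
      (AllMoments.sum fun t => AllMoments.sum fun t' =>
        (s.allMoments_tdCorr k n t t').mul (AllMoments.const _)))).abs
  · exact integral_abs_batchNoise_quadForm_sub_le s.T_pos hN hB (s.hasLaw k n)
      (iIndepFun_batch (s.indep k) n) s.C_nonneg (s.integral_sq_dotProduct_le k) (η n) G

theorem allMoments_tdError (k n : ℕ) (μ : Fin (s.B k)) (t : Fin T) :
    AllMoments (fun ω => tdError γ (s.wR k) (s.w k n ω) (s.ψ k n μ ω) t) (Pr k) :=
  have := s.prob k
  allMoments_tdError_comp (s.allMoments_w k n) (allMoments_episode_comp (s.hasLaw k) n μ) t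

theorem continuous_tdError_batch (k : ℕ) (μ : Fin (s.B k)) (t : Fin T) :
    Continuous fun p : (Fin (s.N k) → ℝ) × (Fin (s.B k) → Fin (T + 1) → Fin (s.N k) → ℝ) =>
      tdError γ (s.wR k) p.1 (p.2 μ) t := by
  simp only [tdError, readout, dotProduct]
  fun_prop

theorem integral_abs_batch_sub_le (k n : ℕ) (hB : 0 < s.B k) (t t' : Fin T) :
    ∫ ω, |1 / (s.B k : ℝ) * ∑ μ, tdError γ (s.wR k) (s.w k n ω) (s.ψ k n μ ω) t
          * tdError γ (s.wR k) (s.w k n ω) (s.ψ k n μ ω) t'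
        - tdCorr (s.P k) γ (s.wR k) (s.w k n ω) t t'| ∂(Pr k)
      ≤ gaussianConst / √(s.B k : ℝ)
        * ∫ ω, tdPower (s.P k) γ (s.wR k) (s.w k n ω) ∂(Pr k) := by
  have := s.prob k
  rw [← integral_const_mul]
  refine integral_iterate_batch_le (s.hasLaw k) (s.indep k) n
    (F := fun a y => |1 / (s.B k : ℝ) * ∑ μ, tdError γ (s.wR k) a (y μ) t
          * tdError γ (s.wR k) a (y μ) t' - tdCorr (s.P k) γ (s.wR k) a t t'|) ?_
    ?_ (g := fun a => gaussianConst / √(s.B k : ℝ) * tdPower (s.P k) γ (s.wR k) a)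
    ((AllMoments.const _).mul (s.allMoments_tdPower k n)) fun a => ?_
  · exact ((continuous_const.mul (continuous_finsetSum _ fun μ _ =>
      (s.continuous_tdError_batch k μ t).mul (s.continuous_tdError_batch k μ t'))).sub
        ((continuous_tdCorr _ γ _ t t').comp continuous_fst)).abs
  · exact (((AllMoments.const _).mul (AllMoments.sum fun μ => (s.allMoments_tdError k n μ t).mul
      (s.allMoments_tdError k n μ t'))).sub (s.allMoments_tdCorr k n t t')).abs
  · exact integral_abs_batch_tdCorr_sub_le hB (s.hasLaw k n) (iIndepFun_batch (s.indep k) n) t t'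

/-- The right side does not involve the episode `μ`, which makes the convergence of the expected
TD-error products uniform over the batch. -/
theorem integral_tdError_mul (k n : ℕ) (μ : Fin (s.B k)) (t t' : Fin T) :
    ∫ ω, tdError γ (s.wR k) (s.w k n ω) (s.ψ k n μ ω) t
        * tdError γ (s.wR k) (s.w k n ω) (s.ψ k n μ ω) t' ∂(Pr k)
      = ∫ ω, tdCorr (s.P k) γ (s.wR k) (s.w k n ω) t t' ∂(Pr k) := by
  have := s.prob k
  have h : IndepFun (s.w k n) (fun ω μ => s.ψ k n μ ω) (Pr k) :=
    indepFun_iterate_batch (fun n μ => (s.hasLaw k n μ).aemeasurable) (s.indep k) n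
  rw [(integral_comp_prodMk_of_indepFun h
    (s.allMoments_w k n).aestronglyMeasurable.aemeasurable
    (aemeasurable_pi_lambda _ fun μ => (s.hasLaw k n μ).aemeasurable)
    (F := fun a y => tdError γ (s.wR k) a (y μ) t * tdError γ (s.wR k) a (y μ) t')
    ((s.continuous_tdError_batch k μ t).mul (s.continuous_tdError_batch k μ t')).measurable
    ((s.allMoments_tdError k n μ t).mul (s.allMoments_tdError k n μ t')).integrable).2]
  refine integral_congr_ae (ae_of_all _ fun ω => ?_)
  exact integral_comp_of_hasLaw (s.hasLaw k n μ) ((TDLearning.allMoments_tdError _ γ _ _ t).mul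
    (TDLearning.allMoments_tdError _ γ _ _ t'))

end LearningSequence

/-! ### Convergence in mean along sequences of probability spaces -/

/-- Convergence to zero in `L¹` of random variables with all moments, on varying spaces. -/
structure TendstoL1 {Ω : ℕ → Type*} [∀ k, MeasurableSpace (Ω k)] (Pr : ∀ k, Measure (Ω k))
    (X : ∀ k, Ω k → ℝ) : Prop where
  allMoments : ∀ᶠ k in atTop, AllMoments (X k) (Pr k)
  tendsto : Tendsto (fun k => ∫ ω, |X k ω| ∂(Pr k)) atTop (𝓝 0)

namespace TendstoL1

variable {Ω : ℕ → Type*} [∀ k, MeasurableSpace (Ω k)] {Pr : ∀ k, Measure (Ω k)}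
  {X Y : ∀ k, Ω k → ℝ}

theorem congr (hX : TendstoL1 Pr X) (h : ∀ᶠ k in atTop, ∀ ω, X k ω = Y k ω) :
    TendstoL1 Pr Y := by
  have h' : ∀ᶠ k in atTop, X k = Y k := h.mono fun k hk => funext hk
  refine ⟨?_, hX.tendsto.congr' (h'.mono fun k hk => by rw [hk])⟩
  filter_upwards [hX.allMoments, h'] with k h1 h2
  rwa [← h2]

theorem add (hX : TendstoL1 Pr X) (hY : TendstoL1 Pr Y) :
    TendstoL1 Pr fun k ω => X k ω + Y k ω := by
  refine ⟨by filter_upwards [hX.allMoments, hY.allMoments] with k h1 h2 using h1.add h2, ?_⟩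
  have h := hX.tendsto.add hY.tendsto
  rw [add_zero] at h
  refine squeeze_zero' (Eventually.of_forall fun k => integral_nonneg fun ω => abs_nonneg _) ?_ h
  filter_upwards [hX.allMoments, hY.allMoments] with k h1 h2
  rw [← integral_add h1.abs.integrable h2.abs.integrable]
  exact integral_mono (h1.add h2).abs.integrable (h1.abs.add h2.abs).integrable
    fun ω => abs_add_le _ _

theorem zero : TendstoL1 Pr fun _ _ => 0 :=
  ⟨Eventually.of_forall fun _ _ => by simp, by simp⟩

theorem sum {ι : Type*} (s : Finset ι) {X : ι → ∀ k, Ω k → ℝ}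
    (hX : ∀ i, TendstoL1 Pr (X i)) : TendstoL1 Pr fun k ω => ∑ i ∈ s, X i k ω := by
  classical
  induction s using Finset.induction_on with
  | empty => simpa using zero
  | insert i s hi ih => simpa only [Finset.sum_insert hi] using (hX i).add ih

theorem const [∀ k, IsProbabilityMeasure (Pr k)] {c : ℕ → ℝ} (hc : Tendsto c atTop (𝓝 0)) :
    TendstoL1 Pr fun k _ => c k :=
  ⟨Eventually.of_forall fun _ => AllMoments.const _, by simpa using hc.abs⟩

theorem const_mul [∀ k, IsProbabilityMeasure (Pr k)] (hX : TendstoL1 Pr X) {c : ℕ → ℝ} {K : ℝ}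
    (hc : ∀ᶠ k in atTop, |c k| ≤ K) :
    TendstoL1 Pr fun k ω => c k * X k ω := by
  refine ⟨hX.allMoments.mono fun k h => (AllMoments.const _).mul h, ?_⟩
  have h := hX.tendsto.const_mul K
  rw [mul_zero] at h
  refine squeeze_zero' (Eventually.of_forall fun k => integral_nonneg fun ω => abs_nonneg _) ?_ h
  filter_upwards [hc] with k h1
  simp only [abs_mul, integral_const_mul]
  exact mul_le_mul_of_nonneg_right h1 (integral_nonneg fun ω => abs_nonneg _)

theorem tendsto_integral (hX : TendstoL1 Pr X) :
    Tendsto (fun k => ∫ ω, X k ω ∂(Pr k)) atTop (𝓝 0) :=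
  squeeze_zero_norm (fun _ => abs_integral_le_integral_abs) hX.tendsto

theorem tendsto_eLpNorm (hX : TendstoL1 Pr X) :
    Tendsto (fun k => eLpNorm (X k) 1 (Pr k)) atTop (𝓝 0) := by
  have h := ENNReal.tendsto_ofReal hX.tendsto
  rw [ENNReal.ofReal_zero] at h
  refine h.congr' (hX.allMoments.mono fun k hk => ?_)
  beta_reduce
  rw [eLpNorm_one_eq_lintegral_enorm, ← ofReal_integral_norm_eq_lintegral_enorm hk.integrable]
  rfl

end TendstoL1

/-- In terms of `r = N/B` the rate is `√(32 (r + r²)/B) + 3 √(r/B) + 1/B`. Here `α` is the limit of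
`N/B`, so the lemma is applied with the inverse of the limiting batch ratio. -/
theorem tendsto_noiseRate {α : ℝ} {N B : ℕ → ℕ} (hB : Tendsto B atTop atTop)
    (hr : Tendsto (fun k => (N k : ℝ) / (B k : ℝ)) atTop (𝓝 α)) :
    Tendsto (fun k => noiseRate (N k) (B k)) atTop (𝓝 0) := by
  have hB' : Tendsto (fun k => (B k : ℝ)⁻¹) atTop (𝓝 0) :=
    tendsto_inv_atTop_zero.comp (tendsto_natCast_atTop_atTop.comp hB)
  have h1 : Tendsto (fun k => √(32 * (((N k : ℝ) / B k + ((N k : ℝ) / B k) ^ 2) * (B k : ℝ)⁻¹))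
      + 3 * √((N k : ℝ) / B k * (B k : ℝ)⁻¹) + (B k : ℝ)⁻¹) atTop
      (𝓝 (√(32 * ((α + α ^ 2) * 0)) + 3 * √(α * 0) + 0)) :=
    (((((hr.add (hr.pow 2)).mul hB').const_mul 32).sqrt).add
      ((hr.mul hB').sqrt.const_mul 3)).add hB'
  have e : √(32 * ((α + α ^ 2) * 0)) + 3 * √(α * 0) + 0 = 0 := by simp
  rw [e] at h1
  refine h1.congr' ?_
  filter_upwards [hB.eventually_gt_atTop 0] with k hk
  have hb : (0 : ℝ) < B k := by exact_mod_cast hk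
  have e1 : √(32 * (((N k : ℝ) / B k + ((N k : ℝ) / B k) ^ 2) * (B k : ℝ)⁻¹))
      = √(32 * ((N k : ℝ) * B k ^ 2 + N k ^ 2 * B k)) / B k ^ 2 := by
    rw [show 32 * (((N k : ℝ) / B k + ((N k : ℝ) / B k) ^ 2) * (B k : ℝ)⁻¹)
        = 32 * ((N k : ℝ) * B k ^ 2 + N k ^ 2 * B k) / (B k ^ 2) ^ 2 by field_simp,
      Real.sqrt_div' _ (by positivity), Real.sqrt_sq (by positivity)]
  have e2 : √((N k : ℝ) / B k * (B k : ℝ)⁻¹) = √(N k) / B k := by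
    rw [show (N k : ℝ) / B k * (B k : ℝ)⁻¹ = N k / B k ^ 2 by field_simp,
      Real.sqrt_div' _ (by positivity), Real.sqrt_sq hb.le]
  rw [e1, e2, noiseRate]
  field_simp
  ring

/-! ### Convergence of quadratic forms of the deviation, and what it implies at a given step -/

namespace LearningSequence

open scoped Matrix.Norms.L2Operator

variable {T : ℕ} {γ α C : ℝ} {η : ℕ → ℝ} {Ω : ℕ → Type*} [∀ k, MeasurableSpace (Ω k)]
  {Pr : ∀ k, Measure (Ω k)} (s : LearningSequence T γ α C η Pr)

/-- Normalized quadratic forms of the weight deviation converge to their theoretical values. -/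
def QuadFormConverges (n : ℕ) : Prop :=
  ∀ (K : ℝ) (G : ∀ k, Matrix (Fin (s.N k)) (Fin (s.N k)) ℝ), (∀ k, ‖G k‖ ≤ K) →
    TendstoL1 Pr fun k ω => 1 / (s.N k : ℝ) * (s.dev k n ω ⬝ᵥ G k *ᵥ s.dev k n ω)
      - 1 / (s.N k : ℝ) * (G k * s.cov k n).trace

theorem eventually_pos : ∀ᶠ k in atTop, 0 < s.N k ∧ 0 < s.B k :=
  (s.tendsto_N.eventually_gt_atTop 0).and (s.tendsto_B.eventually_gt_atTop 0)

theorem tendsto_inv_ratio :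
    Tendsto (fun k => (s.N k : ℝ) / (s.B k : ℝ)) atTop (𝓝 α⁻¹) := by
  simpa only [inv_div] using s.tendsto_ratio.inv₀ s.α_pos.ne'

theorem norm_one_le {N : ℕ} : ‖(1 : Matrix (Fin N) (Fin N) ℝ)‖ ≤ 1 :=
  norm_le_of_mulVec_dotProduct_self_le zero_le_one fun v => by simp

section Consequences

variable {s} {n : ℕ}

theorem QuadFormConverges.exists_integral_le (hs : s.QuadFormConverges n) : ∃ d, 0 ≤ d ∧
    ∀ᶠ k in atTop, ∫ ω, 1 / (s.N k : ℝ) * (s.dev k n ω ⬝ᵥ s.dev k n ω) ∂(Pr k) ≤ d := by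
  obtain ⟨b, hb0, hb⟩ := s.exists_cov_le n
  have h := (hs 1 (fun k => 1) fun k => norm_one_le).tendsto_integral
  refine ⟨1 + b, by positivity, ?_⟩
  filter_upwards [h.eventually_le_const zero_lt_one] with k hk
  have := s.prob k
  have hq := s.allMoments_quadForm k n 1
  rw [integral_sub hq.integrable (integrable_const _)] at hk
  simp only [one_mulVec, one_mul, integral_const, probReal_univ, one_smul] at hk
  have h2 := (abs_le.1 (abs_inv_mul_trace_le (s.cov k n))).2
  have h3 := hb k
  linarith

/-- The power of the TD errors grows at most quadratically in the deviation, whose normalized square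
has bounded expectation. -/
theorem QuadFormConverges.exists_integral_tdPower_le (hs : s.QuadFormConverges n) : ∃ q, 0 ≤ q ∧
    ∀ᶠ k in atTop, ∫ ω, tdPower (s.P k) γ (s.wR k) (s.w k n ω) ∂(Pr k) ≤ q := by
  obtain ⟨q, hq0, hq⟩ := s.exists_tdPower_mean_le n
  obtain ⟨d, hd0, hd⟩ := hs.exists_integral_le
  have hC0 := s.C_nonneg
  refine ⟨2 * q + T * (2 * ((2 * γ ^ 2 + 2) * C)) * d, by positivity, ?_⟩
  filter_upwards [hd] with k hk
  have := s.prob k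
  have hz := (AllMoments.const (μ := Pr k) (1 / (s.N k : ℝ))).mul
    ((s.allMoments_dev k n).dotProduct (s.allMoments_dev k n))
  calc _ ≤ ∫ ω, (2 * q + T * (2 * ((2 * γ ^ 2 + 2) * C)) *
        (1 / (s.N k : ℝ) * (s.dev k n ω ⬝ᵥ s.dev k n ω))) ∂(Pr k) := by
        refine integral_mono (s.allMoments_tdPower k n).integrable
          ((AllMoments.const _).add ((AllMoments.const _).mul hz)).integrable fun ω => ?_
        have h := tdPower_add_le (γ := γ) (s.integral_sq_dotProduct_le k) (s.wR k) (s.mean k n)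
          (s.dev k n ω)
        rw [dev, add_sub_cancel] at h
        refine h.trans ?_
        gcongr
        · exact hq k
        · rfl
    _ = 2 * q + T * (2 * ((2 * γ ^ 2 + 2) * C)) *
        ∫ ω, 1 / (s.N k : ℝ) * (s.dev k n ω ⬝ᵥ s.dev k n ω) ∂(Pr k) := by
        rw [integral_add (integrable_const _) ((AllMoments.const _).mul hz).integrable,
          integral_const (2 * q), integral_const_mul, probReal_univ, one_smul]
    _ ≤ _ := by gcongr

/-- The square of the normalized linear form is the normalized quadratic form with matrix `a aᵀ /
N`, an admissible test matrix. Its predicted value `aᵀ W_n a / N²` is `O(1/N)`, because `W_n` is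
bounded in norm, so the second moment tends to zero. -/
theorem QuadFormConverges.tendstoL1_dotProduct (hs : s.QuadFormConverges n)
    {a : ∀ k, Fin (s.N k) → ℝ} {c : ℝ} (ha : ∀ k, a k ⬝ᵥ a k ≤ c * s.N k) (hc : 0 ≤ c) :
    TendstoL1 Pr fun k ω => 1 / (s.N k : ℝ) * (a k ⬝ᵥ s.dev k n ω) := by
  have hm : ∀ k, AllMoments (fun ω => 1 / (s.N k : ℝ) * (a k ⬝ᵥ s.dev k n ω)) (Pr k) := fun k =>
    have := s.prob k
    (AllMoments.const _).mul ((AllMoments.const _).dotProduct (s.allMoments_dev k n))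
  refine ⟨Eventually.of_forall hm, ?_⟩
  obtain ⟨b, hb0, hb⟩ := s.exists_cov_le n
  set G : ∀ k, Matrix (Fin (s.N k)) (Fin (s.N k)) ℝ := fun k =>
    (1 / (s.N k : ℝ)) • vecMulVec (a k) (a k) with hG
  have hGn : ∀ k, ‖G k‖ ≤ c := fun k => by
    rw [hG, norm_smul, Real.norm_of_nonneg (by positivity)]
    calc _ ≤ 1 / (s.N k : ℝ) * (c * s.N k) := by
          gcongr; exact (norm_vecMulVec_self_le _).trans (ha k)
      _ = c * (s.N k / s.N k : ℝ) := by ring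
      _ ≤ c * 1 := by gcongr; exact div_self_le_one _
      _ = c := mul_one c
  have hG2 : ∀ k (v : Fin (s.N k) → ℝ), v ⬝ᵥ G k *ᵥ v = 1 / (s.N k : ℝ) * (a k ⬝ᵥ v) ^ 2 := by
    intro k v
    simp only [hG, smul_mulVec, vecMulVec_mulVec, dotProduct_smul, smul_eq_mul,
      dotProduct_comm v (a k), op_smul_eq_smul]
    ring
  have htr : ∀ k, 1 / (s.N k : ℝ) * (G k * s.cov k n).trace
      ≤ b * c * (1 / (s.N k : ℝ)) := fun k => by
    have e : (G k * s.cov k n).trace = 1 / (s.N k : ℝ) * (a k ⬝ᵥ s.cov k n *ᵥ a k) := by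
      rw [hG, smul_mul_assoc, trace_smul, trace_mul_comm, trace_mul_vecMulVec, smul_eq_mul]
    rw [e]
    have h1 := (le_abs_self _).trans (abs_dotProduct_mulVec_self_le (s.cov k n) (a k))
    calc _ ≤ 1 / (s.N k : ℝ) * (1 / (s.N k : ℝ) * (b * (c * s.N k))) := by
          gcongr
          refine h1.trans ?_
          gcongr
          · exact dotProduct_self_nonneg' _
          · exact hb k
          · exact ha k
      _ = b * c * (1 / (s.N k : ℝ)) * (s.N k / s.N k : ℝ) := by ring
      _ ≤ b * c * (1 / (s.N k : ℝ)) * 1 := by gcongr; exact div_self_le_one _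
      _ = _ := mul_one _
  have hint := (hs c G hGn).tendsto_integral
  have hNi : Tendsto (fun k => 1 / (s.N k : ℝ)) atTop (𝓝 0) := by
    simp only [one_div]
    exact tendsto_inv_atTop_zero.comp (tendsto_natCast_atTop_atTop.comp s.tendsto_N)
  have hlim := (hint.add (hNi.const_mul (b * c))).sqrt
  rw [mul_zero, add_zero, Real.sqrt_zero] at hlim
  refine squeeze_zero (fun k => integral_nonneg fun ω => abs_nonneg _) (fun k => ?_) hlim
  have := s.prob k
  refine integral_abs_le_sqrt (hm k) ?_
  rw [integral_sub (s.allMoments_quadForm k n (G k)).integrable (integrable_const _)]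
  simp only [integral_const, probReal_univ, one_smul]
  have e : ∀ ω, (1 / (s.N k : ℝ) * (a k ⬝ᵥ s.dev k n ω)) ^ 2
      = 1 / (s.N k : ℝ) * (s.dev k n ω ⬝ᵥ G k *ᵥ s.dev k n ω) := fun ω => by
    rw [hG2]; ring
  simp_rw [e]
  have := htr k
  linarith

/-- In the exact expansion about the mean weights, the linear term vanishes in the limit and the
quadratic term, with the bounded matrix `tdForm`, converges by hypothesis. -/
theorem QuadFormConverges.tendstoL1_tdCorr (hs : s.QuadFormConverges n) (t t' : Fin T) :
    TendstoL1 Pr fun k ω => tdCorr (s.P k) γ (s.wR k) (s.w k n ω) t t' - s.theory k n t t' := by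
  obtain ⟨q, hq0, hq⟩ := s.exists_tdPower_mean_le n
  have hC0 := s.C_nonneg
  have hcross : ∀ k t t', tdCross (s.P k) γ (s.wR k) (s.mean k n) t t' ⬝ᵥ
      tdCross (s.P k) γ (s.wR k) (s.mean k n) t t' ≤ (2 * γ ^ 2 + 2) * C * q := fun k t t' => by
    refine (tdCross_dotProduct_self_le hC0 (s.integral_sq_dotProduct_le k) _ _ t t').trans ?_
    gcongr
    exact hq k
  have h1 := hs.tendstoL1_dotProduct (a := fun k => √(s.N k : ℝ) •
      (tdCross (s.P k) γ (s.wR k) (s.mean k n) t t'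
        + tdCross (s.P k) γ (s.wR k) (s.mean k n) t' t))
    (c := 4 * ((2 * γ ^ 2 + 2) * C * q)) (fun k => by
      simp only [smul_dotProduct, dotProduct_smul, smul_eq_mul]
      rw [← mul_assoc, Real.mul_self_sqrt (by positivity), mul_comm]
      gcongr
      set u := tdCross (s.P k) γ (s.wR k) (s.mean k n) t t'
      set v := tdCross (s.P k) γ (s.wR k) (s.mean k n) t' t
      have e1 := dotProduct_self_nonneg' (u - v)
      have e2 := hcross k t t'
      have e3 := hcross k t' t
      simp only [add_dotProduct, dotProduct_add, sub_dotProduct, dotProduct_sub] at e1 ⊢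
      linarith) (by positivity)
  have h2 := hs ((1 + |γ|) ^ 2 * C) (fun k => tdForm γ (corr (s.P k)) t t') fun k =>
    norm_tdForm_le hC0 (s.integral_sq_dotProduct_le k) t t'
  refine (h1.add h2).congr (Eventually.of_forall fun k ω => ?_)
  have e : s.w k n ω = s.mean k n + s.dev k n ω := (add_sub_cancel _ _).symm
  rw [e, tdCorr_add, theory, theoryQ_eq, trace_mul_comm]
  simp only [mean, cov]
  ring

end Consequences

end LearningSequence

/-! ### The induction on the learning step -/

namespace LearningSequence

open scoped Matrix.Norms.L2Operator

variable {T : ℕ} {γ α C : ℝ} {η : ℕ → ℝ} {Ω : ℕ → Type*} [∀ k, MeasurableSpace (Ω k)]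
  {Pr : ∀ k, Measure (Ω k)} {s : LearningSequence T γ α C η Pr} {n : ℕ}

theorem QuadFormConverges.tendstoL1_cross (hs : s.QuadFormConverges n) {K : ℝ}
    {D : ∀ k, Matrix (Fin (s.N k)) (Fin (s.N k)) ℝ} (hD : ∀ k, ‖D k‖ ≤ K) :
    TendstoL1 Pr fun k ω => 1 / (s.N k : ℝ) * ((D k *ᵥ s.dev k n ω) ⬝ᵥ s.noise k n ω) := by
  obtain ⟨d, hd0, hd⟩ := hs.exists_integral_le
  obtain ⟨q, hq0, hq⟩ := hs.exists_integral_tdPower_le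
  refine ⟨s.eventually_pos.mono fun k hk => ?_, ?_⟩
  · have := s.prob k
    exact (AllMoments.const _).mul (((s.allMoments_dev k n).mulVec _).dotProduct
      (s.allMoments_noise k n hk.2))
  have h1 : Tendsto (fun k => √(η n ^ 2 * gaussianConst * C * ((s.N k : ℝ) / s.B k))
      / 2 * (√(s.N k : ℝ))⁻¹ * (q + K ^ 2 * d)) atTop
      (𝓝 (√(η n ^ 2 * gaussianConst * C * α⁻¹) / 2 * 0 * (q + K ^ 2 * d))) :=
    (((s.tendsto_inv_ratio.const_mul _).sqrt.div_const 2).mul (tendsto_inv_atTop_zero.comp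
      (Real.tendsto_sqrt_atTop.comp (tendsto_natCast_atTop_atTop.comp s.tendsto_N)))).mul_const _
  rw [mul_zero, zero_mul] at h1
  refine squeeze_zero' (Eventually.of_forall fun k => integral_nonneg fun ω => abs_nonneg _) ?_ h1
  filter_upwards [s.eventually_pos, hd, hq] with k hk hd hq
  refine (s.integral_abs_cross_le k n hk.2 (D k)).trans ?_
  calc _ ≤ √(η n ^ 2 * gaussianConst * C * ((s.N k : ℝ) / s.B k)) / (2 * √(s.N k : ℝ))
        * (q + K ^ 2 * d) := by
        refine mul_le_mul_of_nonneg_left (add_le_add hq (mul_le_mul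
          (pow_le_pow_left₀ (norm_nonneg _) (hD k) 2) hd (integral_nonneg fun ω =>
            mul_nonneg (by positivity) (dotProduct_self_nonneg' _)) (by positivity)))
          (by positivity)
    _ = _ := by rw [mul_comm 2, ← div_div]; ring

theorem QuadFormConverges.tendstoL1_noise (hs : s.QuadFormConverges n) {K : ℝ}
    {G : ∀ k, Matrix (Fin (s.N k)) (Fin (s.N k)) ℝ} (hG : ∀ k, ‖G k‖ ≤ K) :
    TendstoL1 Pr fun k ω => 1 / (s.N k : ℝ) * (s.noise k n ω ⬝ᵥ G k *ᵥ s.noise k n ω)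
        - η n ^ 2 / T ^ 2 * (s.N k / s.B k) * ∑ t : Fin T, ∑ t' : Fin T,
          tdCorr (s.P k) γ (s.wR k) (s.w k n ω) t t'
            * (1 / (s.N k : ℝ) * (G k * corr (s.P k) t.castSucc t'.castSucc).trace) := by
  obtain ⟨q, hq0, hq⟩ := hs.exists_integral_tdPower_le
  have hC0 := s.C_nonneg
  have hκ := one_le_gaussianConst
  have hK0 : 0 ≤ K := (norm_nonneg _).trans (hG 0)
  refine ⟨s.eventually_pos.mono fun k hk => ?_, ?_⟩
  · have := s.prob k
    have hn := s.allMoments_noise k n hk.2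
    exact ((AllMoments.const _).mul (hn.dotProduct (hn.mulVec (G k)))).sub
      ((AllMoments.const _).mul (AllMoments.sum fun t => AllMoments.sum fun t' =>
        (s.allMoments_tdCorr k n t t').mul (AllMoments.const _)))
  have h1 := ((tendsto_noiseRate s.tendsto_B s.tendsto_inv_ratio).const_mul
    (η n ^ 2 * gaussianConst * C * K)).mul_const q
  rw [mul_zero, zero_mul] at h1
  refine squeeze_zero' (Eventually.of_forall fun k => integral_nonneg fun ω => abs_nonneg _) ?_ h1
  filter_upwards [s.eventually_pos, hq] with k hk hq
  refine (s.integral_abs_noise_quadForm_sub_le k n hk.1 hk.2 (G k)).trans ?_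
  have hr := noiseRate_nonneg (N := s.N k) (B := s.B k) (by positivity)
  have hp : 0 ≤ ∫ ω, tdPower (s.P k) γ (s.wR k) (s.w k n ω) ∂(Pr k) :=
    integral_nonneg fun ω => tdPower_nonneg
  gcongr
  exact hG k

/-- The limit `N/B → 1/α` may be inserted because the theoretical correlation stays bounded. -/
theorem QuadFormConverges.tendstoL1_ratio_mul_tdCorr (hs : s.QuadFormConverges n)
    (t t' : Fin T) :
    TendstoL1 Pr fun k ω => s.N k / s.B k * tdCorr (s.P k) γ (s.wR k) (s.w k n ω) t t'
      - s.theory k n t t' / α := by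
  have := s.prob
  obtain ⟨c, hc0, hc⟩ := s.exists_theory_le n
  have hr := s.tendsto_inv_ratio
  have h1 := (hs.tendstoL1_tdCorr t t').const_mul
    (hr.abs.eventually_le_const (lt_add_one _))
  have h2 : Tendsto (fun k => ((s.N k : ℝ) / s.B k - α⁻¹) * s.theory k n t t') atTop (𝓝 0) := by
    have h3 : Tendsto (fun k => |(s.N k : ℝ) / s.B k - α⁻¹| * c) atTop (𝓝 0) := by
      have := ((hr.sub_const α⁻¹).abs).mul_const c
      simpa using this
    refine squeeze_zero_norm (fun k => ?_) h3
    rw [norm_mul, Real.norm_eq_abs, Real.norm_eq_abs]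
    gcongr
    exact hc k t t'
  refine (h1.add (TendstoL1.const h2)).congr (Eventually.of_forall fun k ω => ?_)
  ring

/-- `G` need not be symmetric; `G + Gᵀ` collects the two cross terms into a single pairing of the
noise with a vector known before the step. -/
theorem quadForm_dev_succ (k : ℕ) (hB : 0 < s.B k) (G : Matrix (Fin (s.N k)) (Fin (s.N k)) ℝ)
    (ω : Ω k) :
    s.dev k (n + 1) ω ⬝ᵥ G *ᵥ s.dev k (n + 1) ω
      = s.dev k n ω ⬝ᵥ ((s.step k n)ᵀ * G * s.step k n) *ᵥ s.dev k n ω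
        + (((G + Gᵀ) * s.step k n) *ᵥ s.dev k n ω) ⬝ᵥ s.noise k n ω
        + s.noise k n ω ⬝ᵥ G *ᵥ s.noise k n ω := by
  rw [s.dev_succ k n hB]
  simp only [← mulVec_mulVec, mulVec_add, dotProduct_add, add_dotProduct, add_mulVec,
    dotProduct_transpose_mulVec]
  rw [dotProduct_comm (G *ᵥ (s.step k n *ᵥ s.dev k n ω)) (s.noise k n ω),
    dotProduct_comm (Gᵀ *ᵥ (s.step k n *ᵥ s.dev k n ω)), dotProduct_transpose_mulVec,
    dotProduct_comm (G *ᵥ (s.step k n *ᵥ s.dev k n ω)) (s.step k n *ᵥ s.dev k n ω)]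
  ring

theorem trace_mul_cov_succ (k : ℕ) (G : Matrix (Fin (s.N k)) (Fin (s.N k)) ℝ) :
    (G * s.cov k (n + 1)).trace = ((s.step k n)ᵀ * G * s.step k n * s.cov k n).trace
      + η n ^ 2 / (α * (T : ℝ) ^ 2) * ∑ t : Fin T, ∑ t' : Fin T,
        s.theory k n t t' * (G * corr (s.P k) t.castSucc t'.castSucc).trace := by
  rw [cov_succ, mul_add, trace_add, mul_smul_comm, trace_smul, smul_eq_mul]
  congr 1
  · rw [← mul_assoc, ← mul_assoc, trace_mul_comm, ← mul_assoc, ← mul_assoc]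
  · simp only [Finset.mul_sum, trace_sum, mul_smul_comm, trace_smul, smul_eq_mul]

-- The induction has to treat all bounded test families simultaneously, since the propagator changes
-- `G` into `Lᵀ G L`. The four summands `h1`, `h2`, `h3`, `h5` are the propagated form, the cross
-- term, the centered noise form, and the replacement of the conditional TD-error correlation by its
-- theoretical value.
variable (s) in
theorem quadFormConverges (n : ℕ) : s.QuadFormConverges n := by
  have := s.prob
  have hC0 := s.C_nonneg
  induction n with
  | zero =>
    intro K G _
    refine TendstoL1.zero.congr (Eventually.of_forall fun k ω => ?_)
    simp [dev_zero, cov_zero]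
  | succ n hs =>
    intro K G hG
    have hK0 : 0 ≤ K := (norm_nonneg _).trans (hG 0)
    set l := 1 + |η n| * (C + |γ| * C) with hl
    have hl0 : 0 ≤ l := by positivity
    have h1 := hs (l * K * l) (fun k => (s.step k n)ᵀ * G k * s.step k n) fun k => by
      have h0 := s.norm_step_le k n
      refine (norm_mul_le _ _).trans (mul_le_mul ((norm_mul_le _ _).trans
        (mul_le_mul ?_ (hG k) (norm_nonneg _) hl0)) h0 (norm_nonneg _) (by positivity))
      rwa [norm_transpose_eq]
    have h2 := hs.tendstoL1_cross (K := (K + K) * l)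
      (D := fun k => (G k + (G k)ᵀ) * s.step k n) fun k => by
        refine (norm_mul_le _ _).trans (mul_le_mul ((norm_add_le _ _).trans (add_le_add (hG k) ?_))
          (s.norm_step_le k n) (norm_nonneg _) (by positivity))
        rw [norm_transpose_eq]
        exact hG k
    have h3 := hs.tendstoL1_noise hG
    -- The trace coefficients are bounded uniformly in `N`, so convergence of the correlations
    -- survives multiplication by them.
    have h4 : ∀ t t' : Fin T, TendstoL1 Pr fun k ω =>
        (1 / (s.N k : ℝ) * (G k * corr (s.P k) t.castSucc t'.castSucc).trace)
          * (s.N k / s.B k * tdCorr (s.P k) γ (s.wR k) (s.w k n ω) t t'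
            - s.theory k n t t' / α) := fun t t' =>
      (hs.tendstoL1_ratio_mul_tdCorr t t').const_mul (K := K * C) (Eventually.of_forall fun k =>
        (abs_inv_mul_trace_le _).trans ((norm_mul_le _ _).trans (mul_le_mul (hG k)
          (norm_corr_le hC0 (s.integral_sq_dotProduct_le k) _ _) (norm_nonneg _) hK0)))
    have h5 := (TendstoL1.sum Finset.univ fun t => TendstoL1.sum Finset.univ fun t' =>
      h4 t t').const_mul (c := fun _ => η n ^ 2 / (T : ℝ) ^ 2) (Eventually.of_forall fun _ => le_rfl)
    refine (((h1.add h2).add h3).add h5).congr (s.eventually_pos.mono fun k hk ω => ?_)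
    rw [quadForm_dev_succ k hk.2, trace_mul_cov_succ]
    simp only [mul_sub, Finset.sum_sub_distrib, Finset.mul_sum, mul_add]
    have e1 : ∀ t t' : Fin T, η n ^ 2 / (T : ℝ) ^ 2 * ((1 / (s.N k : ℝ) *
        (G k * corr (s.P k) t.castSucc t'.castSucc).trace) *
          (s.N k / s.B k * tdCorr (s.P k) γ (s.wR k) (s.w k n ω) t t'))
        = η n ^ 2 / T ^ 2 * (s.N k / s.B k) * (tdCorr (s.P k) γ (s.wR k) (s.w k n ω) t t'
            * (1 / (s.N k : ℝ) * (G k * corr (s.P k) t.castSucc t'.castSucc).trace)) :=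
      fun t t' => by ring
    have e2 : ∀ t t' : Fin T, η n ^ 2 / (T : ℝ) ^ 2 * ((1 / (s.N k : ℝ) *
        (G k * corr (s.P k) t.castSucc t'.castSucc).trace) * (s.theory k n t t' / α))
        = 1 / (s.N k : ℝ) * (η n ^ 2 / (α * (T : ℝ) ^ 2) * (s.theory k n t t' *
          (G k * corr (s.P k) t.castSucc t'.castSucc).trace)) := fun t t' => by
      field_simp
    simp only [e1, e2]
    ring

end LearningSequence

/-! ### Value error, weight-error moments and batch averages of TD errors -/

namespace LearningSequence

open scoped Matrix.Norms.L2Operator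

variable {T : ℕ} {γ α C : ℝ} {η : ℕ → ℝ} {Ω : ℕ → Type*} [∀ k, MeasurableSpace (Ω k)]
  {Pr : ∀ k, Measure (Ω k)} (s : LearningSequence T γ α C η Pr)

theorem valueError_eq {N T : ℕ} (P : Measure (Fin (T + 1) → Fin N → ℝ)) [IsGaussian P]
    (wTD w : Fin N → ℝ) :
    valueError P wTD w = 1 / (N : ℝ) * ((wTD - w) ⬝ᵥ sigmaBar (corr P) *ᵥ (wTD - w)) := by
  have h : ∀ t : Fin T, ∫ x, (readout wTD (x t.castSucc) - readout w (x t.castSucc)) ^ 2 ∂P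
      = 1 / (N : ℝ) * ((wTD - w) ⬝ᵥ corr P t.castSucc t.castSucc *ᵥ (wTD - w)) := fun t => by
    rw [← integral_sq_readout]
    simp only [readout, sub_dotProduct, sub_div]
  simp only [valueError, h, sigmaBar, smul_mulVec, sum_mulVec, dotProduct_smul, dotProduct_sum,
    smul_eq_mul, Finset.mul_sum]
  exact Finset.sum_congr rfl fun t _ => by ring

/-- This is `Σ² ≤ C Σ` for `0 ≤ Σ ≤ C`. It converts a bound on outputs, that is on `eᵀ Σ e`, into a
bound on the length of `Σ e` when `e` itself may be arbitrarily long. -/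
theorem corr_mulVec_dotProduct_self_le {N T : ℕ} {P : Measure (Fin (T + 1) → Fin N → ℝ)}
    [IsGaussian P] {C : ℝ} (hC0 : 0 ≤ C)
    (hC : ∀ (t : Fin (T + 1)) (v : Fin N → ℝ), ∫ x, (v ⬝ᵥ x t) ^ 2 ∂P ≤ C * (v ⬝ᵥ v))
    (t : Fin (T + 1)) (v : Fin N → ℝ) :
    (corr P t t *ᵥ v) ⬝ᵥ (corr P t t *ᵥ v) ≤ C * (v ⬝ᵥ corr P t t *ᵥ v) := by
  set c := corr P t t *ᵥ v with hc
  have hm : ∀ u, AllMoments (fun x : Fin (T + 1) → Fin N → ℝ => u ⬝ᵥ x t) P := fun u =>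
    (AllMoments.const u).dotProduct (allMoments_episode P t)
  have hv : 0 ≤ v ⬝ᵥ c := by
    rw [hc, dotProduct_corr_mulVec]
    exact integral_nonneg fun x => mul_self_nonneg _
  rcases (dotProduct_self_nonneg' c).eq_or_lt with h0 | h0
  · rw [← h0]; positivity
  · refine le_of_mul_le_mul_right ?_ h0
    have h1 := sq_integral_mul_le (hm c) (hm v)
    rw [← dotProduct_corr_mulVec, ← dotProduct_corr_mulVec P t t v v, ← hc] at h1
    have h2 := hC t c
    simp only [sq] at h2
    calc (c ⬝ᵥ c) * (c ⬝ᵥ c) = (c ⬝ᵥ c) ^ 2 := by ring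
      _ ≤ _ := h1
      _ ≤ C * (c ⬝ᵥ c) * (v ⬝ᵥ c) := by gcongr
      _ = _ := by ring

theorem exists_sigmaBar_mulVec_le (n : ℕ) : ∃ c, 0 ≤ c ∧ ∀ k,
    (sigmaBar (corr (s.P k)) *ᵥ (s.mean k n - s.wTD k)) ⬝ᵥ
      (sigmaBar (corr (s.P k)) *ᵥ (s.mean k n - s.wTD k)) ≤ c * s.N k := by
  obtain ⟨D, hD⟩ := s.exists_readout_mean_le n
  have hC0 := s.C_nonneg
  have hT := s.T_pos
  have hD0 : 0 ≤ D := (integral_nonneg fun _ => sq_nonneg _).trans (hD 0 0)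
  refine ⟨C * (2 * D + 2 * C), by positivity, fun k => ?_⟩
  set e := s.mean k n - s.wTD k with he
  have h1 : ∀ t : Fin T, e ⬝ᵥ corr (s.P k) t.castSucc t.castSucc *ᵥ e
      ≤ (2 * D + 2 * C) * s.N k := fun t => by
    have h2 : ∫ x, readout e (x t.castSucc) ^ 2 ∂(s.P k) ≤ 2 * D + 2 * C := by
      have i1 := (AllMoments.const (μ := s.P k) (2 : ℝ)).mul
        ((allMoments_readout (s.P k) (s.mean k n) t.castSucc).pow 2)
      have i2 := (AllMoments.const (μ := s.P k) (2 : ℝ)).mul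
        ((allMoments_readout (s.P k) (s.wTD k) t.castSucc).pow 2)
      calc _ ≤ ∫ x, (2 * readout (s.mean k n) (x t.castSucc) ^ 2
            + 2 * readout (s.wTD k) (x t.castSucc) ^ 2) ∂(s.P k) := by
            refine integral_mono ((allMoments_readout _ _ _).pow 2).integrable
              (i1.add i2).integrable fun x => ?_
            simp only [he, readout, sub_dotProduct, sub_div]
            nlinarith [sq_nonneg (s.mean k n ⬝ᵥ x t.castSucc / √(s.N k : ℝ)
              + s.wTD k ⬝ᵥ x t.castSucc / √(s.N k : ℝ))]
        _ ≤ _ := by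
            rw [integral_add i1.integrable i2.integrable, integral_const_mul, integral_const_mul]
            have := hD k t.castSucc
            have := s.value_le k t
            linarith
    rw [integral_sq_readout] at h2
    -- For `N = 0` the factor `1 / N` is zero and `h2` carries no information, but both sides of the
    -- goal vanish.
    rcases Nat.eq_zero_or_pos (s.N k) with h0 | h0
    · have : IsEmpty (Fin (s.N k)) := by rw [h0]; infer_instance
      simp [dotProduct, h0]
    · have : (0 : ℝ) < s.N k := by exact_mod_cast h0
      rwa [one_div, inv_mul_le_iff₀ this, mul_comm] at h2
  have hcs : ∀ t t' : Fin T, (corr (s.P k) t.castSucc t.castSucc *ᵥ e) ⬝ᵥ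
      (corr (s.P k) t'.castSucc t'.castSucc *ᵥ e) ≤ C * (2 * D + 2 * C) * s.N k := fun t t' => by
    have hk : ∀ t : Fin T, (corr (s.P k) t.castSucc t.castSucc *ᵥ e) ⬝ᵥ
        (corr (s.P k) t.castSucc t.castSucc *ᵥ e) ≤ C * (2 * D + 2 * C) * s.N k := fun t => by
      refine (corr_mulVec_dotProduct_self_le hC0 (s.integral_sq_dotProduct_le k) _ _).trans ?_
      rw [mul_assoc]
      gcongr
      exact h1 t
    set u := corr (s.P k) t.castSucc t.castSucc *ᵥ e with hu
    set v := corr (s.P k) t'.castSucc t'.castSucc *ᵥ e with hv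
    have h0 := dotProduct_self_nonneg' (u - v)
    simp only [sub_dotProduct, dotProduct_sub] at h0
    rw [dotProduct_comm v u] at h0
    have := hk t
    have := hk t'
    linarith
  simp only [sigmaBar, smul_mulVec, sum_mulVec, dotProduct_smul, smul_dotProduct, smul_eq_mul,
    dotProduct_sum, sum_dotProduct, ← Finset.mul_sum]
  have hT' : (T : ℝ) ≠ 0 := by positivity
  calc _ ≤ 1 / (T : ℝ) * (1 / T * ∑ _t : Fin T, ∑ _t' : Fin T,
        C * (2 * D + 2 * C) * s.N k) := by
        gcongr with t _ t' _
        exact hcs _ _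
    _ = _ := by
        simp only [Finset.sum_const, Finset.card_univ, Fintype.card_fin, nsmul_eq_mul]
        field_simp

/-- The theoretical second moment of the weight error. -/
def errorMoment (k n : ℕ) : Matrix (Fin (s.N k)) (Fin (s.N k)) ℝ :=
  errorCov γ α η (corr (s.P k)) (s.wR k) (s.wTD k) (s.w0 k) n

theorem errorMoment_eq (k n : ℕ) : s.errorMoment k n = s.cov k n
    + vecMulVec (s.mean k n - s.wTD k) (s.mean k n - s.wTD k) := errorCov_eq n

/-- With `w_n - w_TD = z_n + e` and `e = m_n - w_TD` deterministic, the form in `z_n` converges, the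
form in `e` is exactly the rank-one part of `M_n`, and the cross term is linear in `z_n` with
coefficient `Σ̄ e` of squared length `O(N)`. -/
theorem tendstoL1_valueError (n : ℕ) : TendstoL1 Pr fun k ω =>
    valueError (s.P k) (s.wTD k) (s.w k n ω)
      - 1 / (s.N k : ℝ) * (sigmaBar (corr (s.P k)) * s.errorMoment k n).trace := by
  have := s.prob
  obtain ⟨c, hc0, hc⟩ := s.exists_sigmaBar_mulVec_le n
  have h1 := s.quadFormConverges n C (fun k => sigmaBar (corr (s.P k))) fun k =>
    norm_sigmaBar_le s.C_nonneg (s.integral_sq_dotProduct_le k)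
  have h2 := ((s.quadFormConverges n).tendstoL1_dotProduct hc hc0).const_mul (c := fun _ => 2)
    (Eventually.of_forall fun _ => le_rfl)
  refine (h1.add h2).congr (Eventually.of_forall fun k ω => ?_)
  have hsym : (sigmaBar (corr (s.P k)))ᵀ = sigmaBar (corr (s.P k)) := by
    simp only [sigmaBar, transpose_smul, transpose_sum, corr_transpose]
  have e : s.wTD k - s.w k n ω = -(s.dev k n ω + (s.mean k n - s.wTD k)) := by
    rw [dev]; abel
  have e2 := dotProduct_transpose_mulVec (sigmaBar (corr (s.P k))) (s.mean k n - s.wTD k)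
    (s.dev k n ω)
  rw [hsym] at e2
  rw [valueError_eq, e, errorMoment_eq, mul_add, trace_add, trace_mul_vecMulVec]
  simp only [mulVec_neg, neg_dotProduct_neg]
  generalize s.mean k n - s.wTD k = m at *
  rw [mulVec_add, dotProduct_add, add_dotProduct, add_dotProduct, e2,
    dotProduct_comm (sigmaBar (corr (s.P k)) *ᵥ m)]
  ring

theorem integral_dev_eq_zero (k n : ℕ) (hB : 0 < s.B k) (i : Fin (s.N k)) :
    ∫ ω, s.dev k n ω i ∂(Pr k) = 0 := by
  have := s.prob k
  simp only [dev, Pi.sub_apply]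
  rw [integral_sub ((s.allMoments_w k n).eval i).integrable (integrable_const _)]
  simp only [integral_const, probReal_univ, one_smul]
  exact sub_eq_zero.2 (integral_iterate_eq_meanWeights hB (s.hasLaw k) (s.indep k)
    (s.fixedPoint k) n i)

theorem allMoments_error (k n : ℕ) (i : Fin (s.N k)) :
    AllMoments (fun ω => s.w k n ω i - s.wTD k i) (Pr k) :=
  have := s.prob k
  ((s.allMoments_w k n).eval i).sub (AllMoments.const _)

theorem integral_error_mul (k n : ℕ) (hB : 0 < s.B k) (i j : Fin (s.N k)) :
    ∫ ω, (s.w k n ω i - s.wTD k i) * (s.w k n ω j - s.wTD k j) ∂(Pr k)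
      = ∫ ω, s.dev k n ω i * s.dev k n ω j ∂(Pr k)
        + (s.mean k n - s.wTD k) i * (s.mean k n - s.wTD k) j := by
  have := s.prob k
  have hd := fun i => (s.allMoments_dev k n).eval i
  have e : ∀ ω, (s.w k n ω i - s.wTD k i) * (s.w k n ω j - s.wTD k j)
      = s.dev k n ω i * s.dev k n ω j + (s.mean k n - s.wTD k) j * s.dev k n ω i
        + (s.mean k n - s.wTD k) i * s.dev k n ω j
        + (s.mean k n - s.wTD k) i * (s.mean k n - s.wTD k) j := fun ω => by
    simp only [dev, Pi.sub_apply]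
    ring
  have i1 := (hd i).mul (hd j)
  have i2 := fun c i => (AllMoments.const (μ := Pr k) c).mul (hd i)
  simp_rw [e]
  rw [integral_add ((i1.add (i2 _ i)).add (i2 _ j)).integrable (integrable_const _),
    integral_add (i1.add (i2 _ i)).integrable (i2 _ j).integrable,
    integral_add i1.integrable (i2 _ i).integrable, integral_const_mul, integral_const_mul,
    s.integral_dev_eq_zero k n hB, s.integral_dev_eq_zero k n hB]
  simp

theorem trace_mul_of_integral {N : ℕ} {Ω' : Type*} {m : MeasurableSpace Ω'} {μ : Measure Ω'}
    {z : Ω' → Fin N → ℝ} (hz : AllMoments z μ) (G : Matrix (Fin N) (Fin N) ℝ) :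
    (G * Matrix.of fun i j => ∫ ω, z ω i * z ω j ∂μ).trace = ∫ ω, z ω ⬝ᵥ G *ᵥ z ω ∂μ := by
  have hij : ∀ i j, Integrable (fun ω => G i j * (z ω i * z ω j)) μ := fun i j =>
    ((hz.eval i).mul (hz.eval j)).integrable.const_mul _
  have e : ∀ v : Fin N → ℝ, v ⬝ᵥ G *ᵥ v = ∑ i, ∑ j, G i j * (v i * v j) := fun v => by
    simp only [dotProduct, mulVec, Finset.mul_sum]
    exact Finset.sum_congr rfl fun i _ => Finset.sum_congr rfl fun j _ => by ring
  simp_rw [e]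
  rw [integral_finsetSum _ fun i _ => integrable_finsetSum _ fun j _ => hij i j]
  simp_rw [integral_finsetSum Finset.univ fun j _ => hij _ j, integral_const_mul]
  simp only [Matrix.trace, diag_apply, mul_apply, of_apply]
  exact Finset.sum_congr rfl fun i _ => Finset.sum_congr rfl fun j _ => by
    simp only [mul_comm]

theorem tendsto_trace_mul_error (n : ℕ) {K : ℝ} {G : ∀ k, Matrix (Fin (s.N k)) (Fin (s.N k)) ℝ}
    (hG : ∀ k, ‖G k‖ ≤ K) :
    Tendsto (fun k => 1 / (s.N k : ℝ) * (G k * (Matrix.of (fun i j =>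
      ∫ ω, (s.w k n ω i - s.wTD k i) * (s.w k n ω j - s.wTD k j) ∂(Pr k))
        - s.errorMoment k n)).trace) atTop (𝓝 0) := by
  refine (s.quadFormConverges n K G hG).tendsto_integral.congr'
    (s.eventually_pos.mono fun k hk => ?_)
  have := s.prob k
  -- Since the deviation has mean exactly zero, the mean error cancels identically; no bound on its
  -- length is needed.
  have e : Matrix.of (fun i j => ∫ ω, (s.w k n ω i - s.wTD k i) * (s.w k n ω j - s.wTD k j)
        ∂(Pr k)) - s.errorMoment k n
      = Matrix.of (fun i j => ∫ ω, s.dev k n ω i * s.dev k n ω j ∂(Pr k)) - s.cov k n := by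
    ext i j
    rw [errorMoment_eq]
    simp only [Matrix.sub_apply, of_apply, Matrix.add_apply, s.integral_error_mul k n hk.2, vecMulVec_apply]
    ring
  beta_reduce
  rw [e, mul_sub, trace_sub, trace_mul_of_integral (s.allMoments_dev k n),
    integral_sub (s.allMoments_quadForm k n (G k)).integrable (integrable_const _),
    integral_const_mul, integral_const, probReal_univ, one_smul]
  ring

/-- Two limits are combined: the batch average approaches the correlation at the current random
weights as `B → ∞`, and that correlation approaches its theoretical value. -/
theorem tendstoL1_batch (n : ℕ) (t t' : Fin T) : TendstoL1 Pr fun k ω =>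
    1 / (s.B k : ℝ) * ∑ μ, tdError γ (s.wR k) (s.w k n ω) (s.ψ k n μ ω) t
      * tdError γ (s.wR k) (s.w k n ω) (s.ψ k n μ ω) t' - s.theory k n t t' := by
  have := s.prob
  have h1 : TendstoL1 Pr fun k ω =>
      1 / (s.B k : ℝ) * ∑ μ, tdError γ (s.wR k) (s.w k n ω) (s.ψ k n μ ω) t
        * tdError γ (s.wR k) (s.w k n ω) (s.ψ k n μ ω) t'
        - tdCorr (s.P k) γ (s.wR k) (s.w k n ω) t t' := by
    obtain ⟨q, hq0, hq⟩ := (s.quadFormConverges n).exists_integral_tdPower_le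
    have hκ := one_le_gaussianConst
    refine ⟨Eventually.of_forall fun k => ((AllMoments.const _).mul (AllMoments.sum fun μ =>
      (s.allMoments_tdError k n μ t).mul (s.allMoments_tdError k n μ t'))).sub
        (s.allMoments_tdCorr k n t t'), ?_⟩
    have h2 : Tendsto (fun k => gaussianConst * (√(s.B k : ℝ))⁻¹ * q) atTop
        (𝓝 (gaussianConst * 0 * q)) :=
      ((tendsto_inv_atTop_zero.comp (Real.tendsto_sqrt_atTop.comp
        (tendsto_natCast_atTop_atTop.comp s.tendsto_B))).const_mul _).mul_const _
    rw [mul_zero, zero_mul] at h2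
    refine squeeze_zero' (Eventually.of_forall fun k => integral_nonneg fun ω => abs_nonneg _) ?_ h2
    filter_upwards [s.eventually_pos, hq] with k hk hq
    refine (s.integral_abs_batch_sub_le k n hk.2 t t').trans ?_
    rw [div_eq_mul_inv]
    gcongr
  refine (h1.add ((s.quadFormConverges n).tendstoL1_tdCorr t t')).congr
    (Eventually.of_forall fun k ω => ?_)
  ring

theorem eventually_abs_integral_tdError_mul_sub_le (n : ℕ) (t t' : Fin T) {ε : ℝ} (hε : 0 < ε) :
    ∀ᶠ k in atTop, ∀ μ, |∫ ω, tdError γ (s.wR k) (s.w k n ω) (s.ψ k n μ ω) t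
      * tdError γ (s.wR k) (s.w k n ω) (s.ψ k n μ ω) t' ∂(Pr k) - s.theory k n t t'| ≤ ε := by
  have h := ((s.quadFormConverges n).tendstoL1_tdCorr t t').tendsto_integral.abs
  rw [abs_zero] at h
  filter_upwards [h.eventually_le_const hε] with k hk μ
  have := s.prob k
  rw [integral_sub (s.allMoments_tdCorr k n t t').integrable (integrable_const _)] at hk
  simpa [s.integral_tdError_mul k n μ t t'] using hk

end LearningSequence

end TDLearning

end

/-! ### The proposition -/

theorem proposition1
    -- episode length, discount, limiting ratio `B / N`, learning-rate schedule
    (T : ℕ) (hT : 0 < T) (γ α : ℝ) (hα : 0 < α) (η : ℕ → ℝ)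
    -- a sequence of problems in the proportional limit
    (N B : ℕ → ℕ) (hN : Tendsto N atTop atTop) (hB : Tendsto B atTop atTop)
    (hBN : Tendsto (fun k => (B k : ℝ) / (N k : ℝ)) atTop (𝓝 α))
    -- Gaussian law of the features along an episode
    (P : ∀ k, Measure (Fin (T + 1) → Fin (N k) → ℝ)) (hP : ∀ k, IsGaussian (P k))
    -- reward weights, value weights, initial weights
    (wR wTD w0 : ∀ k, Fin (N k) → ℝ)
    (hTD : ∀ k, TDLearning.driftMatrix γ (TDLearning.corr (P k)) *ᵥ wTD k =
      TDLearning.sigmaBar (TDLearning.corr (P k)) *ᵥ wR k)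
    -- everything is of order one
    (C : ℝ)
    (hC : ∀ k (t : Fin (T + 1)) (v : Fin (N k) → ℝ),
      v ⬝ᵥ (TDLearning.corr (P k) t t *ᵥ v) ≤ C * (v ⬝ᵥ v))
    (hR : ∀ k (t : Fin T), ∫ x, TDLearning.readout (wR k) (x t.castSucc) ^ 2 ∂(P k) ≤ C)
    (hV : ∀ k (t : Fin T), ∫ x, TDLearning.readout (wTD k) (x t.castSucc) ^ 2 ∂(P k) ≤ C)
    (h0 : ∀ k (t : Fin (T + 1)), ∫ x, TDLearning.readout (w0 k) (x t) ^ 2 ∂(P k) ≤ C)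
    -- independent episodes with this law
    {Ω : ℕ → Type*} [∀ k, MeasurableSpace (Ω k)] (Pr : ∀ k, Measure (Ω k))
    [∀ k, IsProbabilityMeasure (Pr k)]
    (ψ : ∀ k, ℕ → Fin (B k) → Ω k → Fin (T + 1) → Fin (N k) → ℝ)
    (hlaw : ∀ k n μ, HasLaw (ψ k n μ) (P k) (Pr k))
    (hindep : ∀ k, iIndepFun (fun p : ℕ × Fin (B k) => ψ k p.1 p.2) (Pr k))
    -- the TD iterates, their error about `wTD` and their TD errors
    (w : ∀ k, ℕ → Ω k → Fin (N k) → ℝ)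
    (hw : ∀ k n ω, w k n ω =
      TDLearning.iterate γ η (wR k) (w0 k) (fun m μ => ψ k m μ ω) n)
    (Δ : ∀ k, ℕ → Fin (B k) → Fin T → Ω k → ℝ)
    (hΔ : ∀ k n μ t ω, Δ k n μ t ω = TDLearning.tdError γ (wR k) (w k n ω) (ψ k n μ ω) t)
    -- the deterministic theory
    (M : ∀ k, ℕ → Matrix (Fin (N k)) (Fin (N k)) ℝ)
    (hM : ∀ k n, M k n =
      TDLearning.errorCov γ α η (TDLearning.corr (P k)) (wR k) (wTD k) (w0 k) n)
    (Q : ∀ k, ℕ → Fin T → Fin T → ℝ)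
    (hQ : ∀ k n t t', Q k n t t' =
      TDLearning.theoryQ γ α η (TDLearning.corr (P k)) (wR k) (wTD k) (w0 k) n t t')
    (n : ℕ) :
    -- the value error is asymptotically deterministic, equal to `(1/N) Tr (Σ̄ M_n)` (in `L¹`)
    Tendsto (fun k => eLpNorm
        (fun ω => TDLearning.valueError (P k) (wTD k) (w k n ω)
          - (1 / (N k : ℝ)) * (TDLearning.sigmaBar (TDLearning.corr (P k)) * M k n).trace)
        1 (Pr k)) atTop (𝓝 0)
    ∧
    -- `M_n` is the second moment of the weight error, tested against bounded matrices
    ((∀ k i j, Integrable (fun ω => (w k n ω i - wTD k i) * (w k n ω j - wTD k j)) (Pr k)) ∧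
      ∀ (K : ℝ) (G : ∀ k, Matrix (Fin (N k)) (Fin (N k)) ℝ),
        (∀ k (v : Fin (N k) → ℝ), (G k *ᵥ v) ⬝ᵥ (G k *ᵥ v) ≤ K * (v ⬝ᵥ v)) →
        Tendsto (fun k => (1 / (N k : ℝ)) * (G k * (Matrix.of (fun i j =>
            ∫ ω, (w k n ω i - wTD k i) * (w k n ω j - wTD k j) ∂(Pr k)) - M k n)).trace)
          atTop (𝓝 0))
    ∧
    -- the mean weights follow the mean-path dynamics
    (∀ k, 0 < B k → ∀ i, Integrable (fun ω => w k n ω i) (Pr k) ∧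
      ∫ ω, w k n ω i ∂(Pr k) =
        TDLearning.meanWeights γ η (TDLearning.corr (P k)) (wTD k) (w0 k) n i)
    ∧
    -- `Q_n` is the correlation of the TD errors: over the batch (in `L¹`), and in expectation
    (∀ t t' : Fin T,
      Tendsto (fun k => eLpNorm
        (fun ω => (1 / (B k : ℝ)) * ∑ μ, Δ k n μ t ω * Δ k n μ t' ω - Q k n t t')
        1 (Pr k)) atTop (𝓝 0) ∧
      (∀ k μ, Integrable (fun ω => Δ k n μ t ω * Δ k n μ t' ω) (Pr k)) ∧
      ∀ ε > 0, ∀ᶠ k in atTop, ∀ μ, |∫ ω, Δ k n μ t ω * Δ k n μ t' ω ∂(Pr k) - Q k n t t'| ≤ ε)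
    ∧
    -- `Q_n` as a Gaussian average over the weights
    (∀ k, (TDLearning.weightCov γ α η (TDLearning.corr (P k))
          (wR k) (wTD k) (w0 k) n).PosSemidef ∧
      ∀ t t' : Fin T, Q k n t t' = (1 / (N k : ℝ)) *
        ∫ u, ((wR k - WithLp.ofLp u) ⬝ᵥ
              (TDLearning.corr (P k) t.castSucc t'.castSucc *ᵥ (wR k - WithLp.ofLp u))
            + γ * ((wR k - WithLp.ofLp u) ⬝ᵥ
              (TDLearning.corr (P k) t.castSucc t'.succ *ᵥ WithLp.ofLp u))
            + γ * (WithLp.ofLp u ⬝ᵥ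
              (TDLearning.corr (P k) t.succ t'.castSucc *ᵥ (wR k - WithLp.ofLp u)))
            + γ ^ 2 * (WithLp.ofLp u ⬝ᵥ
              (TDLearning.corr (P k) t.succ t'.succ *ᵥ WithLp.ofLp u)))
          ∂(TDLearning.weightGaussian γ α η (TDLearning.corr (P k))
            (wR k) (wTD k) (w0 k) n)) := by
  let s : TDLearning.LearningSequence T γ α C η Pr :=
    { N := N, B := B, P := P, wR := wR, wTD := wTD, w0 := w0, ψ := ψ, T_pos := hT, α_pos := hα,
      tendsto_N := hN, tendsto_B := hB, tendsto_ratio := hBN, gaussian := hP, fixedPoint := hTD,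
      corr_le := hC, reward_le := hR, value_le := hV, initial_le := h0, prob := inferInstance,
      hasLaw := hlaw, indep := hindep }
  have hw' : ∀ k, w k n = s.w k n := fun k => funext (hw k n)
  simp only [hΔ, hM, hQ, hw']
  refine ⟨(s.tendstoL1_valueError n).tendsto_eLpNorm, ⟨fun k i j =>
      ((s.allMoments_error k n i).mul (s.allMoments_error k n j)).integrable, fun K G hG => ?_⟩,
    fun k hk i => ⟨((s.allMoments_w k n).eval i).integrable,
      TDLearning.integral_iterate_eq_meanWeights hk (hlaw k) (hindep k) (hTD k) n i⟩,
    fun t t' => ⟨(s.tendstoL1_batch n t t').tendsto_eLpNorm, fun k μ =>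
      ((s.allMoments_tdError k n μ t).mul (s.allMoments_tdError k n μ t')).integrable,
      fun ε hε => s.eventually_abs_integral_tdError_mul_sub_le n t t' hε⟩, fun k => ?_⟩
  · open scoped Matrix.Norms.L2Operator in
    -- The constant `K` bounds the square of the operator norm and is not assumed nonnegative, hence
    -- the root and the maximum with zero.
    have hn : ∀ k, ‖G k‖ ≤ √(max K 0) := fun k => by
      refine TDLearning.norm_le_of_mulVec_dotProduct_self_le (Real.sqrt_nonneg _) fun v => ?_
      rw [Real.sq_sqrt (le_max_right _ _)]
      exact (hG k v).trans (mul_le_mul_of_nonneg_right (le_max_left _ _)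
        (TDLearning.dotProduct_self_nonneg' v))
    exact s.tendsto_trace_mul_error n hn
  · have hpsd := TDLearning.weightCov_posSemidef (P := P k) (γ := γ) (η := η) (wR := wR k)
      (wTD := wTD k) (w0 := w0 k) hα.le n
    refine ⟨hpsd, fun t t' => ?_⟩
    rw [TDLearning.theoryQ_eq_integral hpsd, ← integral_const_mul]
    simp only [TDLearning.tdCorr_eq]
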